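/- Let $B_r(0)=\{z\in\mathbb{R}^2:|z|<r\}$ and identify $\mathbb{R}^2$ with $\mathbb{C}$. For $u:B_r(0)\to\mathbb{R}$ harmonic, let $Z(u)=\{z\in B_r(0):u(z)=0\}$. A nodal curve of $u$ is a maximal (with respect to inclusion) regular real-analytic curve contained in $Z(u)$. We say that $u$ has boundary value in $L^1$ if there is $g\in L^1([0,2\pi])$ with $\int_0^{2\pi}|u(\rho e^{i\theta})-g(\theta)|\,d\theta\to 0$ as $\rho\to r^-$. Let $n\ge 1$ be an integer and $r_0>0$. Let $\mathcal{H}_n(r_0)$ be the class of all non-constant harmonic functions $u:B_{r_0}(0)\to\mathbb{R}$ with boundary value in $L^1$ and $u(0)=0$, which have exactly $n$ nodal curves in $B_{r_0}(0)$, all of them passing through $0$ (so $u$ has no other nodal curves in $B_{r_0}(0)$). Theorem. For every $u\in\mathcal{H}_n(r_0)$ and every nodal curve $\gamma$ of $u$, the curvature $\kappa(u)|_\gamma(0)$ of $\gamma$ at $0$ satisfies $$\bigl|\kappa(u)|_\gamma(0)\bigr|\le\frac{4(n+1)}{n r_0}.$$ If $n$ is odd, this bound is sharp. If $n$ is even,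 the stronger bound $$\bigl|\kappa(u)|_\gamma(0)\bigr|\le\frac{4(n+1)}{n r_0}\cos\frac{\pi}{2(n+1)}$$ holds, and it is sharp. Here a bound $C$ is called sharp if, for the given $n$ and $r_0$, for every $C'<C$ there are $u\in\mathcal{H}_n(r_0)$ and a nodal curve $\gamma$ of $u$ with $\bigl|\kappa(u)|_\gamma(0)\bigr|>C'$. -/

import Mathlib

open Set Filter Topology

noncomputable section

/-- The nodal set `Z(u)` of a function `u` on the disc `B_r(0)`; the plane is identified with `ℂ`. -/
def nodalSet (r : ℝ) (u : ℂ → ℝ) : Set ℂ :=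
  {z | z ∈ Metric.ball (0 : ℂ) r ∧ u z = 0}

/-- A regular real-analytic parametrized plane curve. The parameter interval is open, so it may be
taken to be the whole line, after an analytic change of parameter. -/
def IsRegularAnalytic (γ : ℝ → ℂ) : Prop :=
  AnalyticOnNhd ℝ γ univ ∧ ∀ t, deriv γ t ≠ 0

/-- `Γ` is an analytic curve (the trace of a regular analytic parametrized curve) lying in `S`. -/
def IsAnalyticCurveIn (S Γ : Set ℂ) : Prop :=
  (∃ γ : ℝ → ℂ, IsRegularAnalytic γ ∧ range γ = Γ) ∧ Γ ⊆ S

/-- The nodal curves of `u` in `B_r(0)`: the maximal analytic curves contained in the nodal set. -/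
def IsNodalCurve (r : ℝ) (u : ℂ → ℝ) (Γ : Set ℂ) : Prop :=
  Maximal (IsAnalyticCurveIn (nodalSet r u)) Γ

/-- The signed curvature `(x' y'' - y' x'') / |γ'|³` of a parametrized plane curve `γ = x + i y`. -/
def signedCurvature (γ : ℝ → ℂ) (t : ℝ) : ℝ :=
  ((deriv γ t).re * (deriv (deriv γ) t).im - (deriv γ t).im * (deriv (deriv γ) t).re)
    / ‖deriv γ t‖ ^ 3

/-- `κ` is the curvature of the analytic curve `Γ` at its point `p`, for one of the orientations
of `Γ`; reversing the orientation changes the sign of `κ` only. -/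
def HasCurvatureAt (Γ : Set ℂ) (p : ℂ) (κ : ℝ) : Prop :=
  ∃ γ : ℝ → ℂ, IsRegularAnalytic γ ∧ range γ = Γ ∧ ∃ t, γ t = p ∧ signedCurvature γ t = κ

/-- `u`, given on `B_r(0)`, has a boundary value in `L¹`: its restrictions to the circles of
radius `ρ < r` converge in `L¹` of the angle, as `ρ → r`, to an integrable function `g`. -/
def HasL1BoundaryValue (r : ℝ) (u : ℂ → ℝ) : Prop :=
  ∃ g : ℝ → ℝ, IntervalIntegrable g MeasureTheory.volume 0 (2 * Real.pi) ∧
    Tendsto (fun ρ : ℝ => ∫ θ in (0 : ℝ)..(2 * Real.pi), |u (circleMap 0 ρ θ) - g θ|)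
      (𝓝[<] r) (𝓝 0)

/-- The functions under consideration: non-constant harmonic functions on `B_r(0)` with an `L¹`
boundary value and `u 0 = 0`, which have exactly `n` nodal curves in `B_r(0)`, all of them
passing through `0`. -/
structure IsAdmissible (n : ℕ) (r : ℝ) (u : ℂ → ℝ) : Prop where
  harmonic : InnerProductSpace.HarmonicOnNhd u (Metric.ball (0 : ℂ) r)
  nonconst : ¬ ∃ c : ℝ, ∀ z ∈ Metric.ball (0 : ℂ) r, u z = c
  boundary : HasL1BoundaryValue r u
  map_zero : u 0 = 0
  card_nodal : {Γ : Set ℂ | IsNodalCurve r u Γ}.encard = n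
  through_zero : ∀ Γ : Set ℂ, IsNodalCurve r u Γ → (0 : ℂ) ∈ Γ

/-- `C` bounds the absolute curvature at `0` of all nodal curves of all admissible functions. -/
def IsCurvatureBound (n : ℕ) (r C : ℝ) : Prop :=
  ∀ u : ℂ → ℝ, IsAdmissible n r u → ∀ Γ : Set ℂ, IsNodalCurve r u Γ →
    ∀ κ : ℝ, HasCurvatureAt Γ 0 κ → |κ| ≤ C

/-- `C` cannot be replaced by a smaller bound: absolute curvatures at `0` of nodal curves of
admissible functions come arbitrarily close to `C`, or exceed it. -/
def IsSharpCurvatureBound (n : ℕ) (r C : ℝ) : Prop :=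
  ∀ C' : ℝ, C' < C → ∃ u : ℂ → ℝ, IsAdmissible n r u ∧ ∃ Γ : Set ℂ, IsNodalCurve r u Γ ∧
    ∃ κ : ℝ, HasCurvatureAt Γ 0 κ ∧ C' < |κ|

end

/-! Write u = Re f with f holomorphic and f 0 = 0. Near any zero of u, f is a power in a suitable
chart (`IsPowerChart`), so the nodal set is locally a bundle of analytic arcs crossing at equal
angles. By the maximum principle the nodal set contains no loop (`IsNonconstHolo.no_loop`). If all
nodal curves pass through 0, it follows that 0 is the only possible critical point of f on the nodal
set, that the number n of nodal curves is the order of f at 0 (`encard_nodal`), so f = z^n h with h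
0 ≠ 0, and that every component of {u > 0} and of {u < 0} has 0 on its boundary
(`zero_mem_closure`).

Consequently the boundary function g changes sign at most 2n times. With more changes, two of n + 1
positive radii would end in the same positive component, because only n positive sectors meet at 0;
the negative components between them are joined through 0, which is topologically impossible
(`crosscut`, `no_alternating`). By Fatou's theorem (`ae_tendsto_radial`) there are angles θ_k such
that g times T(x) = ∏ sin((x - θ_k)/2), with 2n factors, has constant sign almost everywhere.

Integrate g T against 1 + cos(x - φ) ≥ 0. Since T = c z^{-n} Q(z) on the unit circle, with Q a
polynomial, the factor z^n of f is cancelled and the integral involves only h 0 and h' 0. Optimizing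
in φ gives |r h'(0) - h(0) Σ e^{-iθ_k}| ≤ 2 |Re(e^{iΣθ_k/2} h(0))| (`coefficient_inequality`).
Expanding Re(γ^n h(γ)) = 0 to second order expresses the curvature through h 0 and h' 0
(`signedCurvature_eq`), and with y_k = θ_k - arg γ' one gets n r |κ| ≤ 2 (|Σ sin y_k| + 2 |sin(Σ y_k
/ 2)|). The right side is at most 4(n + 1). For even n the terms cannot all be extremal: the sum in
parentheses is a sum of 2n + 2 cosines whose angles add up to an odd multiple of π, hence at most
(2n + 2) cos(π/(2n + 2)) (`sum_cos_le`).

For sharpness take f = z^n (E + Ē z)/(1 - z)^{2n+1} with |E| = 1 and (iE)^{n+1} = ±1, namely E = 1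
for odd n and E = e^{iπ/(2(n+1))} for even n. On its nodal set Re(z f'/f) > 0
(`extremalLogDeriv_re_pos`), so |z| is strictly monotone along nodal curves away from 0 and all of
them reach 0 (`IsNonconstHolo.curvesThroughZero`). Dilations z ↦ f(az) with a r < 1 are analytic
beyond the closed disc, and their curvatures in the direction iE tend to the bound as a r → 1. -/

/-! ### Real-analytic functions and arc length -/

/-- A real-analytic function of one variable is near each point the restriction of a holomorphic
function. -/
lemma AnalyticAt.exists_complex_extension {f : ℝ → ℝ} {x : ℝ} (hf : AnalyticAt ℝ f x) :
    ∃ g : ℂ → ℂ, AnalyticAt ℂ g x ∧ ∀ᶠ t : ℝ in 𝓝 x, g t = f t := by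
  obtain ⟨p, hp⟩ := hf
  rw [hasFPowerSeriesAt_iff] at hp
  let c : ℕ → ℂ := fun n => (p.coeff n : ℂ)
  let G : ℂ → ℂ := fun z => ∑' n, (z - x) ^ n * c n
  obtain ⟨ε, hε, hball⟩ := Metric.eventually_nhds_iff.1 hp
  -- Convergence at the single real point ε/2 bounds the terms there; inside that radius a geometric
  -- series dominates.
  have hG : ∀ z : ℂ, ‖z‖ < ε / 2 → Summable fun n => z ^ n * c n := by
    intro z hz
    have h1 := (hball (y := ε / 2) (by simp [abs_of_pos hε]; linarith)).summable
    obtain ⟨C, hC⟩ := (h1.tendsto_atTop_zero.norm.bddAbove_range)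
    have hC' : ∀ n, ‖(ε / 2) ^ n • p.coeff n‖ ≤ C := fun n => hC ⟨n, rfl⟩
    have hq : ‖z‖ / (ε / 2) < 1 := (div_lt_one (by positivity)).2 hz
    refine Summable.of_norm_bounded
      ((summable_geometric_of_lt_one (by positivity) hq).mul_left C) fun n => ?_
    have := hC' n
    simp only [smul_eq_mul, norm_mul, norm_pow, Real.norm_eq_abs, c, Complex.norm_real] at this ⊢
    rw [abs_of_pos (by positivity : 0 < ε / 2)] at this
    rw [div_pow, mul_div_assoc', le_div_iff₀ (by positivity)]
    have h3 : (0 : ℝ) ≤ ‖z‖ ^ n := by positivity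
    nlinarith
  refine ⟨G, ⟨FormalMultilinearSeries.ofScalars ℂ c, ?_⟩, ?_⟩
  · rw [hasFPowerSeriesAt_iff]
    filter_upwards [Metric.ball_mem_nhds (0 : ℂ) (half_pos hε)] with z hz
    have := (hG z (by simpa using hz)).hasSum
    simpa [G, FormalMultilinearSeries.coeff_ofScalars] using this
  · have h1 : ∀ᶠ t : ℝ in 𝓝 x, dist t x < ε := Metric.eventually_nhds_iff.2 ⟨ε, hε, fun _ h => h⟩
    filter_upwards [h1] with t ht
    have h2 := hball (y := t - x) (by simpa [Real.dist_eq] using ht)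
    have h3 := (Complex.hasSum_ofReal (f := fun n => (t - x) ^ n • p.coeff n)).2 h2
    simp only [add_sub_cancel] at h3
    simp only [G, c]
    rw [← h3.tsum_eq]
    congr 1
    ext n
    simp

/-- A primitive of a real-analytic function is real-analytic. -/
lemma AnalyticAt.of_hasDerivAt {F f : ℝ → ℝ} {x : ℝ} (hf : AnalyticAt ℝ f x)
    (hF : ∀ᶠ t in 𝓝 x, HasDerivAt F (f t) t) : AnalyticAt ℝ F x := by
  obtain ⟨g, hg, hgf⟩ := hf.exists_complex_extension
  obtain ⟨ε, hε, hgε⟩ := hg.exists_ball_analyticOnNhd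
  -- Integrate the holomorphic extension instead: the real part of `G` on the line is analytic and
  -- has the same derivative as `F`, so the two differ by a constant.
  obtain ⟨G, hG⟩ := hgε.differentiableOn.isExactOn_ball
  have hGan : AnalyticAt ℂ G x := by
    have : DifferentiableOn ℂ G (Metric.ball (x : ℂ) ε) := fun z hz =>
      (hG z hz).differentiableAt.differentiableWithinAt
    exact this.analyticAt (Metric.ball_mem_nhds _ hε)
  have hR : AnalyticAt ℝ (fun t : ℝ => (G t).re) x := by
    have h1 : AnalyticAt ℝ G (Complex.ofRealCLM x) := hGan.restrictScalars
    exact (Complex.reCLM.analyticAt _).comp (h1.comp (Complex.ofRealCLM.analyticAt x))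
  have hball : ∀ᶠ t : ℝ in 𝓝 x, (t : ℂ) ∈ Metric.ball (x : ℂ) ε := by
    refine Metric.eventually_nhds_iff.2 ⟨ε, hε, fun y hy => ?_⟩
    rw [Metric.mem_ball, Complex.dist_eq, ← Complex.ofReal_sub, Complex.norm_real]
    exact hy
  obtain ⟨δ, hδ, hd⟩ := Metric.eventually_nhds_iff_ball.1 ((hF.and hgf).and hball)
  have hder : ∀ t ∈ Metric.ball x δ, HasDerivAt (fun t : ℝ => F t - (G t).re) 0 t := by
    intro t ht
    obtain ⟨⟨h1, h2⟩, h3⟩ := hd t ht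
    have h4 := (hG _ h3).real_of_complex
    rw [h2, Complex.ofReal_re] at h4
    have h5 := h1.sub h4
    rw [sub_self] at h5
    exact h5
  have hconst : ∀ t ∈ Metric.ball x δ, F t = (G t).re + (F x - (G x).re) := by
    intro t ht
    have := Metric.isOpen_ball.is_const_of_deriv_eq_zero (convex_ball x δ).isPreconnected
      (fun s hs => (hder s hs).differentiableAt.differentiableWithinAt)
      (fun s hs => (hder s hs).deriv) ht (Metric.mem_ball_self hδ)
    linarith
  refine (hR.add (analyticAt_const (v := F x - (G x).re))).congr ?_
  filter_upwards [Metric.ball_mem_nhds x hδ] with t ht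
  simp [hconst t ht]

/-- Makes the speed of a regular analytic curve analytic, and hence its arc length, by
`AnalyticAt.of_hasDerivAt`. -/
lemma AnalyticAt.norm_complex {γ : ℝ → ℂ} {t : ℝ} (h : AnalyticAt ℝ γ t) (h0 : γ t ≠ 0) :
    AnalyticAt ℝ (fun s => ‖γ s‖) t := by
  have hre : AnalyticAt ℝ (fun s => (γ s).re) t := (Complex.reCLM.analyticAt _).comp h
  have him : AnalyticAt ℝ (fun s => (γ s).im) t := (Complex.imCLM.analyticAt _).comp h
  have hsq : AnalyticAt ℝ (fun s => (γ s).re * (γ s).re + (γ s).im * (γ s).im) t :=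
    (hre.mul hre).add (him.mul him)
  have hne : (γ t).re * (γ t).re + (γ t).im * (γ t).im ≠ 0 := by
    rw [← Complex.normSq_apply]; exact (Complex.normSq_pos.2 h0).ne'
  refine ((hsq.contDiffAt (n := ⊤)).sqrt hne).analyticAt.congr (Eventually.of_forall fun s => ?_)
  simp [Complex.norm_def, Complex.normSq_apply]

/-- Arc length reparametrization of a regular analytic curve. -/
lemma exists_unit_speed {γ : ℝ → ℂ} {J : Set ℝ} (hJo : IsOpen J) (hJc : IsPreconnected J)
    (hγ : AnalyticOnNhd ℝ γ J) (hγ' : ∀ t ∈ J, deriv γ t ≠ 0) {t₀ : ℝ} (ht₀ : t₀ ∈ J) :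
    ∃ (A : ℝ → ℝ) (σ : ℝ → ℂ), A t₀ = 0 ∧ (∀ t ∈ J, HasDerivAt A ‖deriv γ t‖ t) ∧
      IsOpen (A '' J) ∧ IsPreconnected (A '' J) ∧ AnalyticOnNhd ℝ σ (A '' J) ∧
      (∀ t ∈ J, σ (A t) = γ t) ∧ ∀ t ∈ J, HasDerivAt σ (deriv γ t / ‖deriv γ t‖) (A t) := by
  let A : ℝ → ℝ := fun t => ∫ s in t₀..t, ‖deriv γ s‖
  have hcont : ContinuousOn (fun s => ‖deriv γ s‖) J := fun t ht =>
    ((hγ t ht).deriv.continuousAt.norm).continuousWithinAt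
  have hA : ∀ t ∈ J, HasDerivAt A ‖deriv γ t‖ t := by
    intro t ht
    have hsub : uIcc t₀ t ⊆ J := hJc.ordConnected.uIcc_subset ht₀ ht
    refine intervalIntegral.integral_hasDerivAt_right
      ((hcont.mono hsub).intervalIntegrable) ?_ (hcont.continuousAt (hJo.mem_nhds ht))
    exact hcont.stronglyMeasurableAtFilter hJo _ ht
  have hAan : ∀ t ∈ J, AnalyticAt ℝ A t := fun t ht =>
    ((hγ t ht).deriv.norm_complex (hγ' t ht)).of_hasDerivAt
      (by filter_upwards [hJo.mem_nhds ht] with s hs using hA s hs)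
  have hpos : ∀ t ∈ J, 0 < ‖deriv γ t‖ := fun t ht => norm_pos_iff.2 (hγ' t ht)
  have hcA : ContinuousOn A J := fun t ht => (hA t ht).continuousAt.continuousWithinAt
  have hmono : StrictMonoOn A J := by
    refine strictMonoOn_of_deriv_pos hJc.ordConnected.convex hcA fun t ht => ?_
    rw [(hA t (interior_subset ht)).deriv]
    exact hpos t (interior_subset ht)
  have hopen : IsOpen (A '' J) := by
    rw [isOpen_iff_mem_nhds]
    rintro _ ⟨t, ht, rfl⟩
    have h1 := (hAan t ht).hasStrictDerivAt
    rw [← h1.map_nhds_eq (by rw [(hA t ht).deriv]; exact (hpos t ht).ne')]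
    exact image_mem_map (hJo.mem_nhds ht)
  let σ : ℝ → ℂ := fun s => γ (Function.invFunOn A J s)
  have hσ : ∀ t ∈ J, σ (A t) = γ t := fun t ht => by
    simp only [σ]
    rw [hmono.injOn.leftInvOn_invFunOn ht]
  -- Analyticity passes from γ = σ ∘ A to σ because A' ≠ 0.
  have hσan : ∀ t ∈ J, AnalyticAt ℝ σ (A t) := by
    intro t ht
    rw [← analyticAt_comp_iff_of_deriv_ne_zero (hAan t ht)
      (by rw [(hA t ht).deriv]; exact (hpos t ht).ne')]
    refine (hγ t ht).congr ?_
    filter_upwards [hJo.mem_nhds ht] with s hs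
    exact (hσ s hs).symm
  refine ⟨A, σ, by simp [A], hA, hopen, hJc.image _ hcA, ?_, hσ, fun t ht => ?_⟩
  · rintro _ ⟨t, ht, rfl⟩
    exact hσan t ht
  · have h1 : HasDerivAt (σ ∘ A) (‖deriv γ t‖ • deriv σ (A t)) t :=
      (hσan t ht).differentiableAt.hasDerivAt.scomp t (hA t ht)
    have h2 : HasDerivAt (σ ∘ A) (deriv γ t) t := by
      refine (hγ t ht).differentiableAt.hasDerivAt.congr_of_eventuallyEq ?_
      filter_upwards [hJo.mem_nhds ht] with s hs
      exact hσ s hs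
    have h3 := h1.unique h2
    have h4 : deriv γ t / ‖deriv γ t‖ = deriv σ (A t) := by
      rw [div_eq_iff (by exact_mod_cast (hpos t ht).ne'), mul_comm, ← Complex.real_smul, h3]
    rw [h4]
    exact (hσan t ht).differentiableAt.hasDerivAt

/-- Every nonempty open interval is the image of the line under an analytic diffeomorphism. -/
lemma exists_analytic_range_eq {I : Set ℝ} (ho : IsOpen I) (hc : IsPreconnected I)
    (hne : I.Nonempty) :
    ∃ T : ℝ → ℝ, AnalyticOnNhd ℝ T univ ∧ (∀ x, deriv T x ≠ 0) ∧ range T = I := by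
  have hexp : ∀ x : ℝ, HasDerivAt (fun x => Real.exp (-x)) (-Real.exp (-x)) x := fun x => by
    simpa using (hasDerivAt_neg x).exp
  have hexpan : ∀ x : ℝ, AnalyticAt ℝ (fun x => Real.exp (-x)) x := fun x =>
    analyticAt_id.neg.rexp'
  have key : (∃ a b, a < b ∧ I = Ioo a b) ∨ (∃ a, I = Ioi a) ∨ (∃ b, I = Iio b) ∨ I = univ := by
    have hI : I = interior I := ho.interior_eq.symm
    have hoo : ∀ a b, I = Ioo a b → ∃ a b, a < b ∧ I = Ioo a b := fun a b h => by
      rw [h] at hne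
      exact ⟨a, b, nonempty_Ioo.1 hne, h⟩
    have := hc.mem_intervals
    simp only [mem_insert_iff, mem_singleton_iff] at this
    rcases this with h | h | h | h | h | h | h | h | h | h
    · exact Or.inl (hoo _ _ (by rw [h, interior_Icc] at hI; exact h.trans hI))
    · exact Or.inl (hoo _ _ (by rw [h, interior_Ico] at hI; exact h.trans hI))
    · exact Or.inl (hoo _ _ (by rw [h, interior_Ioc] at hI; exact h.trans hI))
    · exact Or.inl (hoo _ _ h)
    · exact Or.inr (Or.inl ⟨_, by rw [h, interior_Ici] at hI; exact h.trans hI⟩)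
    · exact Or.inr (Or.inl ⟨_, h⟩)
    · exact Or.inr (Or.inr (Or.inl ⟨_, by rw [h, interior_Iic] at hI; exact h.trans hI⟩))
    · exact Or.inr (Or.inr (Or.inl ⟨_, h⟩))
    · exact Or.inr (Or.inr (Or.inr h))
    · exact absurd h hne.ne_empty
  rcases key with ⟨a, b, hab, rfl⟩ | ⟨a, rfl⟩ | ⟨b, rfl⟩ | rfl
  · have hpos : ∀ x : ℝ, 0 < 1 + Real.exp (-x) := fun x => by positivity
    have hd : ∀ x : ℝ, HasDerivAt (fun x => a + (b - a) / (1 + Real.exp (-x)))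
        ((b - a) * Real.exp (-x) / (1 + Real.exp (-x)) ^ 2) x := fun x => by
      have := ((((hexp x).const_add 1).fun_inv (hpos x).ne').const_mul (b - a)).const_add a
      exact this.congr_deriv (by ring)
    refine ⟨fun x => a + (b - a) / (1 + Real.exp (-x)), fun x _ => ?_, fun x => ?_, ?_⟩
    · exact analyticAt_const.add (analyticAt_const.div (analyticAt_const.add (hexpan x))
        (hpos x).ne')
    · rw [(hd x).deriv]
      have := sub_pos.2 hab
      positivity
    · ext y
      simp only [mem_range, mem_Ioo]
      constructor
      · rintro ⟨x, rfl⟩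
        have h1 : 0 < (b - a) / (1 + Real.exp (-x)) := div_pos (sub_pos.2 hab) (hpos x)
        have h2 : (b - a) / (1 + Real.exp (-x)) < b - a :=
          div_lt_self (sub_pos.2 hab) (by linarith [Real.exp_pos (-x)])
        exact ⟨by linarith, by linarith⟩
      · rintro ⟨h1, h2⟩
        refine ⟨-Real.log ((b - y) / (y - a)), ?_⟩
        rw [neg_neg, Real.exp_log (by positivity)]
        have h5 : b - a ≠ 0 := (sub_pos.2 hab).ne'
        field_simp
        ring
  · refine ⟨fun x => a + Real.exp (-x), fun x _ => analyticAt_const.add (hexpan x), fun x => ?_, ?_⟩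
    · rw [((hexp x).const_add a).deriv]; simp
    · ext y
      simp only [mem_range, mem_Ioi]
      refine ⟨?_, fun h => ⟨-Real.log (y - a), ?_⟩⟩
      · rintro ⟨x, rfl⟩; linarith [Real.exp_pos (-x)]
      · rw [neg_neg, Real.exp_log (by linarith)]; ring
  · refine ⟨fun x => b - Real.exp (-x), fun x _ => analyticAt_const.sub (hexpan x), fun x => ?_, ?_⟩
    · rw [((hexp x).const_sub b).deriv]; simp
    · ext y
      simp only [mem_range, mem_Iio]
      refine ⟨?_, fun h => ⟨-Real.log (b - y), ?_⟩⟩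
      · rintro ⟨x, rfl⟩; linarith [Real.exp_pos (-x)]
      · rw [neg_neg, Real.exp_log (by linarith)]; ring
  · exact ⟨id, analyticOnNhd_id, by simp, range_id⟩

/-! ### Power charts of a holomorphic function -/

/-- A holomorphic chart `ψ` at `p` with inverse `φ`, in which `f` is the power `f p + w ^ m`. -/
structure IsPowerChart (f : ℂ → ℂ) (U : Set ℂ) (p : ℂ) (m : ℕ) (ε : ℝ) (ψ φ : ℂ → ℂ) : Prop where
  pos : 0 < ε
  one_le : 1 ≤ m
  analytic : AnalyticOnNhd ℂ ψ (Metric.ball 0 ε)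
  map_zero : ψ 0 = p
  left_inv : ∀ w ∈ Metric.ball (0 : ℂ) ε, φ (ψ w) = w
  analytic_inv : ∀ w ∈ Metric.ball (0 : ℂ) ε, AnalyticAt ℂ φ (ψ w)
  right_inv : ∀ᶠ z in 𝓝 p, φ z ∈ Metric.ball (0 : ℂ) ε ∧ ψ (φ z) = z
  eq_pow : ∀ w ∈ Metric.ball (0 : ℂ) ε, f (ψ w) = f p + w ^ m
  maps : ∀ w ∈ Metric.ball (0 : ℂ) ε, ψ w ∈ U

/-- Factor f - f p = (z - p)^m g with g p ≠ 0 and take φ = (z - p) g^{1/m}. Near p the quotient g /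
g p is close to 1, so the principal logarithm supplies the root. -/
lemma AnalyticAt.exists_eq_add_pow {f : ℂ → ℂ} {p : ℂ} (hf : AnalyticAt ℂ f p)
    (hne : ¬ ∀ᶠ z in 𝓝 p, f z = f p) :
    ∃ (m : ℕ) (φ : ℂ → ℂ), 1 ≤ m ∧ AnalyticAt ℂ φ p ∧ φ p = 0 ∧ deriv φ p ≠ 0 ∧
      ∀ᶠ z in 𝓝 p, f z = f p + φ z ^ m := by
  have h1 : AnalyticAt ℂ (fun z => f z - f p) p := hf.sub analyticAt_const
  obtain ⟨m, g, hg, hg0, hgf⟩ := (h1.exists_eventuallyEq_pow_smul_nonzero_iff).2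
    (fun h => hne (h.mono fun z hz => sub_eq_zero.1 hz))
  have hm : m ≠ 0 := by
    rintro rfl
    have := hgf.self_of_nhds
    simp at this
    exact hg0 this.symm
  obtain ⟨c, hc⟩ : ∃ c : ℂ, c ^ m = g p := ⟨g p ^ ((m : ℂ)⁻¹), Complex.cpow_nat_inv_pow _ hm⟩
  have hc0 : c ≠ 0 := by rintro rfl; rw [zero_pow hm] at hc; exact hg0 hc.symm
  let h : ℂ → ℂ := fun z => c * Complex.exp (Complex.log (g z / g p) / m)
  have hquot : AnalyticAt ℂ (fun z => g z / g p) p := hg.div analyticAt_const hg0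
  have hh : AnalyticAt ℂ h p := by
    refine analyticAt_const.mul (((hquot.clog ?_).div analyticAt_const ?_).cexp')
    · simp [hg0]
    · exact_mod_cast hm
  have hhp : h p = c := by simp [h, hg0]
  refine ⟨m, fun z => (z - p) * h z, Nat.one_le_iff_ne_zero.2 hm,
    (analyticAt_id.sub analyticAt_const).mul hh, by simp, ?_, ?_⟩
  · have : HasDerivAt (fun z => (z - p) * h z) (1 * h p + (p - p) * deriv h p) p :=
      ((hasDerivAt_id p).sub_const p).mul hh.differentiableAt.hasDerivAt
    rw [this.deriv, hhp]
    simpa using hc0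
  · have h2 : ∀ᶠ z in 𝓝 p, g z ≠ 0 := hg.continuousAt.eventually_ne hg0
    filter_upwards [hgf, h2] with z hz hz2
    have h3 : h z ^ m = g z := by
      simp only [h]
      rw [mul_pow, hc, ← Complex.exp_nat_mul, mul_div_cancel₀ _ (by exact_mod_cast hm),
        Complex.exp_log (div_ne_zero hz2 hg0)]
      field_simp
    rw [mul_pow, h3, ← smul_eq_mul, ← hz]
    ring

/-- The inverse function theorem for the root φ of `AnalyticAt.exists_eq_add_pow`; the radius is
shrunk until all required properties hold together. -/
lemma exists_powerChart {f : ℂ → ℂ} {U : Set ℂ} {p : ℂ} (hU : U ∈ 𝓝 p) (hf : AnalyticAt ℂ f p)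
    (hne : ¬ ∀ᶠ z in 𝓝 p, f z = f p) :
    ∃ (m : ℕ) (ε : ℝ) (ψ φ : ℂ → ℂ), IsPowerChart f U p m ε ψ φ := by
  obtain ⟨m, φ, hm, hφ, hφ0, hφ', hfφ⟩ := hf.exists_eq_add_pow hne
  let ψ := hφ.hasStrictDerivAt.localInverse _ _ _ hφ'
  have hψ : AnalyticAt ℂ ψ 0 := by
    have := hφ.analyticAt_localInverse hφ'
    rwa [hφ0] at this
  have hψ0 : ψ 0 = p := by
    have : ψ (φ p) = p := HasStrictFDerivAt.localInverse_apply_image ..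
    rwa [hφ0] at this
  have hleft : ∀ᶠ z in 𝓝 p, ψ (φ z) = z := HasStrictDerivAt.eventually_left_inverse ..
  have hright : ∀ᶠ w in 𝓝 (0 : ℂ), φ (ψ w) = w := by
    have : ∀ᶠ w in 𝓝 (φ p), φ (ψ w) = w := HasStrictDerivAt.eventually_right_inverse ..
    rwa [hφ0] at this
  have hψt : Tendsto ψ (𝓝 0) (𝓝 p) := by simpa [hψ0] using hψ.continuousAt.tendsto
  have hall : ∀ᶠ w in 𝓝 (0 : ℂ), AnalyticAt ℂ ψ w ∧ φ (ψ w) = w ∧ AnalyticAt ℂ φ (ψ w) ∧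
      f (ψ w) = f p + φ (ψ w) ^ m ∧ ψ w ∈ U := by
    filter_upwards [hψ.eventually_analyticAt, hright, hψt.eventually hφ.eventually_analyticAt,
      hψt.eventually hfφ, hψt.eventually hU] with w h1 h2 h3 h4 h5
    exact ⟨h1, h2, h3, h4, h5⟩
  obtain ⟨ε, hε, hb⟩ := Metric.eventually_nhds_iff_ball.1 hall
  refine ⟨m, ε, ψ, φ, hε, hm, fun w hw => (hb w hw).1, hψ0, fun w hw => (hb w hw).2.1,
    fun w hw => (hb w hw).2.2.1, ?_, fun w hw => ?_, fun w hw => (hb w hw).2.2.2.2⟩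
  · have h6 : ∀ᶠ z in 𝓝 p, φ z ∈ Metric.ball (0 : ℂ) ε :=
      hφ.continuousAt.eventually (by rw [hφ0]; exact Metric.ball_mem_nhds _ hε)
    exact h6.and hleft
  · rw [(hb w hw).2.2.2.1, (hb w hw).2.1]

namespace IsPowerChart

variable {f : ℂ → ℂ} {U : Set ℂ} {p : ℂ} {m : ℕ} {ε : ℝ} {ψ φ : ℂ → ℂ}

lemma mono (h : IsPowerChart f U p m ε ψ φ) {δ : ℝ} (hδ : 0 < δ) (hδε : δ ≤ ε) :
    IsPowerChart f U p m δ ψ φ := by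
  have hs : Metric.ball (0 : ℂ) δ ⊆ Metric.ball 0 ε := Metric.ball_subset_ball hδε
  have h0 : (0 : ℂ) ∈ Metric.ball (0 : ℂ) ε := Metric.mem_ball_self h.pos
  have hφ : ContinuousAt φ p := h.map_zero ▸ (h.analytic_inv 0 h0).continuousAt
  have hφ0 : φ p = 0 := by rw [← h.map_zero]; exact h.left_inv 0 h0
  refine ⟨hδ, h.one_le, h.analytic.mono hs, h.map_zero, fun w hw => h.left_inv w (hs hw),
    fun w hw => h.analytic_inv w (hs hw), ?_, fun w hw => h.eq_pow w (hs hw),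
    fun w hw => h.maps w (hs hw)⟩
  have h6 : ∀ᶠ z in 𝓝 p, φ z ∈ Metric.ball (0 : ℂ) δ :=
    hφ.eventually (by rw [hφ0]; exact Metric.ball_mem_nhds _ hδ)
  filter_upwards [h6, h.right_inv] with z h1 h2 using ⟨h1, h2.2⟩

lemma zero_mem (h : IsPowerChart f U p m ε ψ φ) : (0 : ℂ) ∈ Metric.ball (0 : ℂ) ε :=
  Metric.mem_ball_self h.pos

lemma inv_center (h : IsPowerChart f U p m ε ψ φ) : φ p = 0 := by
  rw [← h.map_zero]; exact h.left_inv 0 h.zero_mem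

lemma analyticAt_inv (h : IsPowerChart f U p m ε ψ φ) : AnalyticAt ℂ φ p :=
  h.map_zero ▸ h.analytic_inv 0 h.zero_mem

lemma deriv_mul_deriv (h : IsPowerChart f U p m ε ψ φ) {w : ℂ} (hw : w ∈ Metric.ball (0 : ℂ) ε) :
    deriv φ (ψ w) * deriv ψ w = 1 := by
  have h1 := ((h.analytic_inv w hw).differentiableAt.hasDerivAt).comp w
    (h.analytic w hw).differentiableAt.hasDerivAt
  refine h1.unique ((hasDerivAt_id w).congr_of_eventuallyEq ?_)
  filter_upwards [Metric.isOpen_ball.mem_nhds hw] with x hx using h.left_inv x hx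

lemma deriv_ne_zero (h : IsPowerChart f U p m ε ψ φ) {w : ℂ} (hw : w ∈ Metric.ball (0 : ℂ) ε) :
    deriv ψ w ≠ 0 := right_ne_zero_of_mul_eq_one (h.deriv_mul_deriv hw)

lemma deriv_inv_ne_zero (h : IsPowerChart f U p m ε ψ φ) : deriv φ p ≠ 0 := by
  have := left_ne_zero_of_mul_eq_one (h.deriv_mul_deriv h.zero_mem)
  rwa [h.map_zero] at this

/-- Chain rule in `eq_pow`. Since ψ' ≠ 0, it shows that f is critical in the chart at most at the
centre, and there exactly when m ≥ 2. -/
lemma deriv_comp (h : IsPowerChart f U p m ε ψ φ) (hf : AnalyticOnNhd ℂ f U) {w : ℂ}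
    (hw : w ∈ Metric.ball (0 : ℂ) ε) :
    deriv f (ψ w) * deriv ψ w = m * w ^ (m - 1) := by
  have h1 := ((hf _ (h.maps w hw)).differentiableAt.hasDerivAt).comp w
    (h.analytic w hw).differentiableAt.hasDerivAt
  refine h1.unique (((hasDerivAt_pow m w).const_add (f p)).congr_of_eventuallyEq ?_)
  filter_upwards [Metric.isOpen_ball.mem_nhds hw] with x hx using h.eq_pow x hx

lemma deriv_ne_zero_of_ne (h : IsPowerChart f U p m ε ψ φ) (hf : AnalyticOnNhd ℂ f U) {w : ℂ}
    (hw : w ∈ Metric.ball (0 : ℂ) ε) (hw0 : w ≠ 0) : deriv f (ψ w) ≠ 0 := by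
  have h1 := h.deriv_comp hf hw
  intro h2
  rw [h2, zero_mul] at h1
  have h3 : (m : ℂ) ≠ 0 := by exact_mod_cast (Nat.one_le_iff_ne_zero.1 h.one_le)
  exact mul_ne_zero h3 (pow_ne_zero _ hw0) h1.symm

lemma eq_one_of_deriv_ne_zero (h : IsPowerChart f U p m ε ψ φ) (hf : AnalyticOnNhd ℂ f U)
    (hd : deriv f p ≠ 0) : m = 1 := by
  have h1 := h.deriv_comp hf h.zero_mem
  rw [h.map_zero] at h1
  by_contra hm
  have h2 : m - 1 ≠ 0 := by have := h.one_le; omega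
  rw [zero_pow h2, mul_zero] at h1
  exact mul_ne_zero hd (h.deriv_ne_zero h.zero_mem) h1

/-- A chart maps neighbourhoods of `0` to neighbourhoods of the centre. -/
lemma image_mem_nhds (h : IsPowerChart f U p m ε ψ φ) {V : Set ℂ} (hV : V ∈ 𝓝 (0 : ℂ)) :
    ψ '' V ∈ 𝓝 p := by
  have h1 : ∀ᶠ z in 𝓝 p, φ z ∈ V :=
    h.analyticAt_inv.continuousAt.eventually (by rw [h.inv_center]; exact hV)
  filter_upwards [h1, h.right_inv] with z h2 h3 using ⟨φ z, h2, h3.2⟩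

end IsPowerChart

/-! ### The nodal set inside a power chart -/

/-- A number close to `1` with a real power is real. -/
lemma eventually_im_eq_zero_of_pow {m : ℕ} (hm : 1 ≤ m) :
    ∀ᶠ x : ℂ in 𝓝 1, (x ^ m).im = 0 → x.im = 0 := by
  have hd : HasStrictDerivAt (fun x : ℂ => x ^ m) ((m : ℂ) * 1 ^ (m - 1)) 1 :=
    hasStrictDerivAt_pow m 1
  have hne : (m : ℂ) * 1 ^ (m - 1) ≠ 0 := by
    simpa using (Nat.one_le_iff_ne_zero.1 hm)
  have h1 : ∀ᶠ x : ℂ in 𝓝 1, hd.localInverse _ _ _ hne (x ^ m) = x :=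
    hd.eventually_left_inverse hne
  have h2 : Tendsto (starRingEnd ℂ) (𝓝 (1 : ℂ)) (𝓝 1) := by
    simpa using (Complex.continuous_conj.tendsto (1 : ℂ))
  filter_upwards [h1, h2.eventually h1] with x hx hx2 him
  -- Both x and its conjugate are near 1 and have the same power, and near 1 the power map is
  -- injective.
  have h3 : (starRingEnd ℂ x) ^ m = x ^ m := by
    rw [← map_pow]; exact Complex.conj_eq_iff_im.2 him
  rw [h3, hx] at hx2
  exact Complex.conj_eq_iff_im.1 hx2.symm

lemma div_im_eq_zero_of_re_eq_zero {a b : ℂ} (ha : a.re = 0) (hb : b.re = 0) : (a / b).im = 0 := by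
  rw [Complex.div_im, ha, hb]; simp

lemma AnalyticAt.dslope_self {w : ℝ → ℂ} {t : ℝ} (hw : AnalyticAt ℝ w t) :
    AnalyticAt ℝ (dslope w t) t := by
  obtain ⟨q, hq⟩ := hw
  exact hq.has_fpower_series_dslope_fslope.analyticAt

/-- In a power chart a regular analytic curve in the nodal set runs along a straight line. -/
lemma IsPowerChart.exists_eq_line {f : ℂ → ℂ} {U : Set ℂ} {p : ℂ} {m : ℕ} {ε : ℝ} {ψ φ : ℂ → ℂ}
    (h : IsPowerChart f U p m ε ψ φ) (hp : (f p).re = 0) {σ : ℝ → ℂ} {t₀ : ℝ}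
    (hσ : AnalyticAt ℝ σ t₀) (hσp : σ t₀ = p) (hσ' : deriv σ t₀ ≠ 0)
    (hZ : ∀ᶠ t in 𝓝 t₀, (f (σ t)).re = 0) :
    ((deriv φ p * deriv σ t₀) ^ m).re = 0 ∧
    ∃ r : ℝ → ℝ, AnalyticAt ℝ r t₀ ∧ r t₀ = 0 ∧ deriv r t₀ = 1 ∧
      ∀ᶠ t in 𝓝 t₀, σ t = ψ (r t * (deriv φ p * deriv σ t₀)) := by
  set v : ℂ := deriv φ p * deriv σ t₀ with hv
  have hv0 : v ≠ 0 := mul_ne_zero h.deriv_inv_ne_zero hσ'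
  let w : ℝ → ℂ := φ ∘ σ
  have hφσ : AnalyticAt ℂ φ (σ t₀) := hσp ▸ h.analyticAt_inv
  have hw : AnalyticAt ℝ w t₀ := hφσ.restrictScalars.comp hσ
  have hw0 : w t₀ = 0 := by simp [w, hσp, h.inv_center]
  have hw' : HasDerivAt w v t₀ := by
    have h1 := hφσ.differentiableAt.hasDerivAt.comp t₀ hσ.differentiableAt.hasDerivAt
    rw [hσp] at h1
    exact h1
  -- Write w = (t - t₀) k with k t₀ = v. Off t₀ the real factor cancels from Re(w^m) = 0, so Re(k^m)
  -- = 0, and Re(v^m) = 0 in the limit. Then (k/v)^m is real with k/v close to 1, so k/v is real: w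
  -- stays on the line through v.
  let k := dslope w t₀
  have hk : AnalyticAt ℝ k t₀ := hw.dslope_self
  have hk0 : k t₀ = v := by simp only [k, dslope_same]; exact hw'.deriv
  have hwk : ∀ t, w t = (t - t₀) * k t := fun t => by
    have := sub_smul_dslope w t₀ t
    rw [hw0, sub_zero, Complex.real_smul] at this
    rw [← this]
    push_cast
    rfl
  have hev : ∀ᶠ t in 𝓝 t₀, (w t ∈ Metric.ball (0 : ℂ) ε ∧ ψ (w t) = σ t) := by
    have : Tendsto σ (𝓝 t₀) (𝓝 p) := hσp ▸ hσ.continuousAt.tendsto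
    exact this.eventually h.right_inv
  have hpow : ∀ᶠ t in 𝓝 t₀, t ≠ t₀ → ((k t) ^ m).re = 0 := by
    filter_upwards [hev, hZ] with t h1 h2 hne
    have h3 := h.eq_pow _ h1.1
    rw [h1.2] at h3
    rw [h3, Complex.add_re, hp, zero_add, hwk, mul_pow] at h2
    have h4 : ((t : ℂ) - t₀) ^ m = (((t - t₀) ^ m : ℝ) : ℂ) := by push_cast; rfl
    rw [h4, Complex.re_ofReal_mul] at h2
    exact (mul_eq_zero.1 h2).resolve_left (pow_ne_zero _ (sub_ne_zero.2 hne))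
  have hvre : (v ^ m).re = 0 := by
    have hc : ContinuousAt (fun t => ((k t) ^ m).re) t₀ :=
      Complex.continuous_re.continuousAt.comp (hk.continuousAt.pow m)
    have h1 : Tendsto (fun t => ((k t) ^ m).re) (𝓝[≠] t₀) (𝓝 ((k t₀ ^ m).re)) :=
      hc.tendsto.mono_left nhdsWithin_le_nhds
    have h2 : Tendsto (fun t => ((k t) ^ m).re) (𝓝[≠] t₀) (𝓝 0) := by
      refine tendsto_const_nhds.congr' ?_
      filter_upwards [hpow.filter_mono nhdsWithin_le_nhds, self_mem_nhdsWithin] with t h3 h4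
      exact (h3 h4).symm
    rw [← hk0]
    exact tendsto_nhds_unique h1 h2
  refine ⟨hvre, fun t => (w t / v).re, ?_, by simp [hw0], ?_, ?_⟩
  · exact (Complex.reCLM.analyticAt _).comp (hw.div analyticAt_const hv0)
  · have h1 : HasDerivAt (fun t => (w t / v)) (v / v) t₀ := hw'.div_const v
    have h2 : HasDerivAt (fun t => (w t / v).re) (v / v).re t₀ :=
      (Complex.reCLM.hasFDerivAt.comp_hasDerivAt t₀ h1)
    rw [h2.deriv, div_self hv0, Complex.one_re]
  · have h1 : Tendsto (fun t => k t / v) (𝓝 t₀) (𝓝 1) := by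
      have := (hk.continuousAt.div_const v).tendsto
      simpa only [hk0, div_self hv0] using this
    filter_upwards [h1.eventually (eventually_im_eq_zero_of_pow h.one_le), hpow, hev]
      with t h2 h3 h4
    have h5 : (w t / v).im = 0 := by
      rcases eq_or_ne t t₀ with rfl | hne
      · simp [hw0]
      · have h6 : (k t / v).im = 0 := h2 (by
          rw [div_pow]; exact div_im_eq_zero_of_re_eq_zero (h3 hne) hvre)
        rw [hwk, mul_div_assoc, ← Complex.ofReal_sub, Complex.im_ofReal_mul, h6, mul_zero]
    have h6 : (((w t / v).re : ℝ) : ℂ) = w t / v := Complex.ext (by simp) (by simp [h5])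
    rw [h6, div_mul_cancel₀ _ hv0, h4.2]

/-- The arc length parametrization of a straight line in a power chart. -/
lemma IsPowerChart.exists_unit_line {f : ℂ → ℂ} {U : Set ℂ} {p : ℂ} {m : ℕ} {ε : ℝ} {ψ φ : ℂ → ℂ}
    (h : IsPowerChart f U p m ε ψ φ) {v : ℂ} (hv : v ≠ 0) :
    ∃ (A : ℝ → ℝ) (σ : ℝ → ℂ), A 0 = 0 ∧
      (∀ x : ℝ, ‖(x : ℂ) * v‖ < ε → HasDerivAt A (‖deriv ψ (x * v)‖ * ‖v‖) x) ∧
      IsOpen (A '' {x : ℝ | ‖(x : ℂ) * v‖ < ε}) ∧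
      IsPreconnected (A '' {x : ℝ | ‖(x : ℂ) * v‖ < ε}) ∧
      AnalyticOnNhd ℝ σ (A '' {x : ℝ | ‖(x : ℂ) * v‖ < ε}) ∧
      (∀ x : ℝ, ‖(x : ℂ) * v‖ < ε → σ (A x) = ψ (x * v)) ∧
      (∀ x : ℝ, ‖(x : ℂ) * v‖ < ε →
        HasDerivAt σ (deriv ψ (x * v) * v / ‖deriv ψ (x * v) * v‖) (A x)) := by
  let J := {x : ℝ | ‖(x : ℂ) * v‖ < ε}
  have hJ : J = Metric.ball 0 (ε / ‖v‖) := by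
    ext x
    simp only [J, mem_ofPred_eq, norm_mul, Complex.norm_real, Metric.mem_ball, dist_zero_right]
    rw [lt_div_iff₀ (norm_pos_iff.2 hv)]
  have hder : ∀ x ∈ J, HasDerivAt (fun x : ℝ => ψ (x * v)) (deriv ψ (x * v) * v) x := by
    intro x hx
    have h1 : HasDerivAt (fun x : ℝ => (x : ℂ) * v) (1 * v) x :=
      (Complex.ofRealCLM.hasDerivAt (x := x)).mul_const v
    have h2 := (h.analytic (x * v) (by simpa [J] using hx)).differentiableAt.hasDerivAt.comp x h1
    rw [one_mul] at h2
    exact h2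
  have han : AnalyticOnNhd ℝ (fun x : ℝ => ψ (x * v)) J := by
    intro x hx
    have h1 : AnalyticAt ℝ (fun x : ℝ => (x : ℂ) * v) x :=
      (Complex.ofRealCLM.analyticAt x).mul analyticAt_const
    have h2 : AnalyticAt ℝ ψ ((x : ℂ) * v) :=
      (h.analytic (x * v) (by simpa [J] using hx)).restrictScalars
    exact AnalyticAt.fun_comp (g := ψ) h2 h1
  have h0 : (0 : ℝ) ∈ J := by simp [J, h.pos]
  have hJo : IsOpen J := hJ ▸ Metric.isOpen_ball
  have hJc : IsPreconnected J := hJ ▸ (convex_ball _ _).isPreconnected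
  have hne : ∀ t ∈ J, deriv (fun x : ℝ => ψ (x * v)) t ≠ 0 := fun x hx => by
    rw [(hder x hx).deriv]
    exact mul_ne_zero (h.deriv_ne_zero (by simpa [J] using hx)) hv
  obtain ⟨A, σ, h1, h2, h3, h4, h5, h6, h7⟩ := exists_unit_speed hJo hJc han hne h0
  refine ⟨A, σ, h1, fun x hx => ?_, h3, h4, h5, h6, fun x hx => ?_⟩
  · have := h2 x hx
    rwa [(hder x hx).deriv, norm_mul] at this
  · have := h7 x hx
    rwa [(hder x hx).deriv] at this

/-- Uniqueness of unit speed curves in the nodal set with given position and velocity. -/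
lemma eventuallyEq_of_unit_speed {f : ℂ → ℂ} {p : ℂ} (hf : AnalyticAt ℂ f p)
    (hne : ¬ ∀ᶠ z in 𝓝 p, f z = f p) (hp : (f p).re = 0) {σ ρ : ℝ → ℂ} {t₀ : ℝ}
    (hσ : AnalyticAt ℝ σ t₀) (hρ : AnalyticAt ℝ ρ t₀) (hσp : σ t₀ = p) (hρp : ρ t₀ = p)
    (hd : deriv σ t₀ = deriv ρ t₀)
    (hσZ : ∀ᶠ t in 𝓝 t₀, (f (σ t)).re = 0) (hρZ : ∀ᶠ t in 𝓝 t₀, (f (ρ t)).re = 0)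
    (hσu : ∀ᶠ t in 𝓝 t₀, ‖deriv σ t‖ = 1) (hρu : ∀ᶠ t in 𝓝 t₀, ‖deriv ρ t‖ = 1) :
    σ =ᶠ[𝓝 t₀] ρ := by
  obtain ⟨m, ε, ψ, φ, h⟩ := exists_powerChart univ_mem hf hne
  have hσ' : deriv σ t₀ ≠ 0 := by
    intro h0; have := hσu.self_of_nhds; rw [h0] at this; simp at this
  set v : ℂ := deriv φ p * deriv σ t₀ with hv
  have hv0 : v ≠ 0 := mul_ne_zero h.deriv_inv_ne_zero hσ'
  obtain ⟨A, c, hA0, hA, -, -, -, hc, -⟩ := h.exists_unit_line hv0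
  -- By `exists_eq_line` both curves run along the same chart line; each is identified with the arc
  -- length parametrization `c` of that line.
  suffices key : ∀ s : ℝ → ℂ, AnalyticAt ℝ s t₀ → s t₀ = p → deriv s t₀ = deriv σ t₀ →
      (∀ᶠ t in 𝓝 t₀, (f (s t)).re = 0) → (∀ᶠ t in 𝓝 t₀, ‖deriv s t‖ = 1) →
      ∀ᶠ t in 𝓝 t₀, s t = c (t - t₀) by
    filter_upwards [key σ hσ hσp rfl hσZ hσu, key ρ hρ hρp hd.symm hρZ hρu] with t h1 h2
    rw [h1, h2]
  intro s hs hsp hsd hsZ hsu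
  obtain ⟨-, r, hr, hr0, hr', hrs⟩ := h.exists_eq_line hp hs hsp (hsd ▸ hσ') hsZ
  rw [hsd, ← hv] at hrs
  have hrpos : ∀ᶠ t in 𝓝 t₀, 0 < deriv r t :=
    hr.deriv.continuousAt.eventually (lt_mem_nhds (by rw [hr']; exact one_pos))
  have hrsmall : ∀ᶠ t in 𝓝 t₀, ‖(r t : ℂ) * v‖ < ε := by
    have : ContinuousAt (fun t => ‖(r t : ℂ) * v‖) t₀ :=
      ((Complex.continuous_ofReal.continuousAt.comp hr.continuousAt).mul_const v).norm
    refine this.eventually (gt_mem_nhds ?_)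
    simp [hr0, h.pos]
  obtain ⟨δ, hδ, hb⟩ := Metric.eventually_nhds_iff_ball.1
    ((((hrs.eventually_nhds.and hrpos).and hrsmall).and hsu).and hr.eventually_analyticAt)
  -- The arc length A (r t) grows at the speed of `s`, which is 1; positivity of r' fixes the sign.
  have hder : ∀ t ∈ Metric.ball t₀ δ, HasDerivAt (fun t => A (r t) - t) 0 t := by
    intro t ht
    obtain ⟨⟨⟨⟨h1, h2⟩, h3⟩, h4⟩, h5⟩ := hb t ht
    have h6 := (hA (r t) h3).comp t h5.differentiableAt.hasDerivAt
    have h7 : HasDerivAt (fun t => (r t : ℂ) * v) (((deriv r t : ℝ) : ℂ) * v) t :=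
      (h5.differentiableAt.hasDerivAt.ofReal_comp).mul_const v
    have h8 : HasDerivAt s (deriv ψ (r t * v) * (((deriv r t : ℝ) : ℂ) * v)) t :=
      ((h.analytic (r t * v) (by simpa using h3)).differentiableAt.hasDerivAt.comp t
        h7).congr_of_eventuallyEq h1
    have h9 : ‖deriv ψ (r t * v)‖ * ‖v‖ * deriv r t = 1 := by
      rw [h8.deriv, norm_mul, norm_mul, Complex.norm_real, Real.norm_eq_abs, abs_of_pos h2] at h4
      linarith
    rw [h9] at h6
    have h10 := h6.sub (hasDerivAt_id t)
    rw [sub_self] at h10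
    exact h10
  filter_upwards [Metric.ball_mem_nhds t₀ hδ] with t ht
  have h1 := Metric.isOpen_ball.is_const_of_deriv_eq_zero (convex_ball t₀ δ).isPreconnected
      (fun s hs => (hder s hs).differentiableAt.differentiableWithinAt)
      (fun s hs => (hder s hs).deriv) ht (Metric.mem_ball_self hδ)
  rw [hr0, hA0] at h1
  obtain ⟨⟨⟨⟨h2, -⟩, h3⟩, -⟩, -⟩ := hb t ht
  rw [h2.self_of_nhds, ← hc _ h3]
  congr 1
  linarith

/-! ### Unit speed curves and their maximal extensions -/

/-- A unit speed real-analytic curve in `S`, parametrized by an open interval `I`. -/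
structure IsUnitCurve (S : Set ℂ) (I : Set ℝ) (σ : ℝ → ℂ) : Prop where
  isOpen : IsOpen I
  preconn : IsPreconnected I
  analytic : AnalyticOnNhd ℝ σ I
  unit : ∀ t ∈ I, ‖deriv σ t‖ = 1
  maps : ∀ t ∈ I, σ t ∈ S

/-- A unit speed curve in `S` that extends every unit speed curve in `S` tangent to it. -/
structure IsMaxUnitCurve (S : Set ℂ) (I : Set ℝ) (σ : ℝ → ℂ) : Prop extends
    IsUnitCurve S I σ where
  max : ∀ (J : Set ℝ) (ρ : ℝ → ℂ), IsUnitCurve S J ρ → ∀ t ∈ I, t ∈ J → ρ t = σ t →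
    deriv ρ t = deriv σ t → J ⊆ I ∧ EqOn ρ σ J

/-- `f` is holomorphic on the disc of radius `r` and nowhere locally constant. -/
structure IsNonconstHolo (r : ℝ) (f : ℂ → ℂ) : Prop where
  analytic : AnalyticOnNhd ℂ f (Metric.ball 0 r)
  nonconst : ∀ p ∈ Metric.ball (0 : ℂ) r, ¬ ∀ᶠ z in 𝓝 p, f z = f p

/-- The zero set of the real part of `f` in the disc of radius `r`. -/
abbrev reZeros (r : ℝ) (f : ℂ → ℂ) : Set ℂ := nodalSet r fun z => (f z).re

namespace IsUnitCurve

variable {S : Set ℂ} {I J : Set ℝ} {σ ρ : ℝ → ℂ}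

lemma deriv_ne_zero (h : IsUnitCurve S I σ) {t : ℝ} (ht : t ∈ I) : deriv σ t ≠ 0 := by
  intro h0
  have := h.unit t ht
  rw [h0] at this
  simp at this

/-- Change of parameter by a shift, possibly with reversal of the orientation. -/
lemma comp_affine (h : IsUnitCurve S I σ) {e : ℝ} (he : e = 1 ∨ e = -1) (c : ℝ) :
    IsUnitCurve S {t | e * t + c ∈ I} (fun t => σ (e * t + c)) ∧
      ∀ t, e * t + c ∈ I → deriv (fun t => σ (e * t + c)) t = e * deriv σ (e * t + c) := by
  have hcont : Continuous fun t : ℝ => e * t + c := by fun_prop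
  have hee : e * e = 1 := by rcases he with rfl | rfl <;> norm_num
  have hd : ∀ t, e * t + c ∈ I → deriv (fun t => σ (e * t + c)) t = e * deriv σ (e * t + c) := by
    intro t ht
    have h1 : HasDerivAt (fun t : ℝ => e * t + c) e t := by
      simpa using ((hasDerivAt_id t).const_mul e).add_const c
    have h2 := (h.analytic _ ht).differentiableAt.hasDerivAt.scomp t h1
    rw [Complex.real_smul] at h2
    exact h2.deriv
  refine ⟨⟨h.isOpen.preimage hcont, ?_, fun t ht => ?_, fun t ht => ?_, fun t ht => h.maps _ ht⟩,
    hd⟩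
  · have : {t | e * t + c ∈ I} = (fun t => e * t - e * c) '' I := by
      ext t
      simp only [mem_ofPred_eq, mem_image]
      constructor
      · intro ht
        exact ⟨_, ht, by linear_combination t * hee⟩
      · rintro ⟨s, hs, rfl⟩
        convert hs using 1
        linear_combination (s - c) * hee
    rw [this]
    exact h.preconn.image _ (by fun_prop)
  · have h1 : AnalyticAt ℝ (fun t : ℝ => e * t + c) t :=
      (analyticAt_const.mul analyticAt_id).add analyticAt_const
    exact AnalyticAt.fun_comp (g := σ) (h.analytic _ ht) h1
  · rw [hd t ht, norm_mul, h.unit _ ht, Complex.norm_real]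
    rcases he with rfl | rfl <;> norm_num

/-- Local uniqueness at the common point, then the identity theorem on the interval I ∩ J. -/
lemma eqOn_of_tangent {r : ℝ} {f : ℂ → ℂ} (hf : IsNonconstHolo r f)
    (hσ : IsUnitCurve (reZeros r f) I σ) (hρ : IsUnitCurve (reZeros r f) J ρ) {t : ℝ}
    (htI : t ∈ I) (htJ : t ∈ J) (h0 : σ t = ρ t) (h1 : deriv σ t = deriv ρ t) :
    EqOn σ ρ (I ∩ J) := by
  have hpre : IsPreconnected (I ∩ J) :=
    (hσ.preconn.ordConnected.inter hρ.preconn.ordConnected).isPreconnected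
  refine AnalyticOnNhd.eqOn_of_preconnected_of_eventuallyEq
    (hσ.analytic.mono inter_subset_left) (hρ.analytic.mono inter_subset_right) hpre ⟨htI, htJ⟩ ?_
  have hI := hσ.isOpen.mem_nhds htI
  have hJ := hρ.isOpen.mem_nhds htJ
  have hp := hσ.maps t htI
  refine eventuallyEq_of_unit_speed (hf.analytic _ hp.1) (hf.nonconst _ hp.1) hp.2
    (hσ.analytic t htI) (hρ.analytic t htJ) rfl h0.symm h1 ?_ ?_ ?_ ?_
  · filter_upwards [hI] with s hs using (hσ.maps s hs).2
  · filter_upwards [hJ] with s hs using (hρ.maps s hs).2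
  · filter_upwards [hI] with s hs using hσ.unit s hs
  · filter_upwards [hJ] with s hs using hρ.unit s hs

lemma congr (h : IsUnitCurve S I σ) (hI : EqOn σ ρ I) : IsUnitCurve S I ρ := by
  have hev : ∀ t ∈ I, σ =ᶠ[𝓝 t] ρ := fun t ht => hI.eventuallyEq_of_mem (h.isOpen.mem_nhds ht)
  exact ⟨h.isOpen, h.preconn, fun t ht => (h.analytic t ht).congr (hev t ht),
    fun t ht => by rw [← (hev t ht).deriv_eq]; exact h.unit t ht,
    fun t ht => by rw [← hI ht]; exact h.maps t ht⟩

lemma iUnion {ι : Type*} {I : ι → Set ℝ} {σ : ℝ → ℂ} {t₀ : ℝ}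
    (h : ∀ i, IsUnitCurve S (I i) σ) (h0 : ∀ i, t₀ ∈ I i) : IsUnitCurve S (⋃ i, I i) σ := by
  refine ⟨isOpen_iUnion fun i => (h i).isOpen,
    isPreconnected_iUnion ⟨t₀, mem_iInter.2 h0⟩ fun i => (h i).preconn, ?_, ?_, ?_⟩ <;>
  · intro t ht
    obtain ⟨i, hi⟩ := mem_iUnion.1 ht
    first
      | exact (h i).analytic t hi
      | exact (h i).unit t hi
      | exact (h i).maps t hi

/-- Every unit speed curve in the nodal set extends to a maximal one. -/
lemma exists_max {r : ℝ} {f : ℂ → ℂ} (hf : IsNonconstHolo r f)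
    (h : IsUnitCurve (reZeros r f) I σ) {t₀ : ℝ} (ht₀ : t₀ ∈ I) :
    ∃ I' σ', IsMaxUnitCurve (reZeros r f) I' σ' ∧ t₀ ∈ I' ∧ σ' t₀ = σ t₀ ∧
      deriv σ' t₀ = deriv σ t₀ := by
  classical
  -- All unit curves with the given position and velocity at t₀. Any two agree on their overlap, so
  -- they glue to one curve on the union of their intervals; the value 0 taken off the union plays
  -- no role.
  let F : Set (Set ℝ × (ℝ → ℂ)) := {x | IsUnitCurve (reZeros r f) x.1 x.2 ∧ t₀ ∈ x.1 ∧
    x.2 t₀ = σ t₀ ∧ deriv x.2 t₀ = deriv σ t₀}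
  have hFeq : ∀ x ∈ F, ∀ y ∈ F, EqOn x.2 y.2 (x.1 ∩ y.1) := fun x hx y hy =>
    hx.1.eqOn_of_tangent hf hy.1 hx.2.1 hy.2.1 (hx.2.2.1.trans hy.2.2.1.symm)
      (hx.2.2.2.trans hy.2.2.2.symm)
  let σ' : ℝ → ℂ := fun t => if ht : ∃ x ∈ F, t ∈ x.1 then ht.choose.2 t else 0
  have hσ' : ∀ x ∈ F, EqOn x.2 σ' x.1 := by
    intro x hx t ht
    have hex : ∃ x ∈ F, t ∈ x.1 := ⟨x, hx, ht⟩
    simp only [σ', dif_pos hex]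
    exact hFeq x hx _ hex.choose_spec.1 ⟨ht, hex.choose_spec.2⟩
  let I' : Set ℝ := ⋃ x : F, x.1.1
  have hU : IsUnitCurve (reZeros r f) I' σ' :=
    iUnion (fun x : F => x.2.1.congr (hσ' x x.2)) fun x => x.2.2.1
  have hmemF : (I, σ) ∈ F := ⟨h, ht₀, rfl, rfl⟩
  have ht₀' : t₀ ∈ I' := mem_iUnion.2 ⟨⟨_, hmemF⟩, ht₀⟩
  have hval : σ' t₀ = σ t₀ := (hσ' _ hmemF ht₀).symm
  have hder : deriv σ' t₀ = deriv σ t₀ :=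
    ((hσ' _ hmemF).eventuallyEq_of_mem (h.isOpen.mem_nhds ht₀)).symm.deriv_eq
  refine ⟨I', σ', ⟨hU, fun J ρ hρ t htI htJ h0 h1 => ?_⟩, ht₀', hval, hder⟩
  have hag : EqOn ρ σ' (J ∩ I') := hρ.eqOn_of_tangent hf hU htJ htI h0 h1
  -- Tangency may occur at a time t other than t₀. Gluing ρ to σ' gives a curve that is again in
  -- `F`, so its interval is already contained in I'.
  let τ : ℝ → ℂ := fun s => if s ∈ I' then σ' s else ρ s
  have hτI : EqOn σ' τ I' := fun s hs => by simp [τ, hs]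
  have hτJ : EqOn ρ τ J := fun s hs => by
    by_cases hs' : s ∈ I'
    · simp only [τ, hs', if_true]; exact hag ⟨hs, hs'⟩
    · simp [τ, hs']
  have hτ : IsUnitCurve (reZeros r f) (⋃ b : Bool, cond b I' J) τ := by
    refine iUnion (t₀ := t) (fun b => ?_) (fun b => ?_)
    · cases b
      · exact hρ.congr hτJ
      · exact hU.congr hτI
    · cases b
      · exact htJ
      · exact htI
  have hτF : ((⋃ b : Bool, cond b I' J), τ) ∈ F :=
    ⟨hτ, mem_iUnion.2 ⟨true, ht₀'⟩, (hτI ht₀').symm.trans hval,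
      ((hτI.eventuallyEq_of_mem (hU.isOpen.mem_nhds ht₀')).symm.deriv_eq).trans hder⟩
  have hsub : J ⊆ I' := fun s hs => mem_iUnion.2 ⟨⟨_, hτF⟩, mem_iUnion.2 ⟨false, hs⟩⟩
  exact ⟨hsub, fun s hs => hag ⟨hs, hsub hs⟩⟩

/-- The trace of a unit speed curve is the trace of a regular analytic curve on the line. -/
lemma isAnalyticCurveIn (h : IsUnitCurve S I σ) (hne : I.Nonempty) :
    ∃ γ : ℝ → ℂ, IsRegularAnalytic γ ∧ range γ = σ '' I ∧
      ∀ t ∈ I, ∃ s, γ s = σ t ∧ ∃ c : ℝ, deriv γ s = c * deriv σ t := by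
  obtain ⟨T, hT, hT', hTr⟩ := exists_analytic_range_eq h.isOpen h.preconn hne
  have hmem : ∀ x, T x ∈ I := fun x => hTr ▸ mem_range_self x
  have hrange : range (fun x => σ (T x)) = σ '' I := by rw [← hTr, ← range_comp]; rfl
  have hd : ∀ x, deriv (fun x => σ (T x)) x = deriv T x • deriv σ (T x) := fun x =>
    ((h.analytic _ (hmem x)).differentiableAt.hasDerivAt.scomp x
      (hT x trivial).differentiableAt.hasDerivAt).deriv
  refine ⟨fun x => σ (T x), ⟨fun x _ => ?_, fun x => ?_⟩, hrange, fun t ht => ?_⟩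
  · exact AnalyticAt.fun_comp (g := σ) (h.analytic _ (hmem x)) (hT x trivial)
  · rw [hd]
    exact smul_ne_zero (hT' x) (h.deriv_ne_zero (hmem x))
  · obtain ⟨s, hs⟩ : t ∈ range T := hTr.symm ▸ ht
    exact ⟨s, congrArg σ hs, deriv T s, by rw [hd, hs, Complex.real_smul]⟩

end IsUnitCurve

/-- A regular analytic curve in `S` has a unit speed parametrization. -/
lemma IsRegularAnalytic.exists_unitCurve {S : Set ℂ} {γ : ℝ → ℂ} (h : IsRegularAnalytic γ)
    (hS : range γ ⊆ S) :
    ∃ (J : Set ℝ) (ρ : ℝ → ℂ), IsUnitCurve S J ρ ∧ ρ '' J = range γ ∧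
      ∀ t, ∃ s ∈ J, ρ s = γ t ∧ deriv ρ s = deriv γ t / ‖deriv γ t‖ := by
  obtain ⟨A, σ, -, hA, h1, h2, h3, h4, h5⟩ :=
    exists_unit_speed isOpen_univ isPreconnected_univ h.1 (fun t _ => h.2 t) (mem_univ (0 : ℝ))
  refine ⟨A '' univ, σ, ⟨h1, h2, h3, ?_, ?_⟩, ?_, fun t => ⟨A t, ⟨t, trivial, rfl⟩, h4 t trivial,
    (h5 t trivial).deriv⟩⟩
  · rintro _ ⟨t, -, rfl⟩
    rw [(h5 t trivial).deriv, norm_div, Complex.norm_real, norm_norm,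
      div_self (norm_ne_zero_iff.2 (h.2 t))]
  · rintro _ ⟨t, -, rfl⟩
    rw [h4 t trivial]
    exact hS ⟨t, rfl⟩
  · rw [← image_comp, ← image_univ]
    exact image_congr fun t _ => h4 t trivial

namespace IsMaxUnitCurve

variable {S : Set ℂ} {I J : Set ℝ} {σ ρ : ℝ → ℂ}

/-- A unit speed curve tangent to a maximal one is a part of it. -/
lemma eq_of_tangent (h : IsMaxUnitCurve S I σ) (hρ : IsUnitCurve S J ρ) {e : ℝ}
    (he : e = 1 ∨ e = -1) {t s : ℝ} (ht : t ∈ I) (hs : s ∈ J) (h0 : ρ s = σ t)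
    (h1 : deriv ρ s = e * deriv σ t) {x : ℝ} (hx : x ∈ J) :
    e * (x - s) + t ∈ I ∧ ρ x = σ (e * (x - s) + t) := by
  have hee : e * e = 1 := by rcases he with rfl | rfl <;> norm_num
  obtain ⟨h2, h3⟩ := hρ.comp_affine he (s - e * t)
  have h4 : e * t + (s - e * t) = s := by ring
  obtain ⟨h5, h6⟩ := h.max _ _ h2 t ht (by simpa [h4] using hs) (by simpa [h4] using h0) (by
    rw [h3 t (by simpa [h4] using hs), h4, h1, ← mul_assoc, ← Complex.ofReal_mul, hee,
      Complex.ofReal_one, one_mul])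
  have h7 : e * (e * (x - s) + t) + (s - e * t) = x := by linear_combination (x - s) * hee
  have h9 : e * (x - s) + t ∈ {y | e * y + (s - e * t) ∈ J} := by
    simpa only [mem_ofPred_eq, h7] using hx
  refine ⟨h5 h9, ?_⟩
  have := h6 h9
  simp only [h7] at this
  exact this

/-- Shifts and reversals of maximal curves are maximal. -/
lemma comp_affine (h : IsMaxUnitCurve S I σ) {e : ℝ} (he : e = 1 ∨ e = -1) (c : ℝ) :
    IsMaxUnitCurve S {t | e * t + c ∈ I} (fun t => σ (e * t + c)) := by
  have hee : e * e = 1 := by rcases he with rfl | rfl <;> norm_num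
  obtain ⟨h1, h2⟩ := h.toIsUnitCurve.comp_affine he c
  refine ⟨h1, fun J ρ hρ t ht htJ h3 h4 => ?_⟩
  rw [h2 t ht] at h4
  have key := fun x (hx : x ∈ J) => h.eq_of_tangent hρ he ht htJ h3 h4 hx
  have h5 : ∀ x, e * (x - t) + (e * t + c) = e * x + c := fun x => by ring
  simp only [h5] at key
  exact ⟨fun x hx => (key x hx).1, fun x hx => (key x hx).2⟩

end IsMaxUnitCurve

/-! ### Nodal curves as traces of maximal unit speed curves -/

namespace IsNonconstHolo

variable {r : ℝ} {f : ℂ → ℂ}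

lemma exists_powerChart (hf : IsNonconstHolo r f) {p : ℂ} (hp : p ∈ Metric.ball (0 : ℂ) r) :
    ∃ (m : ℕ) (ε : ℝ) (ψ φ : ℂ → ℂ), IsPowerChart f (Metric.ball 0 r) p m ε ψ φ :=
  _root_.exists_powerChart (Metric.isOpen_ball.mem_nhds hp) (hf.analytic p hp) (hf.nonconst p hp)

/-- In a power chart the centre is the only possible critical point. -/
lemma eventually_deriv_ne_zero (hf : IsNonconstHolo r f) {p : ℂ}
    (hp : p ∈ Metric.ball (0 : ℂ) r) : ∀ᶠ z in 𝓝[≠] p, deriv f z ≠ 0 := by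
  obtain ⟨m, ε, ψ, φ, h⟩ := hf.exists_powerChart hp
  filter_upwards [h.right_inv.filter_mono nhdsWithin_le_nhds, self_mem_nhdsWithin] with z hz hne
  rw [← hz.2]
  refine h.deriv_ne_zero_of_ne hf.analytic hz.1 fun h0 => hne ?_
  rw [mem_singleton_iff, ← hz.2, h0, h.map_zero]

variable {I J : Set ℝ} {σ ρ : ℝ → ℂ}

/-- On any curve in the nodal set there are non-critical points arbitrarily near each point. -/
lemma eventually_deriv_ne_zero_curve (hf : IsNonconstHolo r f)
    (h : IsUnitCurve (reZeros r f) I σ) {t : ℝ} (ht : t ∈ I) :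
    ∀ᶠ s in 𝓝[≠] t, deriv f (σ s) ≠ 0 := by
  have h1 : Tendsto σ (𝓝[≠] t) (𝓝[≠] (σ t)) :=
    (h.analytic t ht).differentiableAt.hasDerivAt.tendsto_nhdsNE (h.deriv_ne_zero ht)
  exact h1.eventually (hf.eventually_deriv_ne_zero (h.maps t ht).1)

lemma exists_deriv_ne_zero_curve (hf : IsNonconstHolo r f)
    (h : IsUnitCurve (reZeros r f) I σ) {t : ℝ} (ht : t ∈ I) :
    ∃ s ∈ I, deriv f (σ s) ≠ 0 :=
  (((hf.eventually_deriv_ne_zero_curve h ht).and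
    ((h.isOpen.mem_nhds ht : I ∈ 𝓝 t) |> mem_nhdsWithin_of_mem_nhds)).exists).imp
      fun _ hs => ⟨hs.2, hs.1⟩

/-- The tangent is orthogonal to the gradient. -/
lemma re_deriv_mul_eq_zero (hf : IsNonconstHolo r f) (h : IsUnitCurve (reZeros r f) I σ) {t : ℝ}
    (ht : t ∈ I) : (deriv f (σ t) * deriv σ t).re = 0 := by
  have h1 := (hf.analytic _ (h.maps t ht).1).differentiableAt.hasDerivAt.comp t
    (h.analytic t ht).differentiableAt.hasDerivAt
  have h2 := (Complex.reCLM.hasFDerivAt.comp_hasDerivAt t h1)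
  refine HasDerivAt.unique h2 ((hasDerivAt_const t (0 : ℝ)).congr_of_eventuallyEq ?_)
  filter_upwards [h.isOpen.mem_nhds ht] with s hs using (h.maps s hs).2

/-- At a non-critical point all curves in the nodal set have the same tangent line. -/
lemma tangent_unique (hf : IsNonconstHolo r f) (h : IsUnitCurve (reZeros r f) I σ)
    (hρ : IsUnitCurve (reZeros r f) J ρ) {t s : ℝ} (ht : t ∈ I) (hs : s ∈ J) (h0 : ρ s = σ t)
    (hd : deriv f (σ t) ≠ 0) : ∃ e : ℝ, (e = 1 ∨ e = -1) ∧ deriv ρ s = e * deriv σ t := by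
  have h1 := hf.re_deriv_mul_eq_zero h ht
  have h2 := hf.re_deriv_mul_eq_zero hρ hs
  rw [h0] at h2
  have h3 : ‖deriv f (σ t) * deriv σ t‖ = ‖deriv f (σ t) * deriv ρ s‖ := by
    rw [norm_mul, norm_mul, h.unit t ht, hρ.unit s hs]
  have h4 : |(deriv f (σ t) * deriv σ t).im| = |(deriv f (σ t) * deriv ρ s).im| := by
    rw [← Complex.abs_im_eq_norm.2 h1, ← Complex.abs_im_eq_norm.2 h2] at h3
    exact h3
  rcases abs_eq_abs.1 h4 with h5 | h5
  · refine ⟨1, Or.inl rfl, ?_⟩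
    have : deriv f (σ t) * deriv σ t = deriv f (σ t) * deriv ρ s :=
      Complex.ext (h1.trans h2.symm) h5
    simpa using (mul_left_cancel₀ hd this).symm
  · refine ⟨-1, Or.inr rfl, ?_⟩
    have : deriv f (σ t) * deriv ρ s = deriv f (σ t) * (-deriv σ t) := by
      apply Complex.ext
      · rw [mul_neg, Complex.neg_re, h1, h2, neg_zero]
      · rw [mul_neg, Complex.neg_im, h5, neg_neg]
    simpa using mul_left_cancel₀ hd this

/-- The trace of a maximal unit speed curve is a nodal curve. -/
lemma isNodalCurve_of_max (hf : IsNonconstHolo r f) (h : IsMaxUnitCurve (reZeros r f) I σ)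
    (hne : I.Nonempty) : IsNodalCurve r (fun z => (f z).re) (σ '' I) := by
  obtain ⟨γ, hγ, hγr, -⟩ := h.toIsUnitCurve.isAnalyticCurveIn hne
  have hsub : σ '' I ⊆ reZeros r f := by
    rintro _ ⟨t, ht, rfl⟩; exact h.maps t ht
  refine ⟨⟨⟨γ, hγ, hγr⟩, hsub⟩, ?_⟩
  rintro Γ ⟨⟨γ', hγ', rfl⟩, hΓ⟩ hle
  obtain ⟨J, ρ, hρ, hρr, -⟩ := hγ'.exists_unitCurve hΓ
  obtain ⟨t₀, ht₀⟩ := hne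
  -- A larger trace need only pass through the points of the curve, not in its direction. At a
  -- non-critical point there is just one tangent line, so there tangency is automatic and
  -- maximality applies.
  obtain ⟨t, ht, htd⟩ := hf.exists_deriv_ne_zero_curve h.toIsUnitCurve ht₀
  obtain ⟨s, hs, hst⟩ : σ t ∈ ρ '' J := hρr ▸ hle ⟨t, ht, rfl⟩
  obtain ⟨e, he, hed⟩ := hf.tangent_unique h.toIsUnitCurve hρ ht hs hst htd
  rw [← hρr]
  rintro _ ⟨x, hx, rfl⟩
  obtain ⟨h1, h2⟩ := h.eq_of_tangent hρ he ht hs hst hed hx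
  exact ⟨_, h1, h2.symm⟩

/-- A nodal curve is the trace of a maximal unit speed curve, with any prescribed base point of
a given regular parametrization. -/
lemma exists_max_of_isNodalCurve (hf : IsNonconstHolo r f) {γ : ℝ → ℂ} (hγ : IsRegularAnalytic γ)
    (h : IsNodalCurve r (fun z => (f z).re) (range γ)) (t : ℝ) :
    ∃ I σ, IsMaxUnitCurve (reZeros r f) I σ ∧ (0 : ℝ) ∈ I ∧ σ '' I = range γ ∧ σ 0 = γ t ∧
      deriv σ 0 = deriv γ t / ‖deriv γ t‖ := by
  obtain ⟨J, ρ, hρ, hρr, hρt⟩ := hγ.exists_unitCurve h.1.2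
  obtain ⟨s, hs, hs0, hs1⟩ := hρt t
  obtain ⟨h1, h2⟩ := hρ.comp_affine (Or.inl rfl) s
  have h0 : (0 : ℝ) ∈ {t : ℝ | (1 : ℝ) * t + s ∈ J} := by simpa using hs
  obtain ⟨I, σ, hσ, hI, hσ0, hσ1⟩ := h1.exists_max hf h0
  rw [h2 0 h0] at hσ1
  simp only [mul_zero, zero_add, Complex.ofReal_one, one_mul] at hσ0 hσ1
  have hsub : range γ ⊆ σ '' I := by
    rw [← hρr]
    rintro _ ⟨x, hx, rfl⟩
    obtain ⟨h3, h4⟩ := hσ.eq_of_tangent hρ (Or.inl rfl) hI hs hσ0.symm (by simp [hσ1]) hx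
    exact ⟨_, h3, h4.symm⟩
  have hnod := hf.isNodalCurve_of_max hσ ⟨0, hI⟩
  exact ⟨I, σ, hσ, hI, (h.eq_of_ge hnod.1 hsub).symm ▸ rfl, hσ0.trans hs0, hσ1.trans hs1⟩

end IsNonconstHolo

/-! ### Cauchy transforms of paths and the absence of loops -/

/-- A continuously differentiable path with its derivative. -/
structure IsC1Path (a a' : ℝ → ℂ) (s t : ℝ) : Prop where
  le : s ≤ t
  hasDerivAt : ∀ x ∈ Icc s t, HasDerivAt a (a' x) x
  cont : ContinuousOn a' (Icc s t)

/-- The Cauchy transform of a path. -/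
noncomputable def cauchyTransform (a a' : ℝ → ℂ) (s t : ℝ) (z : ℂ) : ℂ := ∫ x in s..t, a' x / (a x - z)

namespace IsC1Path

variable {a a' : ℝ → ℂ} {s t : ℝ}

lemma continuousOn (h : IsC1Path a a' s t) : ContinuousOn a (Icc s t) := fun x hx =>
  (h.hasDerivAt x hx).continuousAt.continuousWithinAt

lemma mono (h : IsC1Path a a' s t) {s' t' : ℝ} (h1 : s ≤ s') (h2 : s' ≤ t') (h3 : t' ≤ t) :
    IsC1Path a a' s' t' :=
  ⟨h2, fun x hx => h.hasDerivAt x ⟨h1.trans hx.1, hx.2.trans h3⟩, h.cont.mono (Icc_subset_Icc h1 h3)⟩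

lemma isCompact_image (h : IsC1Path a a' s t) : IsCompact (a '' Icc s t) :=
  isCompact_Icc.image_of_continuousOn h.continuousOn

lemma continuousOn_kernel (h : IsC1Path a a' s t) {z : ℂ} (hz : z ∉ a '' Icc s t) :
    ContinuousOn (fun x => a' x / (a x - z)) (Icc s t) :=
  h.cont.div (h.continuousOn.sub continuousOn_const) fun x hx h0 =>
    hz ⟨x, hx, sub_eq_zero.1 h0⟩

lemma intervalIntegrable (h : IsC1Path a a' s t) {z : ℂ} (hz : z ∉ a '' Icc s t) :
    IntervalIntegrable (fun x => a' x / (a x - z)) MeasureTheory.volume s t := by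
  refine ContinuousOn.intervalIntegrable ?_
  rw [uIcc_of_le h.le]
  exact h.continuousOn_kernel hz

/-- Differentiation under the integral gives a' / (a - z)^2, which has the primitive -1/(a - z).
Only the end points enter, so for two paths with the same ends the difference of the transforms is
locally constant off the paths. -/
lemma hasDerivAt_cauchyTransform (h : IsC1Path a a' s t) {z : ℂ} (hz : z ∉ a '' Icc s t) :
    HasDerivAt (cauchyTransform a a' s t) (1 / (a s - z) - 1 / (a t - z)) z := by
  obtain ⟨ε, hε, hball⟩ := Metric.isOpen_iff.1 h.isCompact_image.isClosed.isOpen_compl z hz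
  obtain ⟨M, hM⟩ := isCompact_Icc.exists_bound_of_continuousOn h.cont
  have hfar : ∀ w ∈ Metric.ball z (ε / 2), ∀ x ∈ Icc s t, ε / 2 ≤ ‖a x - w‖ := by
    intro w hw x hx
    by_contra! hlt
    refine hball (a := a x) ?_ ⟨x, hx, rfl⟩
    rw [Metric.mem_ball] at hw ⊢
    calc dist (a x) z ≤ dist (a x) w + dist w z := dist_triangle _ _ _
      _ < ε / 2 + ε / 2 := add_lt_add (by rwa [dist_eq_norm]) hw
      _ = ε := by ring
  have hne : ∀ w ∈ Metric.ball z (ε / 2), ∀ x ∈ Icc s t, a x - w ≠ 0 := fun w hw x hx h0 => by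
    have := hfar w hw x hx
    rw [h0, norm_zero] at this
    linarith
  have hnot : ∀ w ∈ Metric.ball z (ε / 2), w ∉ a '' Icc s t := by
    rintro w hw ⟨x, hx, rfl⟩
    exact hne _ hw x hx (sub_self _)
  have hsub : uIoc s t ⊆ Icc s t := by rw [uIoc_of_le h.le]; exact Ioc_subset_Icc_self
  have hzb : z ∈ Metric.ball z (ε / 2) := Metric.mem_ball_self (half_pos hε)
  have hcont2 : ContinuousOn (fun x => a' x / (a x - z) ^ 2) (Icc s t) :=
    h.cont.div ((h.continuousOn.sub continuousOn_const).pow 2)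
      fun x hx => pow_ne_zero 2 (hne z hzb x hx)
  have key := intervalIntegral.hasDerivAt_integral_of_dominated_loc_of_deriv_le
    (μ := MeasureTheory.volume) (a := s) (b := t)
    (F := fun w x => a' x / (a x - w)) (F' := fun w x => a' x / (a x - w) ^ 2) (x₀ := z)
    (s := Metric.ball z (ε / 2)) (bound := fun _ => M / (ε / 2) ^ 2)
    (Metric.ball_mem_nhds _ (half_pos hε)) ?_ (h.intervalIntegrable hz) ?_ ?_ (by simp) ?_
  · have h2 : ∫ x in s..t, a' x / (a x - z) ^ 2 = 1 / (a s - z) - 1 / (a t - z) := by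
      have h3 : ∀ x ∈ uIcc s t, HasDerivAt (fun x => -(a x - z)⁻¹) (a' x / (a x - z) ^ 2) x := by
        intro x hx
        rw [uIcc_of_le h.le] at hx
        exact (((h.hasDerivAt x hx).sub_const z).fun_inv (hne z hzb x hx)).fun_neg.congr_deriv
          (by ring)
      rw [intervalIntegral.integral_eq_sub_of_hasDerivAt h3
        (ContinuousOn.intervalIntegrable (by rwa [uIcc_of_le h.le]))]
      ring
    rw [← h2]
    exact key.2
  · filter_upwards [Metric.ball_mem_nhds z (half_pos hε)] with w hw
    exact ((h.continuousOn_kernel (hnot w hw)).mono hsub).aestronglyMeasurable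
      measurableSet_uIoc
  · exact (hcont2.mono hsub).aestronglyMeasurable measurableSet_uIoc
  · refine Eventually.of_forall fun x hx w hw => ?_
    rw [norm_div, norm_pow]
    have h1 := hfar w hw x (hsub hx)
    have h2 := hM x (hsub hx)
    have : 0 ≤ M := (norm_nonneg _).trans h2
    gcongr
  · refine Eventually.of_forall fun x hx w hw => ?_
    have h1 := ((hasDerivAt_id w).const_sub (a x)).fun_inv (hne w hw x (hsub hx))
    refine (h1.const_mul (a' x)).congr_deriv ?_
    simp only [id]
    ring

/-- Far from the path the Cauchy transform is given by a logarithm. -/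
lemma cauchyTransform_eq_log (h : IsC1Path a a' s t) {z : ℂ}
    (hz : ∀ x ∈ Icc s t, ‖a x‖ < ‖z‖) :
    cauchyTransform a a' s t z = Complex.log (1 - a t / z) - Complex.log (1 - a s / z) := by
  have hz0 : z ≠ 0 := by
    rintro rfl
    have := hz s ⟨le_rfl, h.le⟩
    rw [norm_zero] at this
    exact absurd this (norm_nonneg _).not_gt
  have hslit : ∀ x ∈ Icc s t, 1 - a x / z ∈ Complex.slitPlane := fun x hx => by
    have h1 : ‖-(a x / z)‖ < 1 := by
      rw [norm_neg, norm_div, div_lt_one (norm_pos_iff.2 hz0)]; exact hz x hx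
    simpa [sub_eq_add_neg] using Complex.mem_slitPlane_of_norm_lt_one h1
  refine intervalIntegral.integral_eq_sub_of_hasDerivAt (f := fun x => Complex.log (1 - a x / z))
    (fun x hx => ?_) (h.intervalIntegrable ?_)
  · rw [uIcc_of_le h.le] at hx
    have h1 := (((h.hasDerivAt x hx).div_const z).const_sub 1).clog_real (hslit x hx)
    refine h1.congr_deriv ?_
    have h2 := Complex.slitPlane_ne_zero (hslit x hx)
    have h3 : a x - z ≠ 0 := by
      intro h4
      rw [sub_eq_zero.1 h4, div_self hz0, sub_self] at h2
      exact h2 rfl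
    rw [div_eq_div_iff h2 h3]
    field_simp
    ring
  · rintro ⟨x, hx, rfl⟩
    exact lt_irrefl _ (hz x hx)

end IsC1Path

/-- Compares the kernel of a nearly straight path with that of a straight line, with explicit
constants; this bounds the jump of the Cauchy transform across the path in `IsNonconstHolo.no_loop`.
-/
lemma re_div_ge_of_near {A N : ℂ} {y e : ℝ} (he : 0 < e) (hA : ‖A - 1‖ ≤ 1 / 10)
    (hN : ‖N - y‖ ≤ |y| / 10) :
    N ^ 2 + e ^ 2 ≠ 0 ∧ (2 / 5) / (y ^ 2 + e ^ 2) ≤ (A / (N ^ 2 + e ^ 2)).re := by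
  have hD0 : 0 < y ^ 2 + e ^ 2 := by positivity
  set w : ℂ := (N ^ 2 + e ^ 2) / ((y ^ 2 + e ^ 2 : ℝ) : ℂ) with hw
  have hD0c : ((y ^ 2 + e ^ 2 : ℝ) : ℂ) ≠ 0 := by exact_mod_cast hD0.ne'
  have hNy : ‖N + y‖ ≤ 21 / 10 * |y| := by
    have h1 : N + y = (N - y) + 2 * y := by ring
    rw [h1]
    refine (norm_add_le _ _).trans ?_
    rw [norm_mul, Complex.norm_real, Real.norm_eq_abs, Complex.norm_ofNat]
    linarith
  have hw1 : ‖w - 1‖ ≤ 21 / 100 := by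
    have h1 : w - 1 = (N - y) * (N + y) / ((y ^ 2 + e ^ 2 : ℝ) : ℂ) := by
      rw [hw]; field_simp; push_cast; ring
    rw [h1, norm_div, norm_mul, Complex.norm_real, Real.norm_eq_abs, abs_of_pos hD0,
      div_le_iff₀ hD0]
    calc ‖N - y‖ * ‖N + y‖ ≤ (|y| / 10) * (21 / 10 * |y|) :=
          mul_le_mul hN hNy (norm_nonneg _) (by positivity)
      _ = 21 / 100 * y ^ 2 := by rw [← sq_abs y]; ring
      _ ≤ _ := by nlinarith
  have hwn : ‖w‖ ≤ 121 / 100 := by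
    have := norm_add_le (w - 1) 1
    rw [sub_add_cancel, norm_one] at this
    linarith
  have hw0 : w ≠ 0 := by
    intro h0
    rw [h0, zero_sub, norm_neg, norm_one] at hw1
    norm_num at hw1
  have hND : N ^ 2 + e ^ 2 = w * ((y ^ 2 + e ^ 2 : ℝ) : ℂ) := by
    rw [hw, div_mul_cancel₀ _ hD0c]
  refine ⟨by rw [hND]; exact mul_ne_zero hw0 hD0c, ?_⟩
  have h1 : (A / (N ^ 2 + e ^ 2)).re = (A / w).re / (y ^ 2 + e ^ 2) := by
    rw [hND, ← div_div, Complex.div_ofReal_re]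
  rw [h1]
  refine div_le_div_of_nonneg_right ?_ hD0.le
  have h2 : (A / w).re = (A * starRingEnd ℂ w).re / ‖w‖ ^ 2 := by
    rw [← Complex.normSq_eq_norm_sq, Complex.div_re, Complex.mul_re, Complex.conj_re,
      Complex.conj_im]
    ring
  have h3 : ‖A * starRingEnd ℂ w - 1‖ ≤ 331 / 1000 := by
    have h4 : A * starRingEnd ℂ w - 1 = (A - 1) * starRingEnd ℂ w + starRingEnd ℂ (w - 1) := by
      rw [map_sub, map_one]; ring
    rw [h4]
    refine (norm_add_le _ _).trans ?_
    rw [norm_mul, Complex.norm_conj, Complex.norm_conj]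
    nlinarith [norm_nonneg (A - 1), norm_nonneg w]
  have h5 : 669 / 1000 ≤ (A * starRingEnd ℂ w).re := by
    have := (Complex.abs_re_le_norm (A * starRingEnd ℂ w - 1)).trans h3
    rw [Complex.sub_re, Complex.one_re] at this
    linarith [(abs_le.1 this).1]
  rw [h2, le_div_iff₀ (by positivity)]
  nlinarith [norm_nonneg w]

/-- If the real part of `f` vanishes on the frontier of a bounded open set with closure in the disc,
then the set is empty. -/
lemma IsNonconstHolo.eq_empty_of_frontier {r : ℝ} {f : ℂ → ℂ} (hf : IsNonconstHolo r f) {U : Set ℂ}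
    (hU : IsOpen U) (hcl : closure U ⊆ Metric.ball 0 r)
    (hfr : ∀ z ∈ frontier U, (f z).re = 0) : U = ∅ := by
  have hb : Bornology.IsBounded U := Metric.isBounded_ball.subset (subset_closure.trans hcl)
  have hd : DifferentiableOn ℂ f (closure U) := fun z hz =>
    (hf.analytic z (hcl hz)).differentiableAt.differentiableWithinAt
  have hre : ∀ z ∈ U, (f z).re = 0 := by
    intro z hz
    -- The maximum modulus principle for exp f and exp(-f), both of modulus 1 on the frontier.
    apply le_antisymm
    · have h1 := Complex.norm_le_of_forall_mem_frontier_norm_le hb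
        (DifferentiableOn.diffContOnCl (f := fun z => Complex.exp (f z)) hd.cexp) (C := 1)
        (fun w hw => by rw [Complex.norm_exp, hfr w hw, Real.exp_zero]) (subset_closure hz)
      rw [Complex.norm_exp] at h1
      exact Real.exp_le_one_iff.1 h1
    · have h1 := Complex.norm_le_of_forall_mem_frontier_norm_le hb
        (DifferentiableOn.diffContOnCl (f := fun z => Complex.exp (-f z)) hd.neg.cexp) (C := 1)
        (fun w hw => by rw [Complex.norm_exp, Complex.neg_re, hfr w hw, neg_zero, Real.exp_zero])
        (subset_closure hz)
      rw [Complex.norm_exp, Complex.neg_re] at h1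
      linarith [Real.exp_le_one_iff.1 h1]
  by_contra hne
  obtain ⟨z, hz⟩ := nonempty_iff_ne_empty.2 hne
  have hzb := hcl (subset_closure hz)
  -- A non-constant f is open, so it cannot map an open set into the imaginary axis.
  rcases (hf.analytic z hzb).eventually_constant_or_nhds_le_map_nhds with h | h
  · exact hf.nonconst z hzb h
  · have h1 : f '' U ∈ 𝓝 (f z) := h (image_mem_map (hU.mem_nhds hz))
    have h2 : ∀ᶠ w in 𝓝 (f z), w.re = 0 := by
      filter_upwards [h1]
      rintro _ ⟨w, hw, rfl⟩
      exact hre w hw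
    obtain ⟨ε, hε, hball⟩ := Metric.eventually_nhds_iff.1 h2
    have h3 := hball (y := f z + (ε / 2 : ℝ)) (by
      rw [dist_eq_norm, add_sub_cancel_left, Complex.norm_real, Real.norm_eq_abs,
        abs_of_pos (half_pos hε)]
      linarith)
    rw [Complex.add_re, hre z hz, Complex.ofReal_re] at h3
    linarith

/-- The nodal set contains no loops: two paths with the same end points cannot differ. -/
lemma IsNonconstHolo.no_loop {r : ℝ} {f : ℂ → ℂ} (hf : IsNonconstHolo r f) {a a' b b' : ℝ → ℂ}
    {a₀ a₁ b₀ b₁ τ : ℝ} (ha : IsC1Path a a' a₀ a₁) (hb : IsC1Path b b' b₀ b₁)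
    (haZ : ∀ x ∈ Icc a₀ a₁, a x ∈ reZeros r f) (hbZ : ∀ x ∈ Icc b₀ b₁, b x ∈ reZeros r f)
    (h0 : a a₀ = b b₀) (h1 : a a₁ = b b₁) (hτ : τ ∈ Ioo a₀ a₁)
    (hinj : ∀ x ∈ Icc a₀ a₁, a x = a τ → x = τ) (hbτ : ∀ x ∈ Icc b₀ b₁, b x ≠ a τ)
    (hτ' : a' τ ≠ 0) : False := by
  let K : Set ℂ := a '' Icc a₀ a₁ ∪ b '' Icc b₀ b₁
  -- The winding number, up to the factor 2πi, of the loop formed by `a` and the reversed `b`.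
  let W : ℂ → ℂ := fun z => cauchyTransform a a' a₀ a₁ z - cauchyTransform b b' b₀ b₁ z
  have hKc : IsCompact K := ha.isCompact_image.union hb.isCompact_image
  have hKZ : K ⊆ reZeros r f := by
    rintro _ (⟨x, hx, rfl⟩ | ⟨x, hx, rfl⟩)
    exacts [haZ x hx, hbZ x hx]
  have hWd : ∀ z ∉ K, HasDerivAt W 0 z := by
    intro z hz
    have h2 := (ha.hasDerivAt_cauchyTransform fun h => hz (Or.inl h)).sub
      (hb.hasDerivAt_cauchyTransform fun h => hz (Or.inr h))
    refine h2.congr_deriv ?_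
    rw [h0, h1, sub_self]
  have hWopen : IsOpen {z | z ∉ K ∧ W z ≠ 0} := by
    have hc : ContinuousOn W Kᶜ := fun z hz => (hWd z hz).continuousAt.continuousWithinAt
    exact hc.isOpen_inter_preimage hKc.isClosed.isOpen_compl isOpen_ne
  -- W vanishes far away by the logarithm formula. The set where W ≠ 0 is therefore bounded, and its
  -- frontier lies in K, where Re f = 0; by the maximum principle it is empty.
  have hWzero : ∀ z ∉ K, W z = 0 := by
    obtain ⟨R, hR, hKR⟩ : ∃ R < r, K ⊆ Metric.closedBall 0 R := by
      have hne : K.Nonempty := ⟨a τ, Or.inl ⟨τ, Ioo_subset_Icc_self hτ, rfl⟩⟩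
      obtain ⟨z, hz, hmax⟩ := hKc.exists_isMaxOn hne continuous_norm.continuousOn
      refine ⟨‖z‖, by simpa using (hKZ hz).1, fun w hw => ?_⟩
      simpa using hmax hw
    have hsub : {z | z ∉ K ∧ W z ≠ 0} ⊆ Metric.closedBall 0 R := by
      rintro z ⟨-, hz⟩
      by_contra hzR
      rw [Metric.mem_closedBall, dist_zero_right, not_le] at hzR
      have hlt : ∀ w ∈ K, ‖w‖ < ‖z‖ := fun w hw => by
        have := hKR hw
        rw [Metric.mem_closedBall, dist_zero_right] at this
        exact this.trans_lt hzR
      refine hz ?_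
      simp only [W]
      rw [ha.cauchyTransform_eq_log fun x hx => hlt _ (Or.inl ⟨x, hx, rfl⟩),
        hb.cauchyTransform_eq_log fun x hx => hlt _ (Or.inr ⟨x, hx, rfl⟩), h0, h1, sub_self]
    have hempty := hf.eq_empty_of_frontier hWopen
      ((closure_minimal hsub Metric.isClosed_closedBall).trans
        (Metric.closedBall_subset_ball hR)) fun z hz => ?_
    · intro z hz
      by_contra hWz
      have : z ∈ {z | z ∉ K ∧ W z ≠ 0} := ⟨hz, hWz⟩
      rw [hempty] at this
      exact this
    · by_cases hzK : z ∈ K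
      · exact (hKZ hzK).2
      exfalso
      obtain ⟨ε, hε, hball⟩ := Metric.isOpen_iff.1 hKc.isClosed.isOpen_compl z hzK
      obtain ⟨w, hw, hwb⟩ := Metric.mem_closure_iff.1 hz.1 ε hε
      have heq : W z = W w := Metric.isOpen_ball.is_const_of_deriv_eq_zero
        (convex_ball z ε).isPreconnected
        (fun x hx => (hWd x (hball hx)).differentiableAt.differentiableWithinAt)
        (fun x hx => (hWd x (hball hx)).deriv) (Metric.mem_ball_self hε)
        (by rwa [Metric.mem_ball, dist_comm])
      have hzU : z ∈ {z | z ∉ K ∧ W z ≠ 0} := ⟨hzK, heq ▸ hw.2⟩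
      have := hz.2
      rw [hWopen.interior_eq] at this
      exact this hzU
  -- On the other hand W has to jump across `a` at the point q, which the loop passes only once. The
  -- rest of the proof bounds this jump from below.
  set q := a τ with hq
  set α := a' τ with hα
  obtain ⟨δ, hδ, hδa, hδb, hA, hN⟩ : ∃ δ > 0, a₀ ≤ τ - δ ∧ τ + δ ≤ a₁ ∧
      (∀ x ∈ Icc (τ - δ) (τ + δ), ‖a' x / α - 1‖ ≤ 1 / 10) ∧
      ∀ x ∈ Icc (τ - δ) (τ + δ), ‖(a x - q) / α - (x - τ : ℝ)‖ ≤ |x - τ| / 10 := by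
    have hτn : Icc a₀ a₁ ∈ 𝓝 τ := Icc_mem_nhds hτ.1 hτ.2
    have hc : ContinuousAt (fun x => ‖a' x / α - 1‖) τ :=
      (((ha.cont.continuousAt hτn).div_const α).sub continuousAt_const).norm
    have e1 : ∀ᶠ x in 𝓝 τ, ‖a' x / α - 1‖ < 1 / 10 := by
      refine hc.eventually (gt_mem_nhds ?_)
      change ‖α / α - 1‖ < 1 / 10
      rw [div_self hτ', sub_self, norm_zero]
      norm_num
    have e2 : ∀ᶠ x in 𝓝 τ, ‖(a x - q) / α - (x - τ : ℝ)‖ ≤ 1 / 10 * ‖x - τ‖ := by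
      have h3 := ((ha.hasDerivAt τ (Ioo_subset_Icc_self hτ)).sub_const q).div_const α
      rw [← hα, div_self hτ', hasDerivAt_iff_isLittleO] at h3
      filter_upwards [h3.def (by norm_num : (0 : ℝ) < 1 / 10)] with x hx
      simpa [← hq] using hx
    obtain ⟨δ, hδ, hball⟩ := Metric.eventually_nhds_iff.1 ((e1.and e2).and hτn)
    have hmem : ∀ x ∈ Icc (τ - δ / 2) (τ + δ / 2), dist x τ < δ := fun x hx => by
      rw [Real.dist_eq, abs_lt]
      exact ⟨by linarith [hx.1], by linarith [hx.2]⟩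
    refine ⟨δ / 2, half_pos hδ, ?_, ?_, fun x hx => ((hball (hmem x hx)).1.1).le, fun x hx => ?_⟩
    · exact (hball (hmem (τ - δ / 2) ⟨le_rfl, by linarith⟩)).2.1
    · exact (hball (hmem (τ + δ / 2) ⟨by linarith, le_rfl⟩)).2.2
    · have := (hball (hmem x hx)).1.2
      rw [Real.norm_eq_abs] at this
      linarith
  have pL := ha.mono le_rfl hδa (by linarith [hτ.2] : τ - δ ≤ a₁)
  have pM := ha.mono hδa (by linarith : τ - δ ≤ τ + δ) hδb
  have pR := ha.mono (by linarith [hτ.1] : a₀ ≤ τ + δ) hδb le_rfl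
  have qL : q ∉ a '' Icc a₀ (τ - δ) := by
    rintro ⟨x, hx, hxq⟩
    have := hinj x ⟨hx.1, by linarith [hx.2, hτ.2]⟩ hxq
    linarith [hx.2]
  have qR : q ∉ a '' Icc (τ + δ) a₁ := by
    rintro ⟨x, hx, hxq⟩
    have := hinj x ⟨by linarith [hx.1, hτ.1], hx.2⟩ hxq
    linarith [hx.1]
  have qb : q ∉ b '' Icc b₀ b₁ := by
    rintro ⟨x, hx, hxq⟩
    exact hbτ x hx hxq
  -- The part of W coming from outside the window [τ - δ, τ + δ]; it is continuous at q, so the jump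
  -- would have to come from the window alone.
  let H : ℂ → ℂ := fun z => cauchyTransform a a' a₀ (τ - δ) z + cauchyTransform a a' (τ + δ) a₁ z -
    cauchyTransform b b' b₀ b₁ z
  have hH : ContinuousAt H q := ((pL.hasDerivAt_cauchyTransform qL).continuousAt.add
    (pR.hasDerivAt_cauchyTransform qR).continuousAt).sub
    (hb.hasDerivAt_cauchyTransform qb).continuousAt
  have hcurve : ∀ s : ℂ, Tendsto (fun e : ℝ => q + e * s) (𝓝[>] 0) (𝓝 q) := fun s => by
    have h3 : Continuous fun e : ℝ => q + e * s := by fun_prop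
    have h4 := h3.tendsto 0
    simp only [Complex.ofReal_zero, zero_mul, add_zero] at h4
    exact h4.mono_left nhdsWithin_le_nhds
  have hoff : ∀ s : ℂ, ∀ᶠ e : ℝ in 𝓝[>] 0, q + e * s ∉ a '' Icc a₀ (τ - δ) ∧
      q + e * s ∉ a '' Icc (τ + δ) a₁ ∧ q + e * s ∉ b '' Icc b₀ b₁ := fun s =>
    ((hcurve s).eventually (pL.isCompact_image.isClosed.isOpen_compl.mem_nhds qL)).and
      (((hcurve s).eventually (pR.isCompact_image.isClosed.isOpen_compl.mem_nhds qR)).and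
        ((hcurve s).eventually (hb.isCompact_image.isClosed.isOpen_compl.mem_nhds qb)))
  have hkey : ∀ x ∈ Icc (τ - δ) (τ + δ), ∀ e : ℝ, 0 < e →
      ((a x - q) / α) ^ 2 + (e : ℂ) ^ 2 ≠ 0 ∧ (2 / 5) / ((x - τ) ^ 2 + e ^ 2) ≤
        ((a' x / α) / (((a x - q) / α) ^ 2 + (e : ℂ) ^ 2)).re := fun x hx e he =>
    re_div_ge_of_near he (hA x hx) (hN x hx)
  have hfac : ∀ x e : ℝ, ((a x - q) / α) ^ 2 + (e : ℂ) ^ 2 =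
      (a x - (q + e * (Complex.I * α))) * (a x - (q + e * (-(Complex.I * α)))) / α ^ 2 := by
    intro x e
    field_simp
    ring_nf
    rw [Complex.I_sq]
    ring
  have hne : ∀ x ∈ Icc (τ - δ) (τ + δ), ∀ e : ℝ, 0 < e →
      a x - (q + e * (Complex.I * α)) ≠ 0 ∧ a x - (q + e * (-(Complex.I * α))) ≠ 0 := by
    intro x hx e he
    have h3 := (hkey x hx e he).1
    rw [hfac] at h3
    have h4 := (div_ne_zero_iff.1 h3).1
    exact mul_ne_zero_iff.1 h4
  -- Compare the points q ± i e α on the two sides. The integrand of the difference is at least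
  -- (4e/5)/(y^2 + e^2) in its imaginary part, with y = x - τ, hence at least 2/(5e) for |y| ≤ e; an
  -- interval of length 2e already yields 4/5.
  have hjump : ∀ᶠ e : ℝ in 𝓝[>] 0,
      4 / 5 ≤ (H (q + e * (-(Complex.I * α))) - H (q + e * (Complex.I * α))).im := by
    have hsmall : ∀ᶠ e : ℝ in 𝓝[>] 0, e < δ := (gt_mem_nhds hδ).filter_mono nhdsWithin_le_nhds
    filter_upwards [hoff (Complex.I * α), hoff (-(Complex.I * α)), hsmall, self_mem_nhdsWithin]
      with e hp hm heδ he
    have he : (0 : ℝ) < e := he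
    set zp := q + e * (Complex.I * α) with hzp
    set zm := q + e * (-(Complex.I * α)) with hzm
    have hpM : zp ∉ a '' Icc (τ - δ) (τ + δ) := by
      rintro ⟨x, hx, hxq⟩
      exact (hne x hx e he).1 (sub_eq_zero.2 hxq)
    have hmM : zm ∉ a '' Icc (τ - δ) (τ + δ) := by
      rintro ⟨x, hx, hxq⟩
      exact (hne x hx e he).2 (sub_eq_zero.2 hxq)
    have hsplit : ∀ z, z ∉ a '' Icc a₀ (τ - δ) → z ∉ a '' Icc (τ - δ) (τ + δ) →
        z ∉ a '' Icc (τ + δ) a₁ → z ∉ b '' Icc b₀ b₁ →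
        H z + cauchyTransform a a' (τ - δ) (τ + δ) z = 0 := by
      intro z z1 z2 z3 z4
      have hzK : z ∉ K := by
        rintro (⟨x, hx, hxz⟩ | h)
        · rcases le_total x (τ - δ) with h5 | h5
          · exact z1 ⟨x, ⟨hx.1, h5⟩, hxz⟩
          · rcases le_total x (τ + δ) with h6 | h6
            · exact z2 ⟨x, ⟨h5, h6⟩, hxz⟩
            · exact z3 ⟨x, ⟨h6, hx.2⟩, hxz⟩
        · exact z4 h
      have h5 : cauchyTransform a a' a₀ a₁ z = cauchyTransform a a' a₀ (τ - δ) z +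
          cauchyTransform a a' (τ - δ) (τ + δ) z + cauchyTransform a a' (τ + δ) a₁ z := by
        simp only [cauchyTransform]
        rw [intervalIntegral.integral_add_adjacent_intervals (pL.intervalIntegrable z1)
            (pM.intervalIntegrable z2), intervalIntegral.integral_add_adjacent_intervals
            ((pL.intervalIntegrable z1).trans (pM.intervalIntegrable z2))
            (pR.intervalIntegrable z3)]
      have h6 := hWzero z hzK
      simp only [W] at h6
      simp only [H]
      linear_combination h6 - h5
    have s1 := hsplit zp hp.1 hpM hp.2.1 hp.2.2
    have s2 := hsplit zm hm.1 hmM hm.2.1 hm.2.2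
    have s3 : H zm - H zp = cauchyTransform a a' (τ - δ) (τ + δ) zp -
        cauchyTransform a a' (τ - δ) (τ + δ) zm := by linear_combination s2 - s1
    have ip := pM.intervalIntegrable hpM
    have im := pM.intervalIntegrable hmM
    rw [s3]
    simp only [cauchyTransform]
    rw [← intervalIntegral.integral_sub ip im]
    have him : (∫ x in (τ - δ)..(τ + δ), (a' x / (a x - zp) - a' x / (a x - zm))).im =
        ∫ x in (τ - δ)..(τ + δ), (a' x / (a x - zp) - a' x / (a x - zm)).im :=
      (Complex.imCLM.intervalIntegral_comp_comm (ip.sub im)).symm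
    rw [him]
    have hval : ∀ x ∈ Icc (τ - δ) (τ + δ), 2 * e * ((2 / 5) / ((x - τ) ^ 2 + e ^ 2)) ≤
        (a' x / (a x - zp) - a' x / (a x - zm)).im := by
      intro x hx
      obtain ⟨h5, h6⟩ := hkey x hx e he
      obtain ⟨h7, h8⟩ := hne x hx e he
      have h9 : a' x / (a x - zp) - a' x / (a x - zm) =
          (2 * e : ℝ) * ((a' x / α) / (((a x - q) / α) ^ 2 + (e : ℂ) ^ 2)) * Complex.I := by
        have hfac' := hfac x e
        rw [← hzp, ← hzm] at hfac'
        rw [hfac']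
        have alg : ∀ A P M : ℂ, P ≠ 0 → M ≠ 0 → M - P = 2 * e * Complex.I * α →
            A / P - A / M = (2 * e : ℝ) * ((A / α) / (P * M / α ^ 2)) * Complex.I := by
          intro A P M hP hM hPM
          rw [div_sub_div _ _ hP hM, show A * M - P * A = A * (M - P) by ring, hPM]
          push_cast
          field_simp
        exact alg _ _ _ h7 h8 (by rw [hzp, hzm]; ring)
      rw [h9, Complex.mul_I_im, Complex.re_ofReal_mul]
      have h12 : 0 < 2 * e := by linarith
      exact mul_le_mul_of_nonneg_left h6 h12.le
    have hnn : ∀ x ∈ Icc (τ - δ) (τ + δ), 0 ≤ (a' x / (a x - zp) - a' x / (a x - zm)).im :=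
      fun x hx => le_trans (by positivity) (hval x hx)
    have hint : IntervalIntegrable (fun x => (a' x / (a x - zp) - a' x / (a x - zm)).im)
        MeasureTheory.volume (τ - δ) (τ + δ) := by
      refine ContinuousOn.intervalIntegrable ?_
      rw [uIcc_of_le pM.le]
      exact Complex.continuous_im.comp_continuousOn
        ((pM.continuousOn_kernel hpM).sub (pM.continuousOn_kernel hmM))
    have hge : ∫ x in (τ - e)..(τ + e), (2 / (5 * e)) ≤
        ∫ x in (τ - e)..(τ + e), (a' x / (a x - zp) - a' x / (a x - zm)).im := by
      refine intervalIntegral.integral_mono_on (by linarith) (by simp) ?_ fun x hx => ?_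
      · refine hint.mono_set ?_
        rw [uIcc_of_le (by linarith), uIcc_of_le (by linarith)]
        exact Icc_subset_Icc (by linarith) (by linarith)
      · refine le_trans ?_ (hval x ⟨by linarith [hx.1], by linarith [hx.2]⟩)
        have h5 : (x - τ) ^ 2 ≤ e ^ 2 := sq_le_sq' (by linarith [hx.1]) (by linarith [hx.2])
        rw [← mul_div_assoc, div_le_div_iff₀ (by positivity) (by positivity)]
        nlinarith
    have hle : ∫ x in (τ - e)..(τ + e), (a' x / (a x - zp) - a' x / (a x - zm)).im ≤
        ∫ x in (τ - δ)..(τ + δ), (a' x / (a x - zp) - a' x / (a x - zm)).im := by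
      refine intervalIntegral.integral_mono_interval (by linarith) (by linarith) (by linarith) ?_
        hint
      filter_upwards [MeasureTheory.ae_restrict_mem measurableSet_Ioc] with x hx
      exact hnn x (Ioc_subset_Icc_self hx)
    refine le_trans ?_ (hge.trans hle)
    rw [intervalIntegral.integral_const, smul_eq_mul]
    have : (τ + e - (τ - e)) * (2 / (5 * e)) = 4 / 5 := by field_simp; ring
    rw [this]
  have hlim : Tendsto (fun e : ℝ =>
      (H (q + e * (-(Complex.I * α))) - H (q + e * (Complex.I * α))).im) (𝓝[>] 0) (𝓝 0) := by
    have h3 := (hH.tendsto.comp (hcurve (-(Complex.I * α)))).sub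
      (hH.tendsto.comp (hcurve (Complex.I * α)))
    rw [sub_self] at h3
    exact (Complex.continuous_im.tendsto 0).comp h3
  have := ge_of_tendsto hlim hjump
  norm_num at this

/-! ### Continuation of nodal curves, and their intersections -/

lemma mem_reZeros_iff {r : ℝ} {f : ℂ → ℂ} {z : ℂ} :
    z ∈ reZeros r f ↔ z ∈ Metric.ball (0 : ℂ) r ∧ (f z).re = 0 := Iff.rfl

namespace IsPowerChart

variable {f : ℂ → ℂ} {r : ℝ} {p : ℂ} {m : ℕ} {ε : ℝ} {ψ φ : ℂ → ℂ}

lemma exists_deriv_bounds {U : Set ℂ} (h : IsPowerChart f U p m ε ψ φ) :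
    ∃ δ c C : ℝ, 0 < δ ∧ δ ≤ ε ∧ 0 < c ∧ c ≤ C ∧
      ∀ w ∈ Metric.ball (0 : ℂ) δ, c ≤ ‖deriv ψ w‖ ∧ ‖deriv ψ w‖ ≤ C := by
  set d := ‖deriv ψ 0‖ with hd
  have hd0 : 0 < d := norm_pos_iff.2 (h.deriv_ne_zero h.zero_mem)
  have hc : ContinuousAt (fun w => ‖deriv ψ w‖) 0 := (h.analytic 0 h.zero_mem).deriv.continuousAt.norm
  obtain ⟨δ, hδ, hb⟩ := Metric.eventually_nhds_iff_ball.1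
    ((hc.eventually (lt_mem_nhds (by linarith : d / 2 < ‖deriv ψ 0‖))).and
      (hc.eventually (gt_mem_nhds (by linarith : ‖deriv ψ 0‖ < 2 * d))))
  refine ⟨min δ ε, d / 2, 2 * d, lt_min hδ h.pos, min_le_right _ _, half_pos hd0, by linarith,
    fun w hw => ?_⟩
  have := hb w (Metric.ball_subset_ball (min_le_left _ _) hw)
  exact ⟨this.1.le, this.2.le⟩

/-- Straight lines in a chart on which the `m`-th power is imaginary are unit speed curves in the
nodal set. -/
lemma exists_unitCurve_line (h : IsPowerChart f (Metric.ball 0 r) p m ε ψ φ)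
    (hp : (f p).re = 0) {c C : ℝ} (hc : 0 < c)
    (hb : ∀ w ∈ Metric.ball (0 : ℂ) ε, c ≤ ‖deriv ψ w‖ ∧ ‖deriv ψ w‖ ≤ C) {v : ℂ} (hv : ‖v‖ = 1)
    (hvm : (v ^ m).re = 0) :
    ∃ (J : Set ℝ) (A : ℝ → ℝ) (σ : ℝ → ℂ), IsUnitCurve (reZeros r f) J σ ∧ A 0 = 0 ∧
      Icc (-(c * ε / 2)) (c * ε / 2) ⊆ J ∧
      ∀ x : ℝ, |x| < ε → A x ∈ J ∧ |A x| ≤ C * |x| ∧ σ (A x) = ψ (x * v) ∧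
        deriv σ (A x) = deriv ψ (x * v) * v / ‖deriv ψ (x * v) * v‖ := by
  have hv0 : v ≠ 0 := by rintro rfl; simp at hv
  obtain ⟨A, σ, hA0, hA, h1, h2, h3, h4, h5⟩ := h.exists_unit_line hv0
  have hn : ∀ x : ℝ, ‖(x : ℂ) * v‖ = |x| := fun x => by
    rw [norm_mul, hv, mul_one, Complex.norm_real, Real.norm_eq_abs]
  simp only [hn, hv, mul_one] at hA h1 h2 h3 h4 h5
  have hmem : ∀ x : ℝ, |x| < ε → (x : ℂ) * v ∈ Metric.ball (0 : ℂ) ε := fun x hx => by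
    rw [mem_ball_zero_iff, hn]; exact hx
  -- The mean value theorem: arc length and chart parameter are comparable with the constants c and
  -- C.
  have hlow : ∀ x y : ℝ, |x| < ε → |y| < ε → x ≤ y → c * (y - x) ≤ A y - A x ∧
      A y - A x ≤ C * (y - x) := by
    intro x y hx hy hxy
    rcases hxy.eq_or_lt with rfl | hlt
    · simp
    have hin : ∀ z ∈ Icc x y, |z| < ε := fun z hz => abs_lt.2
      ⟨(abs_lt.1 hx).1.trans_le hz.1, hz.2.trans_lt (abs_lt.1 hy).2⟩
    obtain ⟨z, hz, hz2⟩ := exists_hasDerivAt_eq_slope A _ hlt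
      (fun z hz => (hA z (hin z hz)).continuousAt.continuousWithinAt)
      (fun z hz => hA z (hin z (Ioo_subset_Icc_self hz)))
    have hzb := hb _ (hmem z (hin z (Ioo_subset_Icc_self hz)))
    have hpos : 0 < y - x := sub_pos.2 hlt
    rw [eq_div_iff hpos.ne'] at hz2
    rw [← hz2]
    exact ⟨mul_le_mul_of_nonneg_right hzb.1 hpos.le, mul_le_mul_of_nonneg_right hzb.2 hpos.le⟩
  have hε := h.pos
  have habs : ∀ x : ℝ, |x| < ε → |A x| ≤ C * |x| := by
    intro x hx
    have h0 : |(0 : ℝ)| < ε := by simpa using hε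
    rcases le_total 0 x with hx0 | hx0
    · have := hlow 0 x h0 hx hx0
      rw [hA0, sub_zero, sub_zero] at this
      rw [abs_of_nonneg hx0, abs_of_nonneg ((mul_nonneg hc.le hx0).trans this.1)]
      exact this.2
    · have := hlow x 0 hx h0 hx0
      rw [hA0, zero_sub, zero_sub] at this
      rw [abs_of_nonpos hx0, abs_of_nonpos]
      · exact this.2
      · have := (mul_nonneg hc.le (neg_nonneg.2 hx0)).trans this.1
        linarith
  refine ⟨A '' {x : ℝ | |x| < ε}, A, σ, ⟨h1, h2, h3, ?_, ?_⟩, hA0, ?_, fun x hx =>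
    ⟨⟨x, hx, rfl⟩, habs x hx, h4 x hx, (h5 x hx).deriv⟩⟩
  · rintro _ ⟨x, hx, rfl⟩
    rw [(h5 x hx).deriv, norm_div, Complex.norm_real, norm_norm, div_self]
    exact norm_ne_zero_iff.2 (mul_ne_zero (h.deriv_ne_zero (hmem x hx)) hv0)
  · rintro _ ⟨x, hx, rfl⟩
    rw [h4 x hx, mem_reZeros_iff]
    refine ⟨h.maps _ (hmem x hx), ?_⟩
    rw [h.eq_pow _ (hmem x hx), Complex.add_re, hp, mul_pow, ← Complex.ofReal_pow,
      Complex.re_ofReal_mul, hvm]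
    simp
  · have hh : |ε / 2| < ε := by rw [abs_of_pos (by positivity)]; linarith
    have hh' : |-(ε / 2)| < ε := by rwa [abs_neg]
    have h0 : |(0 : ℝ)| < ε := by simpa using hε
    have e1 := (hlow 0 (ε / 2) h0 hh (by positivity)).1
    have e2 := (hlow (-(ε / 2)) 0 hh' h0 (by linarith)).1
    rw [hA0] at e1 e2
    exact (Icc_subset_Icc (by linarith) (by linarith)).trans
      (h2.ordConnected.out ⟨_, hh', rfl⟩ ⟨_, hh, rfl⟩)

end IsPowerChart

namespace IsNonconstHolo

variable {r : ℝ} {f : ℂ → ℂ} {I J : Set ℝ} {σ ρ : ℝ → ℂ}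

/-- Near each point of the nodal set, maximal curves continue for a uniform time. -/
lemma exists_uniform_time (hf : IsNonconstHolo r f) {p : ℂ} (hp : p ∈ reZeros r f) :
    ∃ η > 0, ∃ V ∈ 𝓝 p, ∀ I σ, IsMaxUnitCurve (reZeros r f) I σ → ∀ t ∈ I, σ t ∈ V →
      Icc (t - η) (t + η) ⊆ I := by
  obtain ⟨m, ε₀, ψ, φ, h₀⟩ := hf.exists_powerChart hp.1
  obtain ⟨ε, c, C, hε, hεε, hc, hcC, hb⟩ := h₀.exists_deriv_bounds
  have h := h₀.mono hε hεε
  have hC : 0 < C := hc.trans_le hcC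
  -- A point within chart distance δ of the centre has arc length parameter at most cε/4, while the
  -- line is parametrized at least over [-cε/2, cε/2]; this leaves cε/4 in both directions.
  set δ := min ε (c * ε / (4 * C)) with hδ
  have hδ0 : 0 < δ := lt_min hε (by positivity)
  refine ⟨c * ε / 4, by positivity, ψ '' Metric.ball 0 δ,
    h.image_mem_nhds (Metric.ball_mem_nhds _ hδ0), ?_⟩
  rintro I σ hσ t ht ⟨w, hw, hwt⟩
  have hwε : w ∈ Metric.ball (0 : ℂ) ε := Metric.ball_subset_ball (min_le_left _ _) hw
  -- It remains to find a chart line tangent to σ at time t. At the centre its direction is read off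
  -- from σ'; at any other point of the chart f is non-critical, so the radial line through the
  -- point must be tangent.
  suffices key : ∃ (v : ℂ) (x : ℝ), ‖v‖ = 1 ∧ (v ^ m).re = 0 ∧ |x| < δ ∧ ψ (x * v) = σ t ∧
      ∀ (K : Set ℝ) (ρ : ℝ → ℂ) (s : ℝ), IsUnitCurve (reZeros r f) K ρ → s ∈ K → ρ s = σ t →
        deriv ρ s = deriv ψ (x * v) * v / ‖deriv ψ (x * v) * v‖ →
        ∃ e : ℝ, (e = 1 ∨ e = -1) ∧ deriv ρ s = e * deriv σ t by
    obtain ⟨v, x, hv, hvm, hx, hxt, htan⟩ := key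
    obtain ⟨K, A, ρ, hρ, hA0, hK, hAx⟩ := h.exists_unitCurve_line hp.2 hc hb hv hvm
    obtain ⟨h1, h2, h3, h4⟩ := hAx x (hx.trans_le (min_le_left _ _))
    obtain ⟨e, he, hed⟩ := htan K ρ (A x) hρ h1 (h3.trans hxt) h4
    have hAsmall : |A x| ≤ c * ε / 4 := by
      refine h2.trans ?_
      have : |x| ≤ c * ε / (4 * C) := hx.le.trans (min_le_right _ _)
      calc C * |x| ≤ C * (c * ε / (4 * C)) := mul_le_mul_of_nonneg_left this hC.le
        _ = c * ε / 4 := by field_simp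
    intro y hy
    have hee : e * e = 1 := by rcases he with rfl | rfl <;> norm_num
    have hey : |e * (y - t)| ≤ c * ε / 4 := by
      rw [abs_mul, show |e| = 1 by rcases he with rfl | rfl <;> norm_num, one_mul, abs_le]
      exact ⟨by linarith [hy.1], by linarith [hy.2]⟩
    have hmem : e * (y - t) + A x ∈ K := hK (by
      rw [abs_le] at hAsmall hey
      exact ⟨by linarith [hAsmall.1, hey.1], by linarith [hAsmall.2, hey.2]⟩)
    have := (hσ.eq_of_tangent hρ he ht h1 (h3.trans hxt) hed hmem).1
    rwa [show e * (e * (y - t) + A x - A x) + t = y by linear_combination (y - t) * hee] at this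
  rcases eq_or_ne w 0 with rfl | hw0
  · have hpt : σ t = p := by rw [← hwt, h.map_zero]
    have hZ : ∀ᶠ s in 𝓝 t, (f (σ s)).re = 0 := by
      filter_upwards [hσ.isOpen.mem_nhds ht] with s hs using (hσ.maps s hs).2
    obtain ⟨hv1, -⟩ := h.exists_eq_line hp.2 (hσ.analytic t ht) hpt (hσ.deriv_ne_zero ht) hZ
    set v := deriv φ p * deriv σ t with hv
    have hv0 : v ≠ 0 := mul_ne_zero h.deriv_inv_ne_zero (hσ.deriv_ne_zero ht)
    have hvn : (‖v‖ : ℂ) ≠ 0 := by exact_mod_cast norm_ne_zero_iff.2 hv0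
    refine ⟨v / ‖v‖, 0, ?_, ?_, by simpa using hδ0, ?_, fun K ρ s _ _ _ h4 => ⟨1, Or.inl rfl, ?_⟩⟩
    · rw [norm_div, Complex.norm_real, norm_norm, div_self (norm_ne_zero_iff.2 hv0)]
    · rw [div_pow, ← Complex.ofReal_pow, Complex.div_ofReal_re, hv1, zero_div]
    · rw [Complex.ofReal_zero, zero_mul]; exact hwt
    · have h5 := h.deriv_mul_deriv h.zero_mem
      rw [h.map_zero] at h5
      have h6 : deriv ψ 0 * (v / ‖v‖) = deriv σ t / ‖v‖ := by
        rw [hv, ← mul_div_assoc, ← mul_assoc, mul_comm (deriv ψ 0), h5, one_mul]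
      rw [h4, Complex.ofReal_zero, zero_mul, h6, norm_div, hσ.unit t ht, Complex.norm_real,
        norm_norm]
      push_cast
      field_simp
  · have hwn : (‖w‖ : ℂ) ≠ 0 := by exact_mod_cast norm_ne_zero_iff.2 hw0
    have hxw : (‖w‖ : ℂ) * (w / ‖w‖) = w := mul_div_cancel₀ _ hwn
    refine ⟨w / ‖w‖, ‖w‖, ?_, ?_, ?_, by rw [hxw]; exact hwt, fun K ρ s hρ hs h3 _ => ?_⟩
    · rw [norm_div, Complex.norm_real, norm_norm, div_self (norm_ne_zero_iff.2 hw0)]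
    · have h1 : (f (σ t)).re = 0 := (hσ.maps t ht).2
      have h2 : (f p).re = 0 := hp.2
      rw [← hwt, h.eq_pow _ hwε, Complex.add_re, h2, zero_add] at h1
      rw [div_pow, ← Complex.ofReal_pow, Complex.div_ofReal_re, h1, zero_div]
    · rw [abs_norm]; simpa using hw
    · refine hf.tangent_unique hσ.toIsUnitCurve hρ ht hs h3 ?_
      rw [← hwt]
      exact h.deriv_ne_zero_of_ne hf.analytic hwε hw0

/-- In a chart, each straight line on which the `m`-th power is imaginary continues to a maximal
curve. -/
lemma exists_max_of_direction (hf : IsNonconstHolo r f) {p : ℂ} {m : ℕ} {ε : ℝ} {ψ φ : ℂ → ℂ}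
    (h₀ : IsPowerChart f (Metric.ball 0 r) p m ε ψ φ) (hp : (f p).re = 0) {v : ℂ} (hv : ‖v‖ = 1)
    (hvm : (v ^ m).re = 0) :
    ∃ I σ, IsMaxUnitCurve (reZeros r f) I σ ∧ (0 : ℝ) ∈ I ∧ σ 0 = p ∧
      deriv σ 0 = deriv ψ 0 * v / ‖deriv ψ 0‖ := by
  obtain ⟨δ, c, C, hδ, hδε, hc, hcC, hb⟩ := h₀.exists_deriv_bounds
  have h := h₀.mono hδ hδε
  obtain ⟨K, A, ρ, hρ, hA0, hK, hAx⟩ := h.exists_unitCurve_line hp hc hb hv hvm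
  obtain ⟨h1, h2, h3, h4⟩ := hAx 0 (by simpa using hδ)
  rw [hA0] at h1 h3 h4
  obtain ⟨I, σ, hσ, hI, h5, h6⟩ := hρ.exists_max hf h1
  refine ⟨I, σ, hσ, hI, ?_, ?_⟩
  · rw [h5, h3, Complex.ofReal_zero, zero_mul, h.map_zero]
  · rw [h6, h4, Complex.ofReal_zero, zero_mul, norm_mul, hv, mul_one]

lemma isC1Path (h : IsUnitCurve (reZeros r f) I σ) {s t : ℝ} (hs : s ∈ I) (ht : t ∈ I)
    (hst : s ≤ t) : IsC1Path σ (deriv σ) s t := by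
  have hsub : Icc s t ⊆ I := h.preconn.ordConnected.out hs ht
  exact ⟨hst, fun x hx => (h.analytic x (hsub hx)).differentiableAt.hasDerivAt,
    fun x hx => (h.analytic x (hsub hx)).deriv.continuousAt.continuousWithinAt⟩

/-- Curves in the nodal set do not meet themselves. -/
lemma injOn (hf : IsNonconstHolo r f) (h : IsUnitCurve (reZeros r f) I σ) : InjOn σ I := by
  suffices key : ∀ s ∈ I, ∀ t ∈ I, s < t → σ s ≠ σ t by
    intro s hs t ht hst
    rcases lt_trichotomy s t with h1 | h1 | h1
    · exact absurd hst (key s hs t ht h1)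
    · exact h1
    · exact absurd hst.symm (key t ht s hs h1)
  intro s hs t ht hst heq
  have hsub : Icc s t ⊆ I := h.preconn.ordConnected.out hs ht
  -- Pairs of coinciding parameters. A regular curve is locally injective, so `Q` is closed despite
  -- the strict inequality, and a shortest loop exists; the shortest loop is simple.
  let Q : Set (ℝ × ℝ) := {x | x ∈ Icc s t ×ˢ Icc s t ∧ x.1 < x.2 ∧ σ x.1 = σ x.2}
  have hloc : ∀ x ∈ Icc s t, ∀ᶠ y : ℝ × ℝ in 𝓝 (x, x), σ y.1 = σ y.2 → y.1 = y.2 := by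
    intro x hx
    have h1 : HasStrictDerivAt σ (deriv σ x) x := by
      have h2 := (h.analytic x (hsub hx)).contDiffAt (n := 1)
      exact h2.hasStrictDerivAt (by norm_num)
    have h2 := h1.isLittleO.def (half_pos (norm_pos_iff.2 (h.deriv_ne_zero (hsub hx))))
    filter_upwards [h2] with y hy hyy
    rw [hyy, sub_self, zero_sub, norm_neg, ContinuousLinearMap.toSpanSingleton_apply,
      norm_smul] at hy
    have h3 : 0 < ‖deriv σ x‖ := norm_pos_iff.2 (h.deriv_ne_zero (hsub hx))
    have h4 : ‖y.1 - y.2‖ = 0 := by nlinarith [norm_nonneg (y.1 - y.2)]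
    exact sub_eq_zero.1 (norm_eq_zero.1 h4)
  have hQclosed : IsClosed Q := by
    rw [← isOpen_compl_iff, isOpen_iff_mem_nhds]
    rintro ⟨x, y⟩ hxy
    by_cases hm : (x, y) ∈ Icc s t ×ˢ Icc s t
    · rcases lt_trichotomy x y with h1 | rfl | h1
      · have hne : σ x ≠ σ y := fun h2 => hxy ⟨hm, h1, h2⟩
        have hc : ContinuousAt (fun z : ℝ × ℝ => σ z.1 - σ z.2) (x, y) :=
          ((h.analytic x (hsub hm.1)).continuousAt.comp (x := (x, y)) continuousAt_fst).sub
            ((h.analytic y (hsub hm.2)).continuousAt.comp (x := (x, y)) continuousAt_snd)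
        filter_upwards [hc.eventually_ne (sub_ne_zero.2 hne)] with z hz hzQ
        exact hz (sub_eq_zero.2 hzQ.2.2)
      · filter_upwards [hloc x hm.1] with z hz hzQ
        exact hzQ.2.1.ne (hz hzQ.2.2)
      · have : {z : ℝ × ℝ | z.2 < z.1} ∈ 𝓝 (x, y) :=
          (isOpen_lt continuous_snd continuous_fst).mem_nhds h1
        filter_upwards [this] with z hz hzQ
        exact lt_asymm hz hzQ.2.1
    · have : (Icc s t ×ˢ Icc s t)ᶜ ∈ 𝓝 (x, y) :=
        (isClosed_Icc.prod isClosed_Icc).isOpen_compl.mem_nhds hm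
      filter_upwards [this] with z hz hzQ
      exact hz hzQ.1
  have hQc : IsCompact Q := (isCompact_Icc.prod isCompact_Icc).of_isClosed_subset hQclosed
    fun x hx => hx.1
  have hQne : Q.Nonempty := ⟨(s, t), ⟨⟨le_rfl, hst.le⟩, ⟨hst.le, le_rfl⟩⟩, hst, heq⟩
  obtain ⟨⟨a, b⟩, hab, hmin⟩ := hQc.exists_isMinOn hQne
    (continuous_snd.sub continuous_fst).continuousOn
  obtain ⟨⟨ha, hb⟩, hlt, hσab⟩ := hab
  simp only at ha hb hlt hσab
  have hsub2 : Icc a b ⊆ Icc s t := Icc_subset_Icc ha.1 hb.2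
  have hinj : ∀ x ∈ Icc a b, ∀ y ∈ Icc a b, x < y → σ x = σ y → x = a ∧ y = b := by
    intro x hx y hy hxy hxye
    have : b - a ≤ y - x := hmin (a := (x, y)) ⟨⟨hsub2 hx, hsub2 hy⟩, hxy, hxye⟩
    exact ⟨by linarith [hx.1, hy.2], by linarith [hx.1, hy.2]⟩
  have hpath := isC1Path h (hsub ha) (hsub hb) hlt.le
  -- The second path of `no_loop` degenerates to a point.
  have hpath0 : IsC1Path (fun _ => σ a) (fun _ => 0) a a :=
    ⟨le_rfl, fun x _ => hasDerivAt_const x _, continuousOn_const⟩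
  refine hf.no_loop hpath hpath0 (fun x hx => h.maps x (hsub (hsub2 hx)))
    (fun x _ => h.maps a (hsub ha)) rfl hσab.symm (τ := (a + b) / 2)
    ⟨by linarith, by linarith⟩ ?_ ?_ ?_
  · intro x hx hxe
    have hmid : (a + b) / 2 ∈ Icc a b := ⟨by linarith, by linarith⟩
    rcases lt_trichotomy x ((a + b) / 2) with h1 | h1 | h1
    · have := (hinj x hx _ hmid h1 hxe).2
      linarith
    · exact h1
    · have := (hinj _ hmid x hx h1 hxe.symm).1
      linarith
  · intro x _ hx
    have hmid : (a + b) / 2 ∈ Icc a b := ⟨by linarith, by linarith⟩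
    have := (hinj a ⟨le_rfl, hlt.le⟩ _ hmid (by linarith) hx).2
    linarith
  · exact h.deriv_ne_zero (hsub (hsub2 ⟨by linarith, by linarith⟩))

lemma tendsto_unit_secant (h : IsUnitCurve (reZeros r f) I σ) (h0 : (0 : ℝ) ∈ I) :
    Tendsto (fun t : ℝ => (σ t - σ 0) / ‖σ t - σ 0‖) (𝓝[>] 0) (𝓝 (deriv σ 0)) := by
  have h1 : HasDerivAt σ (deriv σ 0) 0 := (h.analytic 0 h0).differentiableAt.hasDerivAt
  have h2 : Tendsto (fun t : ℝ => t⁻¹ • (σ (0 + t) - σ 0)) (𝓝[>] 0) (𝓝 (deriv σ 0)) :=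
    (hasDerivAt_iff_tendsto_slope_zero.1 h1).mono_left
      (nhdsWithin_mono _ fun x hx => ne_of_gt hx)
  have h3 : Tendsto (fun t : ℝ => (t⁻¹ • (σ (0 + t) - σ 0)) / (‖t⁻¹ • (σ (0 + t) - σ 0)‖ : ℝ))
      (𝓝[>] 0) (𝓝 (deriv σ 0 / (‖deriv σ 0‖ : ℝ))) := by
    refine h2.div ((Complex.continuous_ofReal.tendsto _).comp h2.norm) ?_
    rw [h.unit 0 h0]; simp
  rw [h.unit 0 h0, Complex.ofReal_one, div_one] at h3
  refine h3.congr' ?_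
  filter_upwards [self_mem_nhdsWithin] with t ht
  have ht : (0 : ℝ) < t := ht
  rw [zero_add, norm_smul, Complex.real_smul, Real.norm_eq_abs, abs_of_pos (inv_pos.2 ht)]
  have : ((t⁻¹ : ℝ) : ℂ) ≠ 0 := by exact_mod_cast (inv_pos.2 ht).ne'
  rw [Complex.ofReal_mul, mul_div_mul_left _ _ this]

/-- Two curves in the nodal set leaving a point in different directions do not meet again. -/
lemma ne_of_deriv_ne (hf : IsNonconstHolo r f) (hσ : IsUnitCurve (reZeros r f) I σ)
    (hρ : IsUnitCurve (reZeros r f) J ρ) (hI : (0 : ℝ) ∈ I) (hJ : (0 : ℝ) ∈ J) (h0 : σ 0 = ρ 0)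
    (hd : deriv σ 0 ≠ deriv ρ 0) {s t : ℝ} (hs : s ∈ I) (ht : t ∈ J) (hs0 : 0 < s) (ht0 : 0 < t) :
    σ s ≠ ρ t := by
  intro heq
  have hsubI : Icc 0 s ⊆ I := hσ.preconn.ordConnected.out hI hs
  have hsubJ : Icc 0 t ⊆ J := hρ.preconn.ordConnected.out hJ ht
  have hcσ : ContinuousOn σ (Icc 0 s) := fun x hx =>
    (hσ.analytic x (hsubI hx)).continuousAt.continuousWithinAt
  have hcρ : ContinuousOn ρ (Icc 0 t) := fun x hx =>
    (hρ.analytic x (hsubJ hx)).continuousAt.continuousWithinAt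
  have hinjσ := hf.injOn hσ
  have hinjρ := hf.injOn hρ
  -- Near the common start the unit secants of the two curves approach different velocities, so
  -- small times give no meeting. Injectivity of ρ excludes that σ at a small time meets ρ at a late
  -- time.
  obtain ⟨η, hη, hsep⟩ : ∃ η > 0, ∀ x y : ℝ, 0 < x → x < η → x ≤ s → 0 < y → y ≤ t →
      σ x ≠ ρ y := by
    have hd2 : 0 < ‖deriv σ 0 - deriv ρ 0‖ / 2 := half_pos (norm_pos_iff.2 (sub_ne_zero.2 hd))
    have e1 := (Metric.tendsto_nhds.1 (tendsto_unit_secant hσ hI)) _ hd2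
    have e2 := (Metric.tendsto_nhds.1 (tendsto_unit_secant hρ hJ)) _ hd2
    rw [eventually_nhdsWithin_iff] at e1 e2
    obtain ⟨η₁, hη₁, hb1⟩ := Metric.eventually_nhds_iff.1 e1
    obtain ⟨η₂, hη₂, hb2⟩ := Metric.eventually_nhds_iff.1 e2
    have hK : IsCompact (ρ '' Icc (min η₂ t) t) := isCompact_Icc.image_of_continuousOn
      (hcρ.mono (Icc_subset_Icc (lt_min hη₂ ht0).le le_rfl))
    have hnot : σ 0 ∈ (ρ '' Icc (min η₂ t) t)ᶜ := by
      rintro ⟨y, hy, hye⟩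
      have hy0 : 0 < y := (lt_min hη₂ ht0).trans_le hy.1
      exact hy0.ne' (hinjρ (hsubJ ⟨hy0.le, hy.2⟩) hJ (hye.trans h0))
    have e3 := (hσ.analytic 0 hI).continuousAt.eventually
      (hK.isClosed.isOpen_compl.mem_nhds hnot)
    obtain ⟨η₃, hη₃, hb3⟩ := Metric.eventually_nhds_iff.1 e3
    refine ⟨min η₁ η₃, lt_min hη₁ hη₃, fun x y hx hxη hxs hy hyt hxy => ?_⟩
    have hx3 : dist x 0 < η₃ := by
      rw [Real.dist_0_eq_abs, abs_of_pos hx]; exact hxη.trans_le (min_le_right _ _)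
    have hx1 : dist x 0 < η₁ := by
      rw [Real.dist_0_eq_abs, abs_of_pos hx]; exact hxη.trans_le (min_le_left _ _)
    have hyη : y < η₂ := by
      by_contra! hle
      exact hb3 hx3 ⟨y, ⟨(min_le_left _ _).trans hle, hyt⟩, hxy.symm⟩
    have h1 := hb1 hx1 hx
    have h2 := hb2 (y := y) (by rwa [Real.dist_0_eq_abs, abs_of_pos hy]) hy
    rw [hxy, h0] at h1
    have h3 := dist_triangle_left (deriv σ 0) (deriv ρ 0) ((ρ y - ρ 0) / ‖ρ y - ρ 0‖)
    rw [dist_eq_norm (deriv σ 0)] at h3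
    linarith
  -- The earliest meeting time x at or after the cut-off. At the midpoint x/2 the curve σ is off the
  -- other path: x/2 is either too early for a meeting, by `hsep`, or would be an earlier element of
  -- `Cs`.
  let Cs : Set ℝ := Icc (min (η / 2) s) s ∩ σ ⁻¹' (ρ '' Icc 0 t)
  have hη2 : 0 < min (η / 2) s := lt_min (half_pos hη) hs0
  have hCc : IsCompact Cs := by
    refine isCompact_Icc.of_isClosed_subset ?_ inter_subset_left
    exact (hcσ.mono (Icc_subset_Icc hη2.le le_rfl)).preimage_isClosed_of_isClosed isClosed_Icc
      (isCompact_Icc.image_of_continuousOn hcρ).isClosed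
  have hCne : Cs.Nonempty := ⟨s, ⟨min_le_right _ _, le_rfl⟩, t, ⟨ht0.le, le_rfl⟩, heq.symm⟩
  obtain ⟨x, ⟨hx, y, hy, hxy⟩, hmin⟩ := hCc.exists_isMinOn hCne continuousOn_id
  have hx0 : 0 < x := hη2.trans_le hx.1
  have hIx : Icc 0 x ⊆ I := (Icc_subset_Icc le_rfl hx.2).trans hsubI
  have hJy : Icc 0 y ⊆ J := (Icc_subset_Icc le_rfl hy.2).trans hsubJ
  have hp1 := isC1Path hσ hI (hIx ⟨hx0.le, le_rfl⟩) hx0.le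
  have hp2 := isC1Path hρ hJ (hJy ⟨hy.1, le_rfl⟩) hy.1
  have hmid : x / 2 ∈ Icc 0 x := ⟨by linarith, by linarith⟩
  refine hf.no_loop hp1 hp2 (fun z hz => hσ.maps z (hIx hz)) (fun z hz => hρ.maps z (hJy hz)) h0
    hxy.symm (τ := x / 2) ⟨by linarith, by linarith⟩
    (fun z hz hze => hinjσ (hIx hz) (hIx hmid) hze) (fun z hz hze => ?_)
    (hσ.deriv_ne_zero (hIx hmid))
  rcases hz.1.eq_or_lt with rfl | hz0
  · rw [← h0] at hze
    have := hinjσ hI (hIx hmid) hze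
    linarith
  have hzt : z ≤ t := hz.2.trans hy.2
  by_cases hxη : x / 2 < η
  · exact hsep (x / 2) z (by linarith) hxη (by linarith [hx.2]) hz0 hzt hze.symm
  · push Not at hxη
    have hmem : x / 2 ∈ Cs := ⟨⟨(min_le_left _ _).trans (by linarith), by linarith [hx.2]⟩,
      z, ⟨hz0.le, hzt⟩, hze⟩
    have := hmin hmem
    simp only [mem_ofPred_eq, id] at this
    linarith

end IsNonconstHolo

/-! ### Nodal sets all of whose curves pass through 0 -/

/-- The directions `v` with `v ^ m` imaginary, up to sign. -/
noncomputable def nodalDir (m k : ℕ) : ℂ :=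
  Complex.exp (((Real.pi / 2 + Real.pi * k) / m : ℝ) * Complex.I)

lemma norm_nodalDir (m k : ℕ) : ‖nodalDir m k‖ = 1 := Complex.norm_exp_ofReal_mul_I _

lemma re_exp_ofReal_mul_I_pow (x : ℝ) (m : ℕ) :
    (Complex.exp (x * Complex.I) ^ m).re = Real.cos (m * x) := by
  rw [← Complex.exp_nat_mul, ← mul_assoc, ← Complex.exp_ofReal_mul_I_re]
  push_cast
  rfl

lemma re_nodalDir_pow {m : ℕ} (hm : 1 ≤ m) (k : ℕ) : (nodalDir m k ^ m).re = 0 := by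
  have : (m : ℝ) ≠ 0 := by positivity
  rw [nodalDir, re_exp_ofReal_mul_I_pow, mul_div_cancel₀ _ this, Real.cos_eq_zero_iff]
  exact ⟨k, by push_cast; ring⟩

/-- The arguments differ by π(j - k)/m, which is not a multiple of π since 0 < |j - k| < m. -/
lemma nodalDir_ne {m j k : ℕ} (hj : j < m) (hk : k < m) (hjk : j ≠ k) {e : ℝ} :
    nodalDir m j ≠ e * nodalDir m k := by
  intro h
  have hm : (m : ℝ) ≠ 0 := by have : 0 < m := by omega
                              positivity
  have h1 : nodalDir m j / nodalDir m k = e := by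
    rw [h, mul_div_cancel_right₀]
    rw [← norm_ne_zero_iff, norm_nodalDir]; exact one_ne_zero
  have h2 : nodalDir m j / nodalDir m k =
      Complex.exp ((Real.pi * ((j : ℝ) - k) / m : ℝ) * Complex.I) := by
    rw [nodalDir, nodalDir, ← Complex.exp_sub, ← sub_mul, ← Complex.ofReal_sub]
    congr 3
    ring
  have h3 := congrArg Complex.im (h2.symm.trans h1)
  rw [Complex.exp_ofReal_mul_I_im, Complex.ofReal_im, Real.sin_eq_zero_iff] at h3
  obtain ⟨n, hn⟩ := h3
  have h4 : (n : ℝ) * m = j - k := by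
    have h5 : Real.pi * ((n : ℝ) * m) = Real.pi * (j - k) := by
      rw [eq_div_iff hm] at hn; linarith
    exact mul_left_cancel₀ Real.pi_ne_zero h5
  have h5 : n * m = (j : ℤ) - k := by exact_mod_cast h4
  have hn0 : n = 0 := by
    by_contra h0
    have : (m : ℤ) ≤ |n * m| := by
      rw [abs_mul, Nat.abs_cast]
      nlinarith [Int.one_le_abs h0]
    rw [h5] at this
    have h6 : |(j : ℤ) - k| < m := by rw [abs_lt]; omega
    omega
  rw [hn0] at h5
  omega

/-- The number m · arg v equals π/2 + πj for an integer j. In j = m q + k the quotient q only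
contributes the sign (-1)^q. -/
lemma exists_eq_nodalDir {m : ℕ} (hm : 1 ≤ m) {v : ℂ} (hv : ‖v‖ = 1) (hvm : (v ^ m).re = 0) :
    ∃ k < m, ∃ e : ℝ, (e = 1 ∨ e = -1) ∧ v = e * nodalDir m k := by
  have h0 : v = Complex.exp (v.arg * Complex.I) := by
    have := Complex.norm_mul_exp_arg_mul_I v
    rw [hv, Complex.ofReal_one, one_mul] at this
    exact this.symm
  rw [h0, re_exp_ofReal_mul_I_pow, Real.cos_eq_zero_iff] at hvm
  obtain ⟨j, hj⟩ := hvm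
  have hmz : (0 : ℤ) < m := by exact_mod_cast hm
  obtain ⟨k, hk⟩ := Int.eq_ofNat_of_zero_le (Int.emod_nonneg j hmz.ne')
  have hkm : k < m := by have := Int.emod_lt_of_pos j hmz; omega
  have hj2 : (j : ℝ) = m * (j / (m : ℤ) : ℤ) + k := by
    have := Int.mul_ediv_add_emod j m
    rw [hk] at this
    exact_mod_cast this.symm
  set q := j / (m : ℤ)
  have harg : v.arg = (Real.pi / 2 + Real.pi * k) / m + q * Real.pi := by
    field_simp
    rw [hj2] at hj
    linarith
  refine ⟨k, hkm, (-1) ^ q, ?_, ?_⟩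
  · rcases Int.even_or_odd q with h | h
    · left; exact h.neg_one_zpow
    · right; exact h.neg_one_zpow
  · rw [h0, harg, nodalDir]
    push_cast
    rw [add_mul, Complex.exp_add, mul_comm]
    congr 1
    rw [mul_assoc, Complex.exp_int_mul, Complex.exp_pi_mul_I]

/-- All maximal curves in the nodal set pass through `0`. -/
def CurvesThroughZero (r : ℝ) (f : ℂ → ℂ) : Prop :=
  ∀ I σ, IsMaxUnitCurve (reZeros r f) I σ → I.Nonempty → (0 : ℂ) ∈ σ '' I

namespace IsNonconstHolo

variable {r : ℝ} {f : ℂ → ℂ} {I J : Set ℝ} {σ ρ : ℝ → ℂ}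

/-- Orients a curve so that 0 is reached at a positive time, as `ne_of_deriv_ne` requires. -/
lemma exists_reach (ht : CurvesThroughZero r f)
    (hσ : IsMaxUnitCurve (reZeros r f) I σ) (h0 : (0 : ℝ) ∈ I) (hne : σ 0 ≠ 0) :
    ∃ (e : ℝ) (J : Set ℝ) (ρ : ℝ → ℂ), (e = 1 ∨ e = -1) ∧ IsMaxUnitCurve (reZeros r f) J ρ ∧
      (0 : ℝ) ∈ J ∧ ρ 0 = σ 0 ∧ deriv ρ 0 = e * deriv σ 0 ∧ ∃ t ∈ J, 0 < t ∧ ρ t = 0 := by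
  obtain ⟨t, htI, ht0⟩ := ht I σ hσ ⟨0, h0⟩
  have htne : t ≠ 0 := by rintro rfl; exact hne ht0
  obtain ⟨e, he, het⟩ : ∃ e : ℝ, (e = 1 ∨ e = -1) ∧ 0 < e * t := by
    rcases htne.lt_or_gt with h | h
    · exact ⟨-1, Or.inr rfl, by linarith⟩
    · exact ⟨1, Or.inl rfl, by linarith⟩
  have hee : e * e = 1 := by rcases he with rfl | rfl <;> norm_num
  have hd := (hσ.toIsUnitCurve.comp_affine he 0).2 0 (by simpa using h0)
  refine ⟨e, _, _, he, hσ.comp_affine he 0, by simpa using h0, by simp, ?_, e * t, ?_, het, ?_⟩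
  · rw [hd]; simp
  · simpa [← mul_assoc, hee] using htI
  · simpa [← mul_assoc, hee] using ht0

/-- The nodal set has no critical points besides `0`. -/
lemma deriv_ne_zero (hf : IsNonconstHolo r f) (ht : CurvesThroughZero r f) {p : ℂ}
    (hp : p ∈ reZeros r f) (hp0 : p ≠ 0) : deriv f p ≠ 0 := by
  intro hd
  obtain ⟨m, ε, ψ, φ, h⟩ := hf.exists_powerChart hp.1
  have hm : 2 ≤ m := by
    by_contra hlt
    have hm1 : m = 1 := by have := h.one_le; omega
    have := h.deriv_comp hf.analytic h.zero_mem
    rw [h.map_zero, hd, hm1] at this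
    simp at this
  have hψ : deriv ψ 0 ≠ 0 := h.deriv_ne_zero h.zero_mem
  have hψn : (‖deriv ψ 0‖ : ℂ) ≠ 0 := by exact_mod_cast norm_ne_zero_iff.2 hψ
  -- If f were critical at p, then m ≥ 2 and two transversal nodal curves through p would both lead
  -- to 0, meeting again there.
  have key : ∀ k : ℕ, ∃ (e : ℝ) (J : Set ℝ) (ρ : ℝ → ℂ), (e = 1 ∨ e = -1) ∧
      IsMaxUnitCurve (reZeros r f) J ρ ∧ (0 : ℝ) ∈ J ∧ ρ 0 = p ∧
      deriv ρ 0 = e * (deriv ψ 0 * nodalDir m k / ‖deriv ψ 0‖) ∧ ∃ t ∈ J, 0 < t ∧ ρ t = 0 := by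
    intro k
    obtain ⟨I, σ, hσ, hI, h1, h2⟩ := hf.exists_max_of_direction h hp.2 (norm_nodalDir m k)
      (re_nodalDir_pow h.one_le k)
    obtain ⟨e, J, ρ, he, hρ, hJ, h3, h4, h5⟩ := exists_reach ht hσ hI (h1 ▸ hp0)
    exact ⟨e, J, ρ, he, hρ, hJ, h3.trans h1, h2 ▸ h4, h5⟩
  obtain ⟨e₁, J₁, ρ₁, he₁, hρ₁, hJ₁, h1, h1', t₁, ht₁, ht₁0, hρt₁⟩ := key 0
  obtain ⟨e₂, J₂, ρ₂, he₂, hρ₂, hJ₂, h2, h2', t₂, ht₂, ht₂0, hρt₂⟩ := key 1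
  refine hf.ne_of_deriv_ne hρ₁.toIsUnitCurve hρ₂.toIsUnitCurve hJ₁ hJ₂ (h1.trans h2.symm) ?_
    ht₁ ht₂ ht₁0 ht₂0 (hρt₁.trans hρt₂.symm)
  rw [h1', h2']
  intro heq
  have h3 : (e₁ : ℂ) * nodalDir m 0 = e₂ * nodalDir m 1 := by
    field_simp at heq
    exact heq
  refine nodalDir_ne (m := m) (j := 0) (k := 1) (by omega) (by omega) (by omega)
    (e := e₁ * e₂) ?_
  have h4 : (e₁ : ℂ) * e₁ = 1 := by rcases he₁ with rfl | rfl <;> norm_num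
  rw [Complex.ofReal_mul, mul_assoc, ← h3, ← mul_assoc, h4, one_mul]

/-- Maximal curves with the same trace have parallel tangents where they agree. -/
lemma deriv_eq_of_image_eq (hf : IsNonconstHolo r f) (hσ : IsMaxUnitCurve (reZeros r f) I σ)
    (hρ : IsMaxUnitCurve (reZeros r f) J ρ) (hI : (0 : ℝ) ∈ I) (hJ : (0 : ℝ) ∈ J) (h0 : ρ 0 = σ 0)
    (him : σ '' I = ρ '' J) : ∃ e : ℝ, (e = 1 ∨ e = -1) ∧ deriv ρ 0 = e * deriv σ 0 := by
  obtain ⟨s, hs, hds⟩ := hf.exists_deriv_ne_zero_curve hσ.toIsUnitCurve hI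
  obtain ⟨t, ht, hts⟩ : σ s ∈ ρ '' J := him ▸ ⟨s, hs, rfl⟩
  obtain ⟨e, he, hed⟩ := hf.tangent_unique hσ.toIsUnitCurve hρ.toIsUnitCurve hs ht hts hds
  have key := fun x (hx : x ∈ J) => hσ.eq_of_tangent hρ.toIsUnitCurve he hs ht hts hed hx
  have h1 : e * (0 - t) + s = 0 := hf.injOn hσ.toIsUnitCurve (key 0 hJ).1 hI
    ((key 0 hJ).2.symm.trans h0)
  refine ⟨e, he, ?_⟩
  have h2 : ρ =ᶠ[𝓝 0] fun x => σ (e * x + 0) := by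
    filter_upwards [hρ.isOpen.mem_nhds hJ] with x hx
    rw [(key x hx).2]
    congr 1
    linarith
  rw [h2.deriv_eq, (hσ.toIsUnitCurve.comp_affine he 0).2 0 (by simpa using hI)]
  simp

lemma image_eq_of_deriv_eq (hσ : IsMaxUnitCurve (reZeros r f) I σ)
    (hρ : IsMaxUnitCurve (reZeros r f) J ρ) (hI : (0 : ℝ) ∈ I) (hJ : (0 : ℝ) ∈ J) (h0 : ρ 0 = σ 0)
    {e : ℝ} (he : e = 1 ∨ e = -1) (hd : deriv ρ 0 = e * deriv σ 0) : σ '' I = ρ '' J := by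
  have hee : (e : ℂ) * e = 1 := by rcases he with rfl | rfl <;> norm_num
  apply Subset.antisymm
  · rintro _ ⟨x, hx, rfl⟩
    have h1 := hρ.eq_of_tangent hσ.toIsUnitCurve he hJ hI h0.symm
      (by rw [hd, ← mul_assoc, hee, one_mul]) hx
    exact ⟨_, h1.1, h1.2.symm⟩
  · rintro _ ⟨x, hx, rfl⟩
    have h1 := hσ.eq_of_tangent hρ.toIsUnitCurve he hI hJ h0 hd hx
    exact ⟨_, h1.1, h1.2.symm⟩

/-- If all nodal curves pass through `0`, then their number is the order of `f` at `0`. -/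
lemma encard_nodal (hf : IsNonconstHolo r f) (ht : CurvesThroughZero r f) {m : ℕ} {ε : ℝ}
    {ψ φ : ℂ → ℂ} (h : IsPowerChart f (Metric.ball 0 r) 0 m ε ψ φ) (h0 : (f 0).re = 0) :
    {Γ : Set ℂ | IsNodalCurve r (fun z => (f z).re) Γ}.encard = m := by
  have hψ : deriv ψ 0 ≠ 0 := h.deriv_ne_zero h.zero_mem
  have hψn : (‖deriv ψ 0‖ : ℂ) ≠ 0 := by exact_mod_cast norm_ne_zero_iff.2 hψ
  -- One curve for each of the m directions up to sign; opposite directions give the same trace, run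
  -- backwards.
  choose I σ hσ hI hσ0 hdσ using fun k : Fin m => hf.exists_max_of_direction h h0
    (norm_nodalDir m k) (re_nodalDir_pow h.one_le k)
  have hrange : {Γ : Set ℂ | IsNodalCurve r (fun z => (f z).re) Γ} =
      range fun k => σ k '' I k := by
    ext Γ
    constructor
    · intro hΓ
      obtain ⟨⟨⟨γ, hγ, rfl⟩, -⟩, -⟩ := id hΓ
      obtain ⟨J', ρ', hρ', hJ', him', -⟩ := hf.exists_max_of_isNodalCurve hγ hΓ 0
      obtain ⟨t, htJ, ht0⟩ := ht J' ρ' hρ' ⟨0, hJ'⟩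
      have hρ := hρ'.comp_affine (Or.inl rfl : (1 : ℝ) = 1 ∨ (1 : ℝ) = -1) t
      have him : (fun x => ρ' (1 * x + t)) '' {x | 1 * x + t ∈ J'} = range γ := by
        rw [← him']
        ext z
        constructor
        · rintro ⟨x, hx, rfl⟩; exact ⟨_, hx, rfl⟩
        · rintro ⟨x, hx, rfl⟩; exact ⟨x - t, by simpa using hx, by simp⟩
      have hJ : (0 : ℝ) ∈ {x | 1 * x + t ∈ J'} := by simpa using htJ
      have hρ0 : (fun x => ρ' (1 * x + t)) 0 = 0 := by simpa using ht0
      generalize (fun x => ρ' (1 * x + t)) = ρ at *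
      generalize {x | 1 * x + t ∈ J'} = J at *
      have hZ : ∀ᶠ s in 𝓝 0, (f (ρ s)).re = 0 := by
        filter_upwards [hρ.isOpen.mem_nhds hJ] with s hs using (hρ.maps s hs).2
      have hv1 := (h.exists_eq_line h0 (hρ.analytic 0 hJ) hρ0 (hρ.deriv_ne_zero hJ) hZ).1
      set v := deriv φ 0 * deriv ρ 0 with hv
      have h5 := h.deriv_mul_deriv h.zero_mem
      rw [h.map_zero] at h5
      have hvn : ‖v‖ = ‖deriv ψ 0‖⁻¹ := by
        rw [hv, norm_mul, hρ.unit 0 hJ, mul_one]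
        refine eq_inv_of_mul_eq_one_left ?_
        rw [← norm_mul, h5, norm_one]
      obtain ⟨k, hk, e, he, hke⟩ := exists_eq_nodalDir h.one_le (v := ‖deriv ψ 0‖ * v)
        (by rw [norm_mul, Complex.norm_real, norm_norm, hvn,
          mul_inv_cancel₀ (norm_ne_zero_iff.2 hψ)])
        (by rw [mul_pow, ← Complex.ofReal_pow, Complex.re_ofReal_mul, hv1, mul_zero])
      refine ⟨⟨k, hk⟩, ?_⟩
      rw [← him]
      refine image_eq_of_deriv_eq (hσ _) hρ (hI _) hJ (by rw [hσ0, hρ0]) he ?_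
      have h6 : deriv ψ 0 * v = deriv ρ 0 := by
        rw [hv, ← mul_assoc, mul_comm (deriv ψ 0), h5, one_mul]
      rw [hdσ, ← h6]
      simp only
      have h7 : v = e * nodalDir m k / ‖deriv ψ 0‖ := by
        rw [eq_div_iff hψn, mul_comm]; exact hke
      rw [h7]
      ring
    · rintro ⟨k, rfl⟩
      exact hf.isNodalCurve_of_max (hσ k) ⟨0, hI k⟩
  have hinj : Function.Injective fun k => σ k '' I k := by
    intro j k hjk
    by_contra hne
    obtain ⟨e, -, hed⟩ := hf.deriv_eq_of_image_eq (hσ k) (hσ j) (hI k) (hI j)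
      ((hσ0 j).trans (hσ0 k).symm) hjk.symm
    refine nodalDir_ne j.2 k.2 (fun h => hne (Fin.ext h)) (e := e) ?_
    rw [hdσ, hdσ] at hed
    field_simp at hed
    exact hed
  rw [hrange, ← image_univ, hinj.encard_image, encard_univ, ENat.card_eq_coe_fintype_card,
    Fintype.card_fin]

/-- Each component of a nodal domain has `0` on its boundary. -/
lemma zero_mem_closure (hf : IsNonconstHolo r f) (ht : CurvesThroughZero r f) (h0 : (f 0).re = 0)
    {q : ℂ} (hq : q ∈ Metric.ball (0 : ℂ) r) (hq0 : 0 < (f q).re) :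
    (0 : ℂ) ∈ closure (connectedComponentIn {z | z ∈ Metric.ball (0 : ℂ) r ∧ 0 < (f z).re} q) := by
  set S := {z | z ∈ Metric.ball (0 : ℂ) r ∧ 0 < (f z).re} with hS
  set W := connectedComponentIn S q with hW
  have hcont : ContinuousOn (fun z => (f z).re) (Metric.ball 0 r) :=
    Complex.continuous_re.comp_continuousOn hf.analytic.continuousOn
  have hcat : ∀ z ∈ Metric.ball (0 : ℂ) r, ContinuousAt (fun z => (f z).re) z := fun z hz =>
    hcont.continuousAt (Metric.isOpen_ball.mem_nhds hz)
  have hSo : IsOpen S := hcont.isOpen_inter_preimage Metric.isOpen_ball isOpen_Ioi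
  have hqS : q ∈ S := ⟨hq, hq0⟩
  have hqW : q ∈ W := mem_connectedComponentIn hqS
  have hWo : IsOpen W := hSo.connectedComponentIn
  have hWS : W ⊆ S := connectedComponentIn_subset _ _
  have hr : 0 < r := (norm_nonneg q).trans_lt (by simpa using hq)
  have hmeet : ∀ A : Set ℂ, IsPreconnected A → A ⊆ S → (A ∩ W).Nonempty → A ⊆ W := by
    rintro A hA hAS ⟨x, hxA, hxW⟩
    rw [hW, connectedComponentIn_eq hxW]
    exact hA.subset_connectedComponentIn hxA hAS
  have hbdry : ∀ p ∈ Metric.ball (0 : ℂ) r, p ∈ closure W → p ∉ W → (f p).re = 0 := by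
    intro p hp hpc hpW
    rcases lt_trichotomy (f p).re 0 with h1 | h1 | h1
    · have h2 : ∀ᶠ z in 𝓝 p, (f z).re < 0 := (hcat p hp).eventually (gt_mem_nhds h1)
      obtain ⟨z, hz1, hz2⟩ := mem_closure_iff_nhds.1 hpc _ h2
      exact absurd (hWS hz2).2 (not_lt.2 (le_of_lt hz1))
    · exact h1
    · exfalso
      obtain ⟨δ, hδ, hb⟩ := Metric.isOpen_iff.1 hSo p ⟨hp, h1⟩
      refine hpW (hmeet _ (convex_ball p δ).isPreconnected hb ?_ (Metric.mem_ball_self hδ))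
      exact mem_closure_iff_nhds.1 hpc _ (Metric.ball_mem_nhds p hδ)
  -- W does not fill the disc, because Re f vanishes at 0; hence it has a boundary point inside the
  -- disc.
  obtain ⟨p, hp, hpc, hpW⟩ : ∃ p ∈ Metric.ball (0 : ℂ) r, p ∈ closure W ∧ p ∉ W := by
    by_contra! hno
    have h1 : Metric.ball (0 : ℂ) r ⊆ W :=
      (convex_ball (0 : ℂ) r).isPreconnected.subset_of_closure_inter_subset hWo ⟨q, hq, hqW⟩
        fun z hz => hno z hz.2 hz.1
    exact absurd (hWS (h1 (Metric.mem_ball_self hr))).2 (by rw [h0]; exact lt_irrefl _)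
  have hpZ : p ∈ reZeros r f := ⟨hp, hbdry p hp hpc hpW⟩
  rcases eq_or_ne p 0 with rfl | hp0
  · exact hpc
  obtain ⟨m, ε, ψ, φ, h⟩ := hf.exists_powerChart hp
  obtain ⟨I, σ, hσ, hI, h1, -⟩ := hf.exists_max_of_direction h hpZ.2 (norm_nodalDir m 0)
    (re_nodalDir_pow h.one_le 0)
  obtain ⟨e, J, ρ, he, hρ, hJ, h3, -, t, htJ, ht0, hρt⟩ := exists_reach ht hσ hI (h1 ▸ hp0)
  have hsub : Icc 0 t ⊆ J := hρ.preconn.ordConnected.out hJ htJ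
  have hcρ : ContinuousOn ρ (Icc 0 t) := fun x hx =>
    (hρ.analytic x (hsub hx)).continuousAt.continuousWithinAt
  -- Follow the nodal curve from the boundary point p to 0 by continuous induction on the times at
  -- which it stays in the closure of W.
  have hclosed : IsClosed ({s | ρ s ∈ closure W} ∩ Icc 0 t) := by
    rw [inter_comm]
    exact hcρ.preimage_isClosed_of_isClosed isClosed_Icc isClosed_closure
  have := hclosed.Icc_subset_of_forall_mem_nhdsWithin
    (show (0 : ℝ) ∈ {s | ρ s ∈ closure W} by
      rw [mem_ofPred_eq, h3, h1]; exact hpc) ?_ (right_mem_Icc.2 ht0.le)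
  · rw [mem_ofPred_eq, hρt] at this
    exact this
  rintro s ⟨hs1, hs2⟩
  have hsJ : s ∈ J := hsub (Ico_subset_Icc_self hs2)
  have hsne : ρ s ≠ 0 := by
    rw [← hρt]
    intro h4
    exact hs2.2.ne (hf.injOn hρ.toIsUnitCurve hsJ htJ h4)
  have hsZ := hρ.maps s hsJ
  obtain ⟨m', ε', ψ', φ', h'⟩ := hf.exists_powerChart hsZ.1
  obtain rfl := h'.eq_one_of_deriv_ne_zero hf.analytic (hf.deriv_ne_zero ht hsZ hsne)
  have hre : ∀ w ∈ Metric.ball (0 : ℂ) ε', (f (ψ' w)).re = w.re := by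
    intro w hw
    have h5 : (f (ρ s)).re = 0 := hsZ.2
    rw [h'.eq_pow w hw, Complex.add_re, h5, zero_add, pow_one]
  -- At a non-critical point the chart turns Re f into Re w, so the positive side is a single
  -- half-disc. It meets W and is connected, hence lies in W, and the nodal arc is in its closure.
  let H : Set ℂ := Metric.ball 0 ε' ∩ {w | 0 < w.re}
  have hHc : Convex ℝ H := (convex_ball _ _).inter (convex_halfSpace_re_gt 0)
  have hHp : IsPreconnected (ψ' '' H) := hHc.isPreconnected.image _
    (h'.analytic.continuousOn.mono inter_subset_left)
  have hHS : ψ' '' H ⊆ S := by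
    rintro _ ⟨w, hw, rfl⟩
    exact ⟨h'.maps w hw.1, by rw [hre w hw.1]; exact hw.2⟩
  have hHW : ψ' '' H ⊆ W := by
    refine hmeet _ hHp hHS ?_
    obtain ⟨z, hz1, hz2⟩ := mem_closure_iff_nhds.1 hs1 _ h'.right_inv
    refine ⟨z, ⟨φ' z, ⟨hz1.1, ?_⟩, hz1.2⟩, hz2⟩
    rw [mem_ofPred_eq, ← hre _ hz1.1, hz1.2]
    exact (hWS hz2).2
  have hev : ∀ᶠ x in 𝓝 s, φ' (ρ x) ∈ Metric.ball (0 : ℂ) ε' ∧ ψ' (φ' (ρ x)) = ρ x :=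
    (hρ.analytic s hsJ).continuousAt.eventually h'.right_inv
  refine mem_nhdsWithin_of_mem_nhds ?_
  filter_upwards [hev, hρ.isOpen.mem_nhds hsJ] with x hx hxJ
  rw [← hx.2]
  set w := φ' (ρ x) with hw
  have hw0 : w.re = 0 := by rw [← hre w hx.1, hx.2]; exact (hρ.maps x hxJ).2
  have hwc : w ∈ closure H := by
    rw [Metric.mem_closure_iff]
    intro δ hδ
    have hn : ‖w‖ < ε' := by simpa using hx.1
    set y := min (δ / 2) ((ε' - ‖w‖) / 2) with hy
    have hy0 : 0 < y := lt_min (by positivity) (by linarith)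
    have hyn : ‖(y : ℂ)‖ = y := by rw [Complex.norm_real, Real.norm_eq_abs, abs_of_pos hy0]
    refine ⟨w + y, ⟨?_, ?_⟩, ?_⟩
    · rw [mem_ball_zero_iff]
      have := norm_add_le w y
      have h6 : y ≤ (ε' - ‖w‖) / 2 := min_le_right _ _
      rw [hyn] at this
      linarith
    · rw [mem_ofPred_eq, Complex.add_re, hw0, Complex.ofReal_re, zero_add]; exact hy0
    · rw [dist_eq_norm, sub_add_cancel_left, norm_neg, hyn]
      have : y ≤ δ / 2 := min_le_left _ _
      linarith
  have hcw : ContinuousAt ψ' w := (h'.analytic w hx.1).continuousAt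
  exact closure_mono hHW (hcw.continuousWithinAt.mem_closure_image hwc)

end IsNonconstHolo

/-! ### A crosscut theorem by branches of the logarithm -/

/-- A quotient that is real and at most 0 would exhibit z as a convex combination of q and q'. -/
lemma mem_slitPlane_of_notMem_segment {q q' z : ℂ} (hz : z ∉ segment ℝ q q') :
    (q' - z) / (q - z) ∈ Complex.slitPlane := by
  have hq : q - z ≠ 0 := fun h => hz (sub_eq_zero.1 h ▸ left_mem_segment ℝ q q')
  rw [Complex.mem_slitPlane_iff_not_le_zero]
  intro hle
  rw [Complex.le_def] at hle
  set w := (q' - z) / (q - z) with hw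
  have h1 : w = (w.re : ℂ) := Complex.ext rfl (by simpa using hle.2)
  have h2 : w.re ≤ 0 := hle.1
  set t := -w.re with ht
  have ht0 : 0 ≤ t := by linarith
  have h3 : q' - z = -(t : ℂ) * (q - z) := by
    rw [ht, Complex.ofReal_neg, neg_neg, ← h1, hw, div_mul_cancel₀ _ hq]
  refine hz ⟨t / (1 + t), 1 / (1 + t), by positivity, by positivity, by field_simp; ring, ?_⟩
  have h4 : (1 + t : ℂ) ≠ 0 := by
    have : (1 + t : ℝ) ≠ 0 := by positivity
    exact_mod_cast this
  simp only [Complex.real_smul]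
  push_cast
  field_simp
  linear_combination h3

/-- In a connected open set two points are joined by a compact set outside of which the logarithm
of the quotient of the distances to these points has a branch. -/
lemma exists_log_quotient {P : Set ℂ} (hPo : IsOpen P) (hPc : IsPreconnected P) {p q : ℂ}
    (hp : p ∈ P) (hq : q ∈ P) :
    ∃ K ⊆ P, IsCompact K ∧ ∃ G : ℂ → ℂ, ∀ z ∉ K, HasDerivAt G (1 / (p - z) - 1 / (q - z)) z := by
  -- Near each point a segment serves as the cut; the relation is symmetric and transitive, so
  -- connectedness extends it to all pairs.
  refine hPc.induction₂ (fun p q => ∃ K ⊆ P, IsCompact K ∧ ∃ G : ℂ → ℂ, ∀ z ∉ K,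
    HasDerivAt G (1 / (p - z) - 1 / (q - z)) z) ?_ ?_ ?_ hp hq
  · intro q hq
    obtain ⟨δ, hδ, hb⟩ := Metric.isOpen_iff.1 hPo q hq
    refine mem_nhdsWithin_of_mem_nhds ?_
    filter_upwards [Metric.ball_mem_nhds q hδ] with q' hq'
    refine ⟨segment ℝ q q', ((convex_ball q δ).segment_subset (Metric.mem_ball_self hδ) hq').trans hb,
      ?_, fun z => Complex.log ((q' - z) / (q - z)), fun z hz => ?_⟩
    · rw [segment_eq_image]
      exact isCompact_Icc.image (by fun_prop)
    · have hqz : q - z ≠ 0 := fun h => hz (sub_eq_zero.1 h ▸ left_mem_segment ℝ q q')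
      have hqz' : q' - z ≠ 0 := fun h => hz (sub_eq_zero.1 h ▸ right_mem_segment ℝ q q')
      have h1 : HasDerivAt (fun z => q' - z) (-1) z := (hasDerivAt_id z).const_sub q'
      have h2 : HasDerivAt (fun z => q - z) (-1) z := (hasDerivAt_id z).const_sub q
      refine ((h1.div h2 hqz).clog (mem_slitPlane_of_notMem_segment hz)).congr_deriv ?_
      simp only [Pi.div_apply]
      field_simp
      ring
  · rintro x y z - - - ⟨K, hK, hKc, G, hG⟩ ⟨K', hK', hKc', G', hG'⟩
    refine ⟨K ∪ K', union_subset hK hK', hKc.union hKc', fun w => G w + G' w, fun w hw => ?_⟩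
    refine ((hG w fun h => hw (Or.inl h)).add (hG' w fun h => hw (Or.inr h))).congr_deriv (by ring)
  · rintro x y - - ⟨K, hK, hKc, G, hG⟩
    exact ⟨K, hK, hKc, fun w => -G w, fun w hw => (hG w hw).fun_neg.congr_deriv (by ring)⟩

/-- For w = t e^{iβ} the quotient (1 - w⁻¹)/(1 - w) equals -w⁻¹, which gives the value modulo 2π;
the sign of sin β excludes every nonzero multiple of 2π. -/
lemma im_log_one_sub_inv_sub_log {t β : ℝ} (ht : 1 < t) (h0 : 0 < β) (h1 : β < 2 * Real.pi) :
    (Complex.log (1 - (circleMap 0 t β)⁻¹) - Complex.log (1 - circleMap 0 t β)).im =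
      Real.pi - β := by
  have ht0 : 0 < t := by linarith
  set w := circleMap 0 t β with hw
  have hwn : ‖w‖ = t := by rw [hw, norm_circleMap_zero, abs_of_pos ht0]
  have hw0 : w ≠ 0 := by rw [← norm_pos_iff, hwn]; exact ht0
  have hw1 : 1 - w ≠ 0 := fun h => by
    rw [← sub_eq_zero.1 h, norm_one] at hwn; exact ht.ne hwn
  have hwi : 1 - w⁻¹ ≠ 0 := fun h => by
    have : w = 1 := by rw [← inv_inv w, ← sub_eq_zero.1 h, inv_one]
    rw [this, sub_self] at hw1; exact hw1 rfl
  have hexp : Complex.exp (Complex.log (1 - w⁻¹) - Complex.log (1 - w)) =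
      Complex.exp (((-Real.log t : ℝ) : ℂ) + (Real.pi - β : ℝ) * Complex.I) := by
    rw [Complex.exp_sub, Complex.exp_log hwi, Complex.exp_log hw1, Complex.exp_add,
      ← Complex.ofReal_exp, Real.exp_neg, Real.exp_log ht0, Complex.ofReal_sub, sub_mul,
      Complex.exp_sub, Complex.exp_pi_mul_I]
    have h2 : w = t * Complex.exp (β * Complex.I) := by rw [hw, circleMap_zero]
    have h3 : (1 - w⁻¹) / (1 - w) = - w⁻¹ := by
      rw [div_eq_iff hw1]
      field_simp
      ring
    rw [h3, h2, mul_inv]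
    push_cast
    ring
  obtain ⟨n, hn⟩ := Complex.exp_eq_exp_iff_exists_int.1 hexp
  have him := congrArg Complex.im hn
  have e1 : (((-Real.log t : ℝ) : ℂ) + (Real.pi - β : ℝ) * Complex.I +
      n * (2 * Real.pi * Complex.I)).im = Real.pi - β + n * (2 * Real.pi) := by
    simp
  rw [e1] at him
  rw [him]
  have h1im : (1 - w⁻¹).im = t⁻¹ * Real.sin β := by
    rw [hw, circleMap_zero_inv, Complex.sub_im, circleMap_zero_im, Real.sin_neg]; simp
  have h2im : (1 - w).im = -(t * Real.sin β) := by
    rw [hw, Complex.sub_im, circleMap_zero_im]; simp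
  have h1re : 0 < (1 - w⁻¹).re := by
    have h3 : ‖w⁻¹‖ < 1 := by rw [norm_inv, hwn]; exact inv_lt_one_of_one_lt₀ ht
    have := (Complex.re_le_norm w⁻¹).trans_lt h3
    rw [Complex.sub_re, Complex.one_re]; linarith
  rw [Complex.sub_im, Complex.log_im, Complex.log_im] at him
  have hA := abs_lt.1 (Complex.abs_arg_lt_pi_div_two_iff.2 (Or.inl h1re))
  have hB1 := Complex.neg_pi_lt_arg (1 - w)
  have hB2 := Complex.arg_le_pi (1 - w)
  have hpi := Real.pi_pos
  have hn0 : (n : ℝ) < 1 ∧ -1 < (n : ℝ) := by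
    rcases lt_trichotomy β Real.pi with hβ | hβ | hβ
    · have hs := Real.sin_pos_of_pos_of_lt_pi h0 hβ
      have a1 : 0 ≤ (1 - w⁻¹).arg := Complex.arg_nonneg_iff.2 (by rw [h1im]; positivity)
      have a2 : (1 - w).arg < 0 := Complex.arg_neg_iff.2 (by rw [h2im]; nlinarith)
      constructor <;> nlinarith
    · constructor <;> nlinarith
    · have hs : Real.sin β < 0 := by
        have := Real.sin_pos_of_pos_of_lt_pi (x := β - Real.pi) (by linarith) (by linarith)
        rw [Real.sin_sub_pi] at this; linarith
      have a1 : (1 - w⁻¹).arg < 0 := Complex.arg_neg_iff.2 (by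
        rw [h1im]; exact mul_neg_of_pos_of_neg (by positivity) hs)
      have a2 : 0 ≤ (1 - w).arg := Complex.arg_nonneg_iff.2 (by rw [h2im]; nlinarith)
      constructor <;> nlinarith
  have hn1 : n < 1 := by exact_mod_cast hn0.1
  have hn2 : -1 < n := by exact_mod_cast hn0.2
  have hnz : n = 0 := by omega
  rw [hnz]; simp

/-- Compares, at a point z on the outer circle and for p on the inner one, the branch log(1 - p/z),
valid outside the inner circle, with log(1 - z/p), valid off the ray from p outwards. -/
lemma im_log_sub_log {s ρ θ φ : ℝ} (hρ : 0 < ρ) (hs : ρ < s) (h0 : φ < θ)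
    (h1 : θ < φ + 2 * Real.pi) :
    (Complex.log (1 - circleMap 0 ρ φ / circleMap 0 s θ) -
      Complex.log (1 - circleMap 0 s θ / circleMap 0 ρ φ)).im = Real.pi - (θ - φ) := by
  have h2 : circleMap 0 ρ φ / circleMap 0 s θ = (circleMap 0 s θ / circleMap 0 ρ φ)⁻¹ :=
    (inv_div _ _).symm
  rw [h2, circleMap_zero_div]
  exact im_log_one_sub_inv_sub_log ((one_lt_div hρ).2 hs) (by linarith) (by linarith)

lemma hasDerivAt_log_one_sub_div {z p : ℂ} (hz : ‖p‖ < ‖z‖) :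
    HasDerivAt (fun z => Complex.log (1 - p / z)) (1 / (z - p) - 1 / z) z := by
  have hz0 : z ≠ 0 := norm_pos_iff.1 ((norm_nonneg p).trans_lt hz)
  have hzp : z - p ≠ 0 := fun h => hz.ne (by rw [sub_eq_zero.1 h])
  have h1 : HasDerivAt (fun z => 1 - p / z) (-(p * (-(z ^ 2)⁻¹))) z :=
    ((hasDerivAt_inv hz0).const_mul p).const_sub 1
  have hs : 1 - p / z ∈ Complex.slitPlane := by
    left
    have h3 : ‖p / z‖ < 1 := by rw [norm_div]; exact (div_lt_one (norm_pos_iff.2 hz0)).2 hz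
    have := (Complex.re_le_norm (p / z)).trans_lt h3
    rw [Complex.sub_re, Complex.one_re]; linarith
  refine (h1.clog hs).congr_deriv ?_
  field_simp
  ring

lemma hasDerivAt_log_one_sub_div' {z p : ℂ} (hp : p ≠ 0) (hs : 1 - z / p ∈ Complex.slitPlane) :
    HasDerivAt (fun z => Complex.log (1 - z / p)) (-(1 / (p - z))) z := by
  have h1 : HasDerivAt (fun z => 1 - z / p) (-(1 / p)) z :=
    ((hasDerivAt_id z).div_const p).const_sub 1
  refine (h1.clog hs).congr_deriv ?_
  have h4 : (1 - z / p) ≠ 0 := Complex.slitPlane_ne_zero hs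
  field_simp

/-- In a disc two disjoint connected sets, one of them open, cannot separate each other at the
boundary. -/
theorem crosscut {r : ℝ} (hr : 0 < r) {P E : Set ℂ} (hPo : IsOpen P) (hPc : IsPreconnected P)
    (hPr : P ⊆ Metric.ball 0 r) (hE : IsPreconnected E) (hEr : E ⊆ Metric.ball 0 r)
    (hPE : Disjoint P E) {θ₁ θ₂ θ₃ θ₄ : ℝ} (h12 : θ₁ < θ₂) (h23 : θ₂ < θ₃) (h34 : θ₃ < θ₄)
    (h41 : θ₄ < θ₁ + 2 * Real.pi) (h1 : ∀ᶠ ρ in 𝓝[<] r, circleMap 0 ρ θ₁ ∈ P)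
    (h2 : ∀ᶠ ρ in 𝓝[<] r, circleMap 0 ρ θ₂ ∈ E) (h3 : ∀ᶠ ρ in 𝓝[<] r, circleMap 0 ρ θ₃ ∈ P)
    (h4 : ∀ᶠ ρ in 𝓝[<] r, circleMap 0 ρ θ₄ ∈ E) : False := by
  obtain ⟨s₀, hs₀, hall⟩ := mem_nhdsLT_iff_exists_Ioo_subset.1
    ((h1.and h2).and ((h3.and h4).and (Ioo_mem_nhdsLT hr)))
  obtain ⟨ρ, hρ1, hρ2⟩ := exists_between (show s₀ < r from hs₀)
  have hρ0 : 0 < ρ := (hall ⟨hρ1, hρ2⟩).2.2.1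
  set p₁ := circleMap 0 ρ θ₁ with hp₁
  set p₃ := circleMap 0 ρ θ₃ with hp₃
  have hpn : ∀ θ : ℝ, ‖circleMap 0 ρ θ‖ = ρ := fun θ => by
    rw [norm_circleMap_zero, abs_of_pos hρ0]
  have hpz : ∀ θ : ℝ, circleMap 0 ρ θ ≠ 0 := fun θ => by
    rw [← norm_pos_iff, hpn]; exact hρ0
  obtain ⟨K, hKP, hKc, G, hG⟩ := exists_log_quotient hPo hPc
    (hall ⟨hρ1, hρ2⟩).1.1 (hall ⟨hρ1, hρ2⟩).2.1.1
  obtain ⟨r', hr', hKr'⟩ := exists_lt_subset_ball hKc.isClosed (hKP.trans hPr)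
  obtain ⟨s, hs, hsr⟩ := exists_between (max_lt hρ2 hr')
  have hρs : ρ < s := (le_max_left _ _).trans_lt hs
  have hr's : r' < s := (le_max_right _ _).trans_lt hs
  have hs0 : 0 < s := hρ0.trans hρs
  have hsn : ∀ θ : ℝ, ‖circleMap 0 s θ‖ = s := fun θ => by
    rw [norm_circleMap_zero, abs_of_pos hs0]
  have hsK : ∀ θ : ℝ, circleMap 0 s θ ∉ K := fun θ h => by
    have := hKr' h
    rw [mem_ball_zero_iff, hsn] at this
    linarith
  have hsmem := hall ⟨hρ1.trans hρs, hsr⟩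
  -- On the whole circle of radius s, which avoids K, `G` and the outer branches have the same
  -- derivative.
  have hout : G (circleMap 0 s θ₂) - (Complex.log (1 - p₃ / circleMap 0 s θ₂) -
      Complex.log (1 - p₁ / circleMap 0 s θ₂)) = G (circleMap 0 s θ₄) -
      (Complex.log (1 - p₃ / circleMap 0 s θ₄) - Complex.log (1 - p₁ / circleMap 0 s θ₄)) := by
    have hd : ∀ θ : ℝ, HasDerivAt (fun θ => G (circleMap 0 s θ) -
        (Complex.log (1 - p₃ / circleMap 0 s θ) - Complex.log (1 - p₁ / circleMap 0 s θ))) 0 θ := by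
      intro θ
      have hlt : ∀ φ, ‖circleMap 0 ρ φ‖ < ‖circleMap 0 s θ‖ := fun φ => by rw [hpn, hsn]; exact hρs
      have e1 := (hG _ (hsK θ)).sub
        ((hasDerivAt_log_one_sub_div (hlt θ₃)).sub (hasDerivAt_log_one_sub_div (hlt θ₁)))
      refine (e1.comp θ (hasDerivAt_circleMap 0 s θ)).congr_deriv ?_
      have e3 : ∀ φ, circleMap 0 ρ φ - circleMap 0 s θ = -(circleMap 0 s θ - circleMap 0 ρ φ) :=
        fun φ => (neg_sub _ _).symm
      rw [e3, e3, div_neg, div_neg]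
      ring
    exact is_const_of_deriv_eq_zero (fun θ => (hd θ).differentiableAt) (fun θ => (hd θ).deriv) θ₂ θ₄
  -- The set E avoids K ⊆ P and the two radial segments ending P at angles θ₁ and θ₃. On the
  -- component of `O` containing E, `G` differs from the inner branches by a constant.
  let O : Set ℂ := Kᶜ ∩ ((fun z => 1 - z / p₁) ⁻¹' Complex.slitPlane ∩
    (fun z => 1 - z / p₃) ⁻¹' Complex.slitPlane)
  have hOo : IsOpen O := hKc.isClosed.isOpen_compl.inter
    ((Complex.isOpen_slitPlane.preimage (by fun_prop)).inter
      (Complex.isOpen_slitPlane.preimage (by fun_prop)))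
  have hslit : ∀ φ : ℝ, (∀ t, ρ ≤ t → t < r → circleMap 0 t φ ∈ P) → ∀ z ∈ E,
      1 - z / circleMap 0 ρ φ ∈ Complex.slitPlane := by
    intro φ hφ z hz
    rw [Complex.mem_slitPlane_iff_not_le_zero]
    intro hle
    rw [Complex.le_def] at hle
    set w := z / circleMap 0 ρ φ with hw
    have hwim : w.im = 0 := by simpa using hle.2
    have hwre : 1 ≤ w.re := by simpa using hle.1
    have hwe : w = (w.re : ℂ) := Complex.ext rfl (by simpa using hwim)
    have hze : z = circleMap 0 (w.re * ρ) φ := by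
      rw [circleMap_zero, Complex.ofReal_mul, mul_assoc, ← circleMap_zero, ← hwe, hw,
        div_mul_cancel₀ _ (hpz φ)]
    have hzn : ‖z‖ = w.re * ρ := by
      rw [hze, norm_circleMap_zero, abs_of_nonneg (by positivity)]
    refine disjoint_left.1 hPE (hze ▸ hφ (w.re * ρ) (by nlinarith) ?_) hz
    rw [← hzn]
    simpa using hEr hz
  have hEO : E ⊆ O := fun z hz => ⟨fun h => disjoint_left.1 hPE (hKP h) hz,
    hslit θ₁ (fun t ht ht' => (hall ⟨hρ1.trans_le ht, ht'⟩).1.1) z hz,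
    hslit θ₃ (fun t ht ht' => (hall ⟨hρ1.trans_le ht, ht'⟩).2.1.1) z hz⟩
  have hin : G (circleMap 0 s θ₂) - (Complex.log (1 - circleMap 0 s θ₂ / p₃) -
      Complex.log (1 - circleMap 0 s θ₂ / p₁)) = G (circleMap 0 s θ₄) -
      (Complex.log (1 - circleMap 0 s θ₄ / p₃) - Complex.log (1 - circleMap 0 s θ₄ / p₁)) := by
    have hd : ∀ z ∈ O, HasDerivAt (fun z => G z - (Complex.log (1 - z / p₃) -
        Complex.log (1 - z / p₁))) 0 z := by
      intro z hz
      refine ((hG z hz.1).sub ((hasDerivAt_log_one_sub_div' (hpz θ₃) hz.2.2).sub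
        (hasDerivAt_log_one_sub_div' (hpz θ₁) hz.2.1))).congr_deriv ?_
      ring
    have hsub := connectedComponentIn_subset O (circleMap 0 s θ₂)
    have hE2 := hE.subset_connectedComponentIn hsmem.1.2 hEO
    exact hOo.connectedComponentIn.is_const_of_deriv_eq_zero isPreconnected_connectedComponentIn
      (fun z hz => (hd z (hsub hz)).differentiableAt.differentiableWithinAt)
      (fun z hz => (hd z (hsub hz)).deriv) (hE2 hsmem.1.2) (hE2 hsmem.2.1.2)
  -- By `hout` and `hin` the outer and inner branches differ by the same amount at θ₂ and θ₄. But θ₂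
  -- precedes θ₃ and θ₄ follows it, so for θ₂ the argument of p₃ is θ₃ - 2π, and the two amounts
  -- differ by 2π.
  have hp₃' : p₃ = circleMap 0 ρ (θ₃ - 2 * Real.pi) := ((periodic_circleMap 0 ρ).sub_eq θ₃).symm
  have a1 := im_log_sub_log hρ0 hρs (φ := θ₁) (θ := θ₂) h12 (by linarith)
  have a2 := im_log_sub_log hρ0 hρs (φ := θ₃ - 2 * Real.pi) (θ := θ₂) (by linarith) (by linarith)
  have a3 := im_log_sub_log hρ0 hρs (φ := θ₁) (θ := θ₄) (by linarith) (by linarith)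
  have a4 := im_log_sub_log hρ0 hρs (φ := θ₃) (θ := θ₄) (by linarith) (by linarith)
  rw [← hp₃'] at a2
  rw [← hp₁] at a1 a3
  rw [← hp₃] at a4
  have b := congrArg Complex.im hout
  have c := congrArg Complex.im hin
  simp only [Complex.sub_im] at a1 a2 a3 a4 b c
  have := Real.pi_pos
  linarith

/-! ### Sign changes of the radial limits -/

namespace IsNonconstHolo

variable {r : ℝ} {f : ℂ → ℂ}

lemma neg (hf : IsNonconstHolo r f) : IsNonconstHolo r fun z => -f z :=
  ⟨fun z hz => (hf.analytic z hz).fun_neg, fun p hp h => hf.nonconst p hp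
    (h.mono fun _ hz => neg_injective hz)⟩

lemma reZeros_neg (r : ℝ) (f : ℂ → ℂ) : reZeros r (fun z => -f z) = reZeros r f := by
  ext z
  simp only [mem_reZeros_iff, Complex.neg_re, neg_eq_zero]

/-- Radial segments on which `Re f` is positive end in a component with `0` on its boundary. -/
lemma exists_component (hf : IsNonconstHolo r f) (ht : CurvesThroughZero r f) (h0 : (f 0).re = 0)
    (hr : 0 < r) {θ : ℝ} (hθ : ∀ᶠ ρ in 𝓝[<] r, 0 < (f (circleMap 0 ρ θ)).re) :
    ∃ q ∈ {z | z ∈ Metric.ball (0 : ℂ) r ∧ 0 < (f z).re},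
      (0 : ℂ) ∈ closure (connectedComponentIn {z | z ∈ Metric.ball (0 : ℂ) r ∧ 0 < (f z).re} q) ∧
      ∀ᶠ ρ in 𝓝[<] r, circleMap 0 ρ θ ∈
        connectedComponentIn {z | z ∈ Metric.ball (0 : ℂ) r ∧ 0 < (f z).re} q := by
  obtain ⟨s₀, hs₀, hall⟩ := mem_nhdsLT_iff_exists_Ioo_subset.1 (hθ.and (Ioo_mem_nhdsLT hr))
  have hsub : (fun ρ => circleMap 0 ρ θ) '' Ioo s₀ r ⊆
      {z | z ∈ Metric.ball (0 : ℂ) r ∧ 0 < (f z).re} := by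
    rintro _ ⟨ρ, hρ, rfl⟩
    refine ⟨?_, (hall hρ).1⟩
    rw [mem_ball_zero_iff, norm_circleMap_zero, abs_of_pos (hall hρ).2.1]
    exact hρ.2
  have hpre : IsPreconnected ((fun ρ => circleMap 0 ρ θ) '' Ioo s₀ r) := by
    refine isPreconnected_Ioo.image _ (Continuous.continuousOn ?_)
    unfold circleMap
    fun_prop
  obtain ⟨ρ, hρ1, hρ2⟩ := exists_between (show s₀ < r from hs₀)
  have hq : circleMap 0 ρ θ ∈ (fun ρ => circleMap 0 ρ θ) '' Ioo s₀ r := ⟨ρ, ⟨hρ1, hρ2⟩, rfl⟩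
  refine ⟨_, hsub hq, hf.zero_mem_closure ht h0 (hsub hq).1 (hsub hq).2, ?_⟩
  filter_upwards [Ioo_mem_nhdsLT (show s₀ < r from hs₀)] with x hx
  exact hpre.subset_connectedComponentIn hq hsub ⟨x, hx, rfl⟩

/-- In the chart Re f is |w|^m cos(m arg w), so near 0 the positive set consists of m connected
sectors. A component with 0 in its closure meets one of them, hence contains its midpoint; this
labels such components by m sectors. -/
lemma exists_sector {m : ℕ} {ε : ℝ} {ψ φ : ℂ → ℂ}
    (h : IsPowerChart f (Metric.ball 0 r) 0 m ε ψ φ) (h0 : (f 0).re = 0) {q : ℂ}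
    (hq : (0 : ℂ) ∈
      closure (connectedComponentIn {z | z ∈ Metric.ball (0 : ℂ) r ∧ 0 < (f z).re} q)) :
    ∃ k : Fin m, ψ (circleMap 0 (ε / 2) (2 * Real.pi * k / m)) ∈
      connectedComponentIn {z | z ∈ Metric.ball (0 : ℂ) r ∧ 0 < (f z).re} q := by
  set S := {z | z ∈ Metric.ball (0 : ℂ) r ∧ 0 < (f z).re}
  obtain ⟨z, hz1, hz2⟩ := mem_closure_iff_nhds.1 hq _ h.right_inv
  have hzS : 0 < (f z).re := (connectedComponentIn_subset S q hz2).2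
  set w := φ z with hw
  have hre : ∀ ρ α : ℝ, circleMap 0 ρ α ∈ Metric.ball (0 : ℂ) ε →
      (f (ψ (circleMap 0 ρ α))).re = ρ ^ m * Real.cos (m * α) := by
    intro ρ α hα
    rw [h.eq_pow _ hα, Complex.add_re, h0, zero_add, circleMap_zero, mul_pow, ← Complex.ofReal_pow,
      Complex.re_ofReal_mul, re_exp_ofReal_mul_I_pow]
  have hwe : circleMap 0 ‖w‖ w.arg = w := by
    rw [circleMap_zero, Complex.norm_mul_exp_arg_mul_I]
  have hm := h.one_le
  have hm0 : (0 : ℝ) < m := by positivity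
  have hwn : ‖w‖ < ε := by simpa using hz1.1
  have hcos : 0 < ‖w‖ ^ m * Real.cos (m * w.arg) := by
    rw [← hre ‖w‖ w.arg (by rw [hwe]; exact hz1.1), hwe, hz1.2]
    exact hzS
  have hcos' : 0 < Real.cos (m * w.arg) := pos_of_mul_pos_right hcos (by positivity)
  have hw0 : 0 < ‖w‖ := by
    rcases (norm_nonneg w).eq_or_lt with h1 | h1
    · rw [← h1, zero_pow (by omega), zero_mul] at hcos; exact absurd hcos (lt_irrefl _)
    · exact h1
  have hpi := Real.pi_pos
  -- The index of the sector axis nearest to w, taken modulo m afterwards.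
  set j := round (m * w.arg / (2 * Real.pi)) with hj
  set d := m * w.arg - j * (2 * Real.pi) with hd
  have hdabs : |d| ≤ Real.pi := by
    have h1 := abs_sub_round (m * w.arg / (2 * Real.pi))
    have h2 : d = (m * w.arg / (2 * Real.pi) - j) * (2 * Real.pi) := by
      rw [hd]; field_simp
    rw [h2, abs_mul, abs_of_pos (by positivity : 0 < 2 * Real.pi)]
    nlinarith
  have hdcos : 0 < Real.cos d := by rw [hd, Real.cos_sub_int_mul_two_pi]; exact hcos'
  have hd2 : |d| < Real.pi / 2 := by
    by_contra! hle
    rw [← Real.cos_abs] at hdcos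
    exact absurd (Real.cos_nonpos_of_pi_div_two_le_of_le hle (by linarith)) (not_le.2 hdcos)
  have hmz : (0 : ℤ) < m := by exact_mod_cast hm
  obtain ⟨k, hk⟩ := Int.eq_ofNat_of_zero_le (Int.emod_nonneg j hmz.ne')
  have hkm : k < m := by have := Int.emod_lt_of_pos j hmz; omega
  have hj2 : (j : ℝ) = m * (j / (m : ℤ) : ℤ) + k := by
    have := Int.mul_ediv_add_emod j m
    rw [hk] at this
    exact_mod_cast this.symm
  set a := j / (m : ℤ)
  refine ⟨⟨k, hkm⟩, ?_⟩
  let B : Set (ℝ × ℝ) := Ioo 0 ε ×ˢ Ioo (2 * Real.pi * k / m - Real.pi / (2 * m))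
    (2 * Real.pi * k / m + Real.pi / (2 * m))
  have hBc : IsPreconnected ((fun x : ℝ × ℝ => ψ (circleMap 0 x.1 x.2)) '' B) := by
    refine (isPreconnected_Ioo.prod isPreconnected_Ioo).image _ ?_
    refine h.analytic.continuousOn.comp (Continuous.continuousOn ?_) ?_
    · unfold circleMap; fun_prop
    · rintro ⟨x, y⟩ ⟨hx, -⟩
      rw [mem_ball_zero_iff, norm_circleMap_zero, abs_of_pos hx.1]
      exact hx.2
  have hBS : (fun x : ℝ × ℝ => ψ (circleMap 0 x.1 x.2)) '' B ⊆ S := by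
    rintro _ ⟨⟨x, y⟩, ⟨hx, hy⟩, rfl⟩
    have hx : x ∈ Ioo 0 ε := hx
    have hy : y ∈ Ioo _ _ := hy
    have hmem : circleMap 0 x y ∈ Metric.ball (0 : ℂ) ε := by
      rw [mem_ball_zero_iff, norm_circleMap_zero, abs_of_pos hx.1]
      exact hx.2
    refine ⟨h.maps _ hmem, ?_⟩
    change 0 < (f (ψ (circleMap 0 x y))).re
    rw [hre _ _ hmem]
    refine mul_pos (pow_pos hx.1 _) ?_
    rw [← Real.cos_sub_nat_mul_two_pi _ k]
    have e1 : 2 * Real.pi * k / m - Real.pi / (2 * m) = (k * (2 * Real.pi) - Real.pi / 2) / m := by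
      field_simp
    have e2 : 2 * Real.pi * k / m + Real.pi / (2 * m) = (k * (2 * Real.pi) + Real.pi / 2) / m := by
      field_simp
    rw [e1, e2] at hy
    have h1 := (div_lt_iff₀ hm0).1 hy.1
    have h2 := (lt_div_iff₀ hm0).1 hy.2
    exact Real.cos_pos_of_mem_Ioo ⟨by linarith, by linarith⟩
  have hzB : z ∈ (fun x : ℝ × ℝ => ψ (circleMap 0 x.1 x.2)) '' B := by
    refine ⟨(‖w‖, w.arg - a * (2 * Real.pi)), ⟨⟨hw0, hwn⟩, ?_⟩, ?_⟩
    · have h1 : w.arg - a * (2 * Real.pi) = (d + k * (2 * Real.pi)) / m := by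
        rw [hd, hj2]; field_simp; ring
      have e1 : 2 * Real.pi * k / m - Real.pi / (2 * m) = (k * (2 * Real.pi) - Real.pi / 2) / m := by
        field_simp
      have e2 : 2 * Real.pi * k / m + Real.pi / (2 * m) = (k * (2 * Real.pi) + Real.pi / 2) / m := by
        field_simp
      have h2 := abs_lt.1 hd2
      change w.arg - a * (2 * Real.pi) ∈ Ioo _ _
      rw [h1, e1, e2]
      exact ⟨(div_lt_div_iff_of_pos_right hm0).2 (by linarith),
        (div_lt_div_iff_of_pos_right hm0).2 (by linarith)⟩
    · change ψ (circleMap 0 ‖w‖ (w.arg - a * (2 * Real.pi))) = z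
      rw [(periodic_circleMap 0 ‖w‖).sub_int_mul_eq, hwe, hz1.2]
  have hcB : ψ (circleMap 0 (ε / 2) (2 * Real.pi * k / m)) ∈
      (fun x : ℝ × ℝ => ψ (circleMap 0 x.1 x.2)) '' B := by
    have hε := h.pos
    have : 0 < Real.pi / (2 * m) := by positivity
    exact ⟨(ε / 2, 2 * Real.pi * k / m), ⟨⟨by positivity, by linarith⟩,
      ⟨by linarith, by linarith⟩⟩, rfl⟩
  rw [connectedComponentIn_eq hz2]
  exact hBc.subset_connectedComponentIn hzB hBS hcB

/-- The sign of the radial limits changes at most `2 m` times. -/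
theorem no_alternating (hf : IsNonconstHolo r f) (ht : CurvesThroughZero r f) (hr : 0 < r)
    {m : ℕ} {ε : ℝ} {ψ φ : ℂ → ℂ} (h : IsPowerChart f (Metric.ball 0 r) 0 m ε ψ φ)
    (h0 : (f 0).re = 0) {e : ℝ} (he : e = 1 ∨ e = -1) (θ : ℕ → ℝ)
    (hmono : ∀ i j, i < j → j ≤ 2 * m + 1 → θ i < θ j)
    (h2π : θ (2 * m + 1) < θ 0 + 2 * Real.pi)
    (hs : ∀ i ≤ 2 * m + 1, ∀ᶠ ρ in 𝓝[<] r, 0 < e * (-1) ^ i * (f (circleMap 0 ρ (θ i))).re) :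
    False := by
  -- The parity of the indices with positive sign: these are 2j + c for j = 0, …, m, which are m + 1
  -- in number.
  obtain ⟨c, hc, hec⟩ : ∃ c ≤ 1, e * (-1) ^ c = 1 := by
    rcases he with rfl | rfl
    · exact ⟨0, by omega, by norm_num⟩
    · exact ⟨1, by omega, by norm_num⟩
  have hpos : ∀ j ≤ m, ∀ᶠ ρ in 𝓝[<] r, 0 < (f (circleMap 0 ρ (θ (2 * j + c)))).re := by
    intro j hj
    filter_upwards [hs (2 * j + c) (by omega)] with ρ hρ
    rw [pow_add, pow_mul, neg_one_sq, one_pow, one_mul, hec, one_mul] at hρ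
    exact hρ
  have hneg : ∀ i ≤ 2 * m + 1, (∃ j, i = 2 * j + c + 1 ∨ i + 1 = 2 * j + c) →
      ∀ᶠ ρ in 𝓝[<] r, 0 < (-f (circleMap 0 ρ (θ i))).re := by
    rintro i hi ⟨j, hj⟩
    have hec' : e * (-1) ^ i = -1 := by
      have h3 : e * (-1) ^ (i + 1) = 1 := by
        rcases hj with rfl | hj
        · rw [show 2 * j + c + 1 + 1 = 2 * (j + 1) + c by ring, pow_add, pow_mul, neg_one_sq,
            one_pow, one_mul, hec]
        · rw [hj, pow_add, pow_mul, neg_one_sq, one_pow, one_mul, hec]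
      rw [pow_succ] at h3
      linarith
    filter_upwards [hs i hi] with ρ hρ
    rw [hec'] at hρ
    rw [Complex.neg_re]
    linarith
  set S := {z | z ∈ Metric.ball (0 : ℂ) r ∧ 0 < (f z).re} with hS
  have hcont : ContinuousOn (fun z => (f z).re) (Metric.ball 0 r) :=
    Complex.continuous_re.comp_continuousOn hf.analytic.continuousOn
  have hSo : IsOpen S := hcont.isOpen_inter_preimage Metric.isOpen_ball isOpen_Ioi
  have hcomp : ∀ j : Fin (m + 1), ∃ q, (∃ k : Fin m,
      ψ (circleMap 0 (ε / 2) (2 * Real.pi * k / m)) ∈ connectedComponentIn S q) ∧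
      ∀ᶠ ρ in 𝓝[<] r, circleMap 0 ρ (θ (2 * j + c)) ∈ connectedComponentIn S q := by
    intro j
    obtain ⟨q, -, hq, hq2⟩ := hf.exists_component ht h0 hr (hpos j (by omega))
    exact ⟨q, exists_sector h h0 hq, hq2⟩
  choose q hk' hq using hcomp
  choose k hk using hk'
  -- Pigeonhole: m + 1 positive radii and m sectors, so two of the radii end in the same component.
  obtain ⟨j₁, j₂, hne, hkk⟩ := Fintype.exists_ne_map_eq_of_card_lt k (by simp)
  wlog hlt : j₁ < j₂ generalizing j₁ j₂
  · exact this j₂ j₁ hne.symm hkk.symm (lt_of_le_of_ne (not_lt.1 hlt) hne.symm)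
  have hP : connectedComponentIn S (q j₁) = connectedComponentIn S (q j₂) := by
    rw [connectedComponentIn_eq (hk j₁), connectedComponentIn_eq (hk j₂), hkk]
  have hlt' : (j₁ : ℕ) < j₂ := hlt
  -- The next negative angle after the second positive one. If there is none in the list, then c =
  -- 1, and θ 0 after a full turn is taken.
  obtain ⟨θ₄, h34, h41, h4⟩ : ∃ θ₄, θ (2 * j₂ + c) < θ₄ ∧ θ₄ < θ (2 * j₁ + c) + 2 * Real.pi ∧
      ∀ᶠ ρ in 𝓝[<] r, 0 < (-f (circleMap 0 ρ θ₄)).re := by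
    have h01 : θ 0 ≤ θ (2 * j₁ + c) := by
      rcases Nat.eq_zero_or_pos (2 * j₁ + c) with h1 | h1
      · rw [h1]
      · exact (hmono 0 _ h1 (by omega)).le
    by_cases hle : 2 * (j₂ : ℕ) + c + 1 ≤ 2 * m + 1
    · refine ⟨θ (2 * j₂ + c + 1), hmono _ _ (by omega) hle, ?_, hneg _ hle ⟨j₂, Or.inl rfl⟩⟩
      have : θ (2 * j₂ + c + 1) ≤ θ (2 * m + 1) := by
        rcases hle.eq_or_lt with h1 | h1
        · rw [h1]
        · exact (hmono _ _ h1 le_rfl).le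
      linarith
    · have hc1 : c = 1 := by omega
      have hjm : 2 * (j₂ : ℕ) + c = 2 * m + 1 := by omega
      refine ⟨θ 0 + 2 * Real.pi, by rw [hjm]; exact h2π, ?_, ?_⟩
      · have := hmono 0 (2 * j₁ + c) (by omega) (by omega)
        linarith
      · filter_upwards [hneg 0 (by omega) ⟨0, Or.inr (by omega)⟩] with ρ hρ
        rw [periodic_circleMap 0 ρ]
        exact hρ
  have h2 := hneg (2 * j₁ + c + 1) (by omega) ⟨j₁, Or.inl rfl⟩
  have ht' : CurvesThroughZero r fun z => -f z := by
    unfold CurvesThroughZero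
    rw [reZeros_neg]
    exact ht
  have h0' : (-f 0).re = 0 := by rw [Complex.neg_re, h0, neg_zero]
  obtain ⟨p₂, -, hp₂, hN₂⟩ := hf.neg.exists_component ht' h0' hr h2
  obtain ⟨p₄, -, hp₄, hN₄⟩ := hf.neg.exists_component ht' h0' hr h4
  set S' := {z | z ∈ Metric.ball (0 : ℂ) r ∧ 0 < (-f z).re} with hS'
  set N₂ := connectedComponentIn S' p₂
  set N₄ := connectedComponentIn S' p₄
  have hpre : ∀ N : Set ℂ, IsPreconnected N → (0 : ℂ) ∈ closure N → IsPreconnected (insert 0 N) :=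
    fun N hN hN0 => hN.subset_closure (subset_insert _ _) (insert_subset hN0 subset_closure)
  -- The two negative components are joined through 0, which lies in both closures and not in the
  -- positive component.
  have hE : IsPreconnected (insert 0 N₂ ∪ insert 0 N₄) :=
    (hpre _ isPreconnected_connectedComponentIn hp₂).union 0 (mem_insert _ _) (mem_insert _ _)
      (hpre _ isPreconnected_connectedComponentIn hp₄)
  have hN₂S : N₂ ⊆ S' := connectedComponentIn_subset _ _
  have hN₄S : N₄ ⊆ S' := connectedComponentIn_subset _ _
  have hES : insert 0 N₂ ∪ insert 0 N₄ ⊆ {z | z ∈ Metric.ball (0 : ℂ) r ∧ (f z).re ≤ 0} := by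
    have hz0 : (0 : ℂ) ∈ {z | z ∈ Metric.ball (0 : ℂ) r ∧ (f z).re ≤ 0} :=
      ⟨Metric.mem_ball_self hr, h0.le⟩
    have hS'' : S' ⊆ {z | z ∈ Metric.ball (0 : ℂ) r ∧ (f z).re ≤ 0} := fun z hz =>
      ⟨hz.1, by have := hz.2; rw [Complex.neg_re] at this; linarith⟩
    exact union_subset (insert_subset hz0 (hN₂S.trans hS'')) (insert_subset hz0 (hN₄S.trans hS''))
  have hPS : connectedComponentIn S (q j₁) ⊆ S := connectedComponentIn_subset _ _
  refine crosscut hr hSo.connectedComponentIn isPreconnected_connectedComponentIn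
    (fun z hz => (hPS hz).1) hE (fun z hz => (hES hz).1)
    (disjoint_left.2 fun z hz1 hz2 => absurd (hPS hz1).2 (not_lt.2 (hES hz2).2))
    (hmono _ _ (Nat.lt_succ_self _) (by omega)) (hmono (2 * j₁ + c + 1) (2 * j₂ + c) (by omega)
      (by omega)) h34 h41 (hq j₁) (hN₂.mono fun ρ hρ => Or.inl (Or.inr hρ)) (hP ▸ hq j₂)
    (hN₄.mono fun ρ hρ => Or.inr (Or.inr hρ))

end IsNonconstHolo

/-! ### Poisson integrals and Fatou's theorem -/

section Fatou

open MeasureTheory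

/-- The Poisson kernel of the disc of radius `R` in polar coordinates. -/
noncomputable def polarPoisson (ρ R x : ℝ) : ℝ :=
  (R ^ 2 - ρ ^ 2) / ((R - ρ) ^ 2 + 4 * R * ρ * Real.sin (x / 2) ^ 2)

lemma continuous_polarPoisson {ρ R : ℝ} (hρ : 0 ≤ ρ) (hR : ρ < R) :
    Continuous (polarPoisson ρ R) := by
  have hR0 : 0 < R := hρ.trans_lt hR
  refine continuous_const.div (by fun_prop) fun x => ?_
  have : 0 < R - ρ := sub_pos.2 hR
  positivity

lemma polarPoisson_nonneg {ρ R : ℝ} (hρ : 0 ≤ ρ) (hR : ρ < R) (x : ℝ) :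
    0 ≤ polarPoisson ρ R x := by
  have hR0 : 0 < R := hρ.trans_lt hR
  refine div_nonneg ?_ (by positivity)
  nlinarith

/-- Away from the centre the kernel is of the order of R - ρ; this serves for distant angles and,
with s proportional to x^2, for the dyadic shells. -/
lemma polarPoisson_le {ρ R s x : ℝ} (hρ : R / 2 ≤ ρ) (hR : ρ < R) (hs : 0 < s)
    (hx : s ≤ Real.sin (x / 2) ^ 2) : polarPoisson ρ R x ≤ (R - ρ) / (R * s) := by
  have hR0 : 0 < R := by linarith
  have hd : 0 < R - ρ := sub_pos.2 hR
  have h1 : 2 * R ^ 2 * s ≤ (R - ρ) ^ 2 + 4 * R * ρ * Real.sin (x / 2) ^ 2 := by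
    have h2 : 2 * R ^ 2 * s ≤ 4 * R * ρ * s := by
      have : 2 * R ^ 2 ≤ 4 * R * ρ := by nlinarith
      exact mul_le_mul_of_nonneg_right this hs.le
    have h3 : 4 * R * ρ * s ≤ 4 * R * ρ * Real.sin (x / 2) ^ 2 :=
      mul_le_mul_of_nonneg_left hx (by nlinarith)
    nlinarith [sq_nonneg (R - ρ)]
  have h4 : (R - ρ) / (R * s) = (2 * R * (R - ρ)) / (2 * R ^ 2 * s) := by field_simp
  rw [h4, polarPoisson]
  exact div_le_div₀ (by positivity) (by nlinarith) (by positivity) h1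

lemma polarPoisson_le_center {ρ R x : ℝ} (hρ : R / 2 ≤ ρ) (hR : ρ < R) :
    polarPoisson ρ R x ≤ 2 * R / (R - ρ) := by
  have hR0 : 0 < R := by linarith
  have hd : 0 < R - ρ := sub_pos.2 hR
  have h4 : 2 * R / (R - ρ) = (2 * R * (R - ρ)) / (R - ρ) ^ 2 := by field_simp
  rw [h4, polarPoisson]
  refine div_le_div₀ (by positivity) (by nlinarith) (by positivity) ?_
  have : 0 ≤ 4 * R * ρ * Real.sin (x / 2) ^ 2 := by
    have : 0 ≤ ρ := by linarith
    positivity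
  linarith

lemma sq_le_sin_half_sq {x : ℝ} (hx : |x| ≤ Real.pi) : (x / Real.pi) ^ 2 ≤ Real.sin (x / 2) ^ 2 := by
  have hpi := Real.pi_pos
  have h1 : |x| / Real.pi ≤ Real.sin (|x| / 2) := by
    have := Real.mul_le_sin (x := |x| / 2) (by positivity) (by linarith)
    calc |x| / Real.pi = 2 / Real.pi * (|x| / 2) := by field_simp
      _ ≤ _ := this
  have h2 : Real.sin (|x| / 2) ^ 2 = Real.sin (x / 2) ^ 2 := by
    rcases abs_choice x with h | h <;> rw [h]
    rw [neg_div, Real.sin_neg, neg_sq]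
  rw [← h2, ← sq_abs, abs_div, abs_of_pos hpi]
  exact pow_le_pow_left₀ (by positivity) h1 2

lemma norm_circleMap_sub_sq (R ρ t θ : ℝ) : ‖circleMap 0 R t - circleMap 0 ρ θ‖ ^ 2 =
    (R - ρ) ^ 2 + 4 * R * ρ * Real.sin ((θ - t) / 2) ^ 2 := by
  rw [← Complex.normSq_eq_norm_sq, Complex.normSq_apply, Complex.sub_re, Complex.sub_im,
    circleMap_zero_re, circleMap_zero_im, circleMap_zero_re, circleMap_zero_im]
  have h1 : Real.sin ((θ - t) / 2) ^ 2 = (1 - Real.cos (θ - t)) / 2 := by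
    have := Real.cos_sq ((θ - t) / 2)
    rw [mul_div_cancel₀ _ two_ne_zero] at this
    rw [Real.sin_sq, this]; ring
  rw [h1, Real.cos_sub]
  linear_combination R ^ 2 * Real.sin_sq_add_cos_sq t + ρ ^ 2 * Real.sin_sq_add_cos_sq θ

lemma integral_polarPoisson_mul {u : ℂ → ℝ} {ρ R : ℝ} (hρ : 0 ≤ ρ) (hR : ρ < R)
    (hu : InnerProductSpace.HarmonicOnNhd u (Metric.closedBall 0 R)) (θ : ℝ) :
    ∫ t in (0 : ℝ)..(2 * Real.pi), polarPoisson ρ R (θ - t) * u (circleMap 0 R t) =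
      2 * Real.pi * u (circleMap 0 ρ θ) := by
  have hw : circleMap 0 ρ θ ∈ Metric.ball (0 : ℂ) R := by
    rw [mem_ball_zero_iff, norm_circleMap_zero, abs_of_nonneg hρ]; exact hR
  have h := hu.circleAverage_poissonKernel_smul hw
  have hpi : 2 * Real.pi ≠ 0 := by positivity
  rw [Real.circleAverage_def, smul_eq_mul, inv_mul_eq_iff_eq_mul₀ hpi] at h
  rw [← h]
  refine intervalIntegral.integral_congr fun t _ => ?_
  simp only [Pi.smul_apply', smul_eq_mul, poissonKernel_def, sub_zero, norm_circleMap_sub_sq,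
    norm_circleMap_zero, sq_abs]
  rfl

/-- Split k v = k g + k (v - g): dominated convergence for the first term, boundedness of k and L¹
convergence for the second. -/
lemma tendsto_integral_mul_of_L1 {r M : ℝ} {v : ℝ → ℝ → ℝ} {g : ℝ → ℝ} {k : ℝ → ℝ → ℝ}
    {k₀ : ℝ → ℝ} (hg : IntervalIntegrable g volume 0 (2 * Real.pi))
    (hv : ∀ᶠ ρ in 𝓝[<] r, Continuous (v ρ))
    (hlim : Tendsto (fun ρ => ∫ θ in (0 : ℝ)..(2 * Real.pi), |v ρ θ - g θ|) (𝓝[<] r) (𝓝 0))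
    (hk : ∀ᶠ ρ in 𝓝[<] r, Continuous (k ρ)) (hM : ∀ᶠ ρ in 𝓝[<] r, ∀ θ, |k ρ θ| ≤ M)
    (hk₀ : ∀ θ, Tendsto (fun ρ => k ρ θ) (𝓝[<] r) (𝓝 (k₀ θ))) :
    Tendsto (fun ρ => ∫ θ in (0 : ℝ)..(2 * Real.pi), k ρ θ * v ρ θ) (𝓝[<] r)
      (𝓝 (∫ θ in (0 : ℝ)..(2 * Real.pi), k₀ θ * g θ)) := by
  have hpi : 0 ≤ 2 * Real.pi := by positivity
  have h1 : Tendsto (fun ρ => ∫ θ in (0 : ℝ)..(2 * Real.pi), k ρ θ * g θ) (𝓝[<] r)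
      (𝓝 (∫ θ in (0 : ℝ)..(2 * Real.pi), k₀ θ * g θ)) := by
    refine intervalIntegral.tendsto_integral_filter_of_dominated_convergence
      (fun θ => M * |g θ|) ?_ ?_ (hg.abs.const_mul M) ?_
    · filter_upwards [hk] with ρ hρ
      exact hρ.aestronglyMeasurable.mul (intervalIntegrable_iff.1 hg).aestronglyMeasurable
    · filter_upwards [hM] with ρ hρ
      refine Eventually.of_forall fun θ _ => ?_
      rw [Real.norm_eq_abs, abs_mul]
      exact mul_le_mul_of_nonneg_right (hρ θ) (abs_nonneg _)
    · exact Eventually.of_forall fun θ _ => (hk₀ θ).mul_const _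
  have h2 : Tendsto (fun ρ => ∫ θ in (0 : ℝ)..(2 * Real.pi), k ρ θ * (v ρ θ - g θ)) (𝓝[<] r)
      (𝓝 0) := by
    have h3 := hlim.const_mul M
    rw [mul_zero] at h3
    refine squeeze_zero_norm' ?_ h3
    filter_upwards [hk, hM, hv] with ρ hρ hρM hvρ
    rw [← intervalIntegral.integral_const_mul]
    have hint := (hvρ.intervalIntegrable 0 (2 * Real.pi)).sub hg
    refine intervalIntegral.norm_integral_le_of_norm_le hpi
      (Eventually.of_forall fun θ _ => ?_) (hint.abs.const_mul M)
    rw [Real.norm_eq_abs, abs_mul]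
    exact mul_le_mul_of_nonneg_right (hρM θ) (abs_nonneg _)
  have h3 := h1.add h2
  rw [add_zero] at h3
  refine h3.congr' ?_
  filter_upwards [hk, hv] with ρ hρ hvρ
  have hint := (hvρ.intervalIntegrable 0 (2 * Real.pi)).sub hg
  rw [← intervalIntegral.integral_add (hg.continuousOn_mul hρ.continuousOn)
    (hint.continuousOn_mul hρ.continuousOn)]
  refine intervalIntegral.integral_congr fun θ _ => ?_
  change k ρ θ * g θ + k ρ θ * (v ρ θ - g θ) = k ρ θ * v ρ θ
  ring

lemma continuous_comp_circleMap {r : ℝ} {u : ℂ → ℝ}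
    (hu : InnerProductSpace.HarmonicOnNhd u (Metric.ball 0 r)) {ρ : ℝ} (hρ : 0 ≤ ρ) (hρr : ρ < r) :
    Continuous fun θ => u (circleMap 0 ρ θ) := by
  rw [continuous_iff_continuousAt]
  intro θ
  have hw : circleMap 0 ρ θ ∈ Metric.ball (0 : ℂ) r := by
    rw [mem_ball_zero_iff, norm_circleMap_zero, abs_of_nonneg hρ]; exact hρr
  exact ContinuousAt.comp (hu _ hw).1.continuousAt (continuous_circleMap 0 ρ).continuousAt

/-- Let the radius R of the Poisson formula tend to r with ρ fixed. -/
lemma integral_polarPoisson_mul_boundary {r : ℝ} {u : ℂ → ℝ} {g : ℝ → ℝ}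
    (hu : InnerProductSpace.HarmonicOnNhd u (Metric.ball 0 r))
    (hg : IntervalIntegrable g volume 0 (2 * Real.pi))
    (hlim : Tendsto (fun ρ : ℝ => ∫ θ in (0 : ℝ)..(2 * Real.pi), |u (circleMap 0 ρ θ) - g θ|)
      (𝓝[<] r) (𝓝 0)) {ρ : ℝ} (hρ : 0 ≤ ρ) (hρr : ρ < r) (θ : ℝ) :
    ∫ t in (0 : ℝ)..(2 * Real.pi), polarPoisson ρ r (θ - t) * g t =
      2 * Real.pi * u (circleMap 0 ρ θ) := by
  have hmid : (ρ + r) / 2 < r := by linarith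
  have hev : ∀ᶠ R in 𝓝[<] r, R ∈ Ioo ((ρ + r) / 2) r := Ioo_mem_nhdsLT hmid
  -- For R > (ρ + r)/2 one has R - ρ ≥ (r - ρ)/2, whence this bound of the kernel.
  refine tendsto_nhds_unique (tendsto_integral_mul_of_L1 (M := r ^ 2 / ((r - ρ) / 2) ^ 2)
    (k := fun R t => polarPoisson ρ R (θ - t)) hg ?_ hlim ?_ ?_ ?_) ?_
  · filter_upwards [hev] with R hR
    exact continuous_comp_circleMap hu (by linarith [hR.1]) hR.2
  · filter_upwards [hev] with R hR
    exact (continuous_polarPoisson hρ (by linarith [hR.1])).comp (by fun_prop)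
  · filter_upwards [hev] with R hR t
    have h0 : ρ < R := by linarith [hR.1]
    rw [abs_of_nonneg (polarPoisson_nonneg hρ h0 _), polarPoisson]
    refine div_le_div₀ (by positivity) ?_ (by positivity) ?_
    · nlinarith [hR.2, sq_nonneg ρ]
    · have h1 : ((r - ρ) / 2) ^ 2 ≤ (R - ρ) ^ 2 := by
        refine pow_le_pow_left₀ (by linarith) (by linarith [hR.1]) 2
      have h2 : 0 ≤ 4 * R * ρ * Real.sin ((θ - t) / 2) ^ 2 := by
        have : 0 ≤ R := by linarith
        positivity
      linarith
  · intro t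
    have : ContinuousAt (fun R => polarPoisson ρ R (θ - t)) r := by
      unfold polarPoisson
      refine ContinuousAt.div (by fun_prop) (by fun_prop) ?_
      have : 0 ≤ 4 * r * ρ * Real.sin ((θ - t) / 2) ^ 2 := by
        have : 0 ≤ r := by linarith
        positivity
      positivity
    exact this.tendsto.mono_left nhdsWithin_le_nhds
  · refine tendsto_const_nhds.congr' ?_
    filter_upwards [hev] with R hR
    refine (integral_polarPoisson_mul hρ (by linarith [hR.1]) (fun z hz => hu z ?_) θ).symm
    exact Metric.closedBall_subset_ball hR.2 hz

lemma integral_polarPoisson {r ρ : ℝ} (hρ : 0 ≤ ρ) (hρr : ρ < r) (θ : ℝ) :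
    ∫ t in (0 : ℝ)..(2 * Real.pi), polarPoisson ρ r (θ - t) = 2 * Real.pi := by
  have := integral_polarPoisson_mul (u := fun _ => 1) hρ hρr
    (fun z _ => InnerProductSpace.harmonicAt_const _) θ
  simpa using this

/-- Dyadic estimate of the integral of a kernel against a function with small means. -/
lemma setIntegral_le_dyadic {F φ : ℝ → ℝ} {θ h c η : ℝ} (hh : 0 < h) (hc : 0 ≤ c)
    (hφ : ∀ t, 0 ≤ φ t) (hφi : IntegrableOn φ (Metric.closedBall θ h)) (hF : Continuous F)
    (hmean : ∀ s, 0 < s → s ≤ h → ∫ t in Metric.closedBall θ s, φ t ≤ η * s)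
    (hFc : ∀ t, t ∈ Metric.closedBall θ h → t ≠ θ → F t ≤ c / (t - θ) ^ 2) (N : ℕ) :
    ∫ t in Metric.closedBall θ h, F t * φ t ≤
      (∫ t in Metric.closedBall θ (h / 2 ^ N), F t * φ t) + 4 * c * η * (2 ^ N - 1) / h := by
  have hint : ∀ S ⊆ Metric.closedBall θ h, IntegrableOn (fun t => F t * φ t) S := fun S hS =>
    (hφi.continuousOn_mul hF.continuousOn (isCompact_closedBall θ h)).mono_set hS
  induction N with
  | zero => simp
  | succ N ih =>
    refine ih.trans ?_
    have hle : h / 2 ^ N ≤ h := div_le_self hh.le (one_le_pow₀ one_le_two)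
    have hle2 : h / 2 ^ (N + 1) ≤ h / 2 ^ N := by
      rw [pow_succ, ← div_div]; exact div_le_self (by positivity) one_le_two
    set B := Metric.closedBall θ (h / 2 ^ N) with hB
    set B' := Metric.closedBall θ (h / 2 ^ (N + 1)) with hB'
    have hB'B : B' ⊆ B := Metric.closedBall_subset_closedBall hle2
    have hBh : B ⊆ Metric.closedBall θ h := Metric.closedBall_subset_closedBall hle
    have hsplit : ∫ t in B, F t * φ t = (∫ t in B', F t * φ t) + ∫ t in B \ B', F t * φ t := by
      rw [← setIntegral_union disjoint_sdiff_right
        (measurableSet_closedBall.diff measurableSet_closedBall) (hint _ (hB'B.trans hBh))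
        (hint _ (sdiff_subset.trans hBh)), union_sdiff_cancel hB'B]
    -- On this shell the kernel is at most c · 4^(N+1)/h^2 and the mass of φ is at most η h/2^N.
    have hbound : ∫ t in B \ B', F t * φ t ≤ 4 * c * η * 2 ^ N / h := by
      set C := c / (h / 2 ^ (N + 1)) ^ 2 with hC
      have hC0 : 0 ≤ C := by positivity
      calc ∫ t in B \ B', F t * φ t ≤ ∫ t in B \ B', C * φ t := by
            refine setIntegral_mono_on (hint _ (sdiff_subset.trans hBh))
              ((hφi.mono_set (sdiff_subset.trans hBh)).const_mul C)
              (measurableSet_closedBall.diff measurableSet_closedBall) fun t ht => ?_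
            refine mul_le_mul_of_nonneg_right ?_ (hφ t)
            have h1 : h / 2 ^ (N + 1) < |t - θ| := by
              have := ht.2
              rw [hB', Metric.mem_closedBall, Real.dist_eq, not_le] at this
              exact this
            have h2 : t ≠ θ := by
              rintro rfl
              rw [sub_self, abs_zero] at h1
              have : 0 < h / 2 ^ (N + 1) := by positivity
              linarith
            refine (hFc t (hBh ht.1) h2).trans ?_
            rw [← sq_abs (t - θ)]
            exact div_le_div_of_nonneg_left hc (by positivity)
              (pow_le_pow_left₀ (by positivity) h1.le 2)
        _ = C * ∫ t in B \ B', φ t := integral_const_mul _ _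
        _ ≤ C * ∫ t in B, φ t := by
            refine mul_le_mul_of_nonneg_left (setIntegral_mono_set (hφi.mono_set hBh)
              (Eventually.of_forall hφ) (Eventually.of_forall sdiff_subset)) hC0
        _ ≤ C * (η * (h / 2 ^ N)) := mul_le_mul_of_nonneg_left (hmean _ (by positivity) hle) hC0
        _ = 4 * c * η * 2 ^ N / h := by
            rw [hC]; field_simp; ring
    rw [hsplit]
    have : 4 * c * η * (2 ^ (N + 1) - 1) / h =
        4 * c * η * 2 ^ N / h + 4 * c * η * (2 ^ N - 1) / h := by
      field_simp; ring
    linarith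

/-- Fatou's theorem on radial limits. -/
theorem ae_tendsto_radial {r : ℝ} (hr : 0 < r) {u : ℂ → ℝ} {g : ℝ → ℝ}
    (hu : InnerProductSpace.HarmonicOnNhd u (Metric.ball 0 r))
    (hg : IntervalIntegrable g volume 0 (2 * Real.pi))
    (hlim : Tendsto (fun ρ : ℝ => ∫ θ in (0 : ℝ)..(2 * Real.pi), |u (circleMap 0 ρ θ) - g θ|)
      (𝓝[<] r) (𝓝 0)) :
    ∀ᵐ θ : ℝ, θ ∈ Ioo 0 (2 * Real.pi) →
      Tendsto (fun ρ => u (circleMap 0 ρ θ)) (𝓝[<] r) (𝓝 (g θ)) := by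
  have hpi := Real.pi_pos
  have h2pi : (0 : ℝ) ≤ 2 * Real.pi := by positivity
  set G : ℝ → ℝ := indicator (Ioc 0 (2 * Real.pi)) g with hG
  have hGi : Integrable G := (integrable_indicator_iff measurableSet_Ioc).2
    ((intervalIntegrable_iff_integrableOn_Ioc_of_le h2pi).1 hg)
  -- The limit exists at every Lebesgue point of g, extended by zero.
  filter_upwards [IsUnifLocDoublingMeasure.ae_tendsto_average_norm_sub (μ := volume)
    hGi.locallyIntegrable 1] with θ hθ hθI
  have hGθ : G θ = g θ := indicator_of_mem (show θ ∈ Ioc 0 (2 * Real.pi) from ⟨hθI.1, hθI.2.le⟩) g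
  have havg := hθ (l := 𝓝[>] (0 : ℝ)) (fun _ => θ) id tendsto_id (by
    filter_upwards [self_mem_nhdsWithin] with j hj
    exact Metric.mem_closedBall_self (by rw [one_mul]; exact le_of_lt hj))
  set φ : ℝ → ℝ := fun t => ‖G t - G θ‖ with hφ
  have hφ0 : ∀ t, 0 ≤ φ t := fun t => norm_nonneg _
  have hφi : ∀ S : Set ℝ, volume S ≠ ⊤ → IntegrableOn φ S := fun S hS =>
    (hGi.integrableOn.sub (integrableOn_const hS)).norm
  set A := ∫ t in Ioc 0 (2 * Real.pi), φ t with hA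
  rw [Metric.tendsto_nhds]
  intro ε hε
  -- In `hin` the central ball contributes 2η and the dyadic shells 8π²η.
  set η := ε / (8 * Real.pi ^ 2 + 2) with hη
  have hη0 : 0 < η := by positivity
  obtain ⟨h₁, hh₁, hmean₁⟩ := mem_nhdsGT_iff_exists_Ioo_subset.1
    (havg.eventually (gt_mem_nhds (half_pos hη0)))
  have hh₁ : 0 < h₁ := hh₁
  obtain ⟨h, hh, hlt⟩ := exists_between
    (lt_min hh₁ (lt_min hθI.1 (sub_pos.2 hθI.2)))
  have hlt1 : h < h₁ := hlt.trans_le (min_le_left _ _)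
  have hlt2 : h < θ := hlt.trans_le ((min_le_right _ _).trans (min_le_left _ _))
  have hlt3 : h < 2 * Real.pi - θ := hlt.trans_le ((min_le_right _ _).trans (min_le_right _ _))
  have hmean : ∀ s, 0 < s → s ≤ h → ∫ t in Metric.closedBall θ s, φ t ≤ η * s := by
    intro s hs hsh
    have h1 : ⨍ t in Metric.closedBall θ s, φ t < η / 2 := hmean₁ ⟨hs, hsh.trans_lt hlt1⟩
    rw [setAverage_eq, smul_eq_mul, Measure.real, Real.volume_closedBall,
      ENNReal.toReal_ofReal (by positivity), inv_mul_lt_iff₀ (by positivity)] at h1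
    linarith
  set B := Metric.closedBall θ h with hB
  have hBI : B ⊆ Ioc 0 (2 * Real.pi) := by
    rw [hB, Real.closedBall_eq_Icc]
    exact fun t ht => ⟨by linarith [ht.1], by linarith [ht.2]⟩
  have hsin : 0 < Real.sin (h / 2) := Real.sin_pos_of_pos_of_lt_pi (by linarith) (by linarith)
  set s := Real.sin (h / 2) ^ 2 with hs
  have hs0 : 0 < s := by positivity
  have hfar : Tendsto (fun ρ => (r - ρ) / (r * s) * A) (𝓝[<] r) (𝓝 0) := by
    have : ContinuousAt (fun ρ => (r - ρ) / (r * s) * A) r := by fun_prop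
    have h1 := this.tendsto
    rw [sub_self, zero_div, zero_mul] at h1
    exact h1.mono_left nhdsWithin_le_nhds
  have hmax : max (r / 2) (r - r * h) < r := max_lt (by linarith) (by nlinarith)
  filter_upwards [hfar.eventually (gt_mem_nhds hε), Ioo_mem_nhdsLT hmax] with ρ hρA hρ
  have hρr : ρ < r := hρ.2
  have hρ2 : r / 2 ≤ ρ := ((le_max_left _ _).trans_lt hρ.1).le
  have hρ0 : 0 ≤ ρ := by linarith
  set F : ℝ → ℝ := fun t => polarPoisson ρ r (θ - t) with hF
  have hFc : Continuous F := (continuous_polarPoisson hρ0 hρr).comp (by fun_prop)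
  have hF0 : ∀ t, 0 ≤ F t := fun t => polarPoisson_nonneg hρ0 hρr _
  set d := (r - ρ) / r with hd
  have hd0 : 0 < d := div_pos (sub_pos.2 hρr) hr
  have hdh : d ≤ h := by
    have := ((le_max_right _ _).trans_lt hρ.1).le
    rw [hd, div_le_iff₀ hr]; linarith
  have hφI : IntegrableOn φ (Ioc 0 (2 * Real.pi)) := hφi _ measure_Ioc_lt_top.ne
  have hFφ : IntegrableOn (fun t => F t * φ t) (Ioc 0 (2 * Real.pi)) := by
    refine ((integrableOn_Icc_iff_integrableOn_Ioc (f := φ)).2 hφI |>.continuousOn_mul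
      hFc.continuousOn isCompact_Icc).mono_set Ioc_subset_Icc_self
  have hrep : |2 * Real.pi * (u (circleMap 0 ρ θ) - g θ)| ≤
      ∫ t in Ioc 0 (2 * Real.pi), F t * φ t := by
    have h1 := integral_polarPoisson_mul_boundary hu hg hlim hρ0 hρr θ
    have h2 := integral_polarPoisson hρ0 hρr θ
    have h3 : 2 * Real.pi * (u (circleMap 0 ρ θ) - g θ) =
        ∫ t in Ioc 0 (2 * Real.pi), F t * (G t - G θ) := by
      have h2' : ∫ t in (0 : ℝ)..(2 * Real.pi), F t * g θ = 2 * Real.pi * g θ := by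
        rw [intervalIntegral.integral_mul_const, h2]
      rw [mul_sub, ← h1, ← h2', hGθ, ← intervalIntegral.integral_sub (hg.continuousOn_mul hFc.continuousOn)
          ((hFc.intervalIntegrable _ _).mul_const _), intervalIntegral.integral_of_le h2pi]
      refine setIntegral_congr_fun measurableSet_Ioc fun t ht => ?_
      change F t * g t - F t * g θ = F t * (G t - g θ)
      rw [hG, indicator_of_mem ht]
      ring
    rw [h3, ← Real.norm_eq_abs]
    refine norm_integral_le_of_norm_le hFφ (Eventually.of_forall fun t => ?_)
    rw [norm_mul, Real.norm_eq_abs, abs_of_nonneg (hF0 t)]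
  have hsplit : ∫ t in Ioc 0 (2 * Real.pi), F t * φ t =
      (∫ t in B, F t * φ t) + ∫ t in Ioc 0 (2 * Real.pi) \ B, F t * φ t := by
    rw [← setIntegral_union disjoint_sdiff_right
      (measurableSet_Ioc.diff measurableSet_closedBall) (hFφ.mono_set hBI)
      (hFφ.mono_set sdiff_subset), union_sdiff_cancel hBI]
  have hout : ∫ t in Ioc 0 (2 * Real.pi) \ B, F t * φ t ≤ (r - ρ) / (r * s) * A := by
    have hC : 0 ≤ (r - ρ) / (r * s) := div_nonneg (by linarith) (by positivity)
    calc ∫ t in Ioc 0 (2 * Real.pi) \ B, F t * φ t ≤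
        ∫ t in Ioc 0 (2 * Real.pi) \ B, (r - ρ) / (r * s) * φ t := by
          refine setIntegral_mono_on (hFφ.mono_set sdiff_subset)
            ((hφI.mono_set sdiff_subset).const_mul _)
            (measurableSet_Ioc.diff measurableSet_closedBall) fun t ht => ?_
          refine mul_le_mul_of_nonneg_right (polarPoisson_le hρ2 hρr hs0 ?_) (hφ0 t)
          have h1 : h < |θ - t| := by
            have := ht.2
            rw [hB, Metric.mem_closedBall, Real.dist_eq, not_le, abs_sub_comm] at this
            exact this
          have h2 : |θ - t| < 2 * Real.pi - h := abs_lt.2 ⟨by linarith [ht.1.2], by linarith [ht.1.1]⟩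
          have h3 : Real.sin (h / 2) ≤ Real.sin (|θ - t| / 2) := by
            rcases le_total (|θ - t|) Real.pi with h4 | h4
            · exact Real.sin_le_sin_of_le_of_le_pi_div_two (by linarith) (by linarith) (by linarith)
            · rw [← Real.sin_pi_sub (|θ - t| / 2)]
              exact Real.sin_le_sin_of_le_of_le_pi_div_two (by linarith) (by linarith) (by linarith)
          have h4 : Real.sin (|θ - t| / 2) ^ 2 = Real.sin ((θ - t) / 2) ^ 2 := by
            rcases abs_choice (θ - t) with h | h <;> rw [h]
            rw [neg_div, Real.sin_neg, neg_sq]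
          rw [← h4]
          exact pow_le_pow_left₀ hsin.le h3 2
      _ = (r - ρ) / (r * s) * ∫ t in Ioc 0 (2 * Real.pi) \ B, φ t := integral_const_mul _ _
      _ ≤ (r - ρ) / (r * s) * A := mul_le_mul_of_nonneg_left (setIntegral_mono_set hφI
          (Eventually.of_forall hφ0) (Eventually.of_forall sdiff_subset)) hC
  have hin : ∫ t in B, F t * φ t ≤ (8 * Real.pi ^ 2 + 2) * η := by
    -- Halve h until the radius is comparable to the relative distance d from the boundary; on that
    -- last ball the maximum of the kernel is a sufficient bound.
    obtain ⟨N, hN1, hN2⟩ := exists_nat_pow_near ((one_le_div hd0).2 hdh) one_lt_two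
    rw [le_div_iff₀ hd0] at hN1
    rw [div_lt_iff₀ hd0] at hN2
    have hM : h / 2 ^ (N + 1) ≤ d := (div_le_iff₀ (by positivity)).2 (by linarith)
    have hMh : h / 2 ^ (N + 1) ≤ h := div_le_self hh.le (one_le_pow₀ one_le_two)
    have hdy := setIntegral_le_dyadic (c := d * Real.pi ^ 2) hh (by positivity) hφ0
      (hφI.mono_set hBI) hFc hmean (fun t ht hne => ?_) (N + 1)
    · refine hdy.trans ?_
      have e1 : ∫ t in Metric.closedBall θ (h / 2 ^ (N + 1)), F t * φ t ≤ 2 * η := by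
        have hsub : Metric.closedBall θ (h / 2 ^ (N + 1)) ⊆ Ioc 0 (2 * Real.pi) :=
          (Metric.closedBall_subset_closedBall hMh).trans hBI
        calc ∫ t in Metric.closedBall θ (h / 2 ^ (N + 1)), F t * φ t ≤
            ∫ t in Metric.closedBall θ (h / 2 ^ (N + 1)), 2 * r / (r - ρ) * φ t :=
              setIntegral_mono_on (hFφ.mono_set hsub) ((hφI.mono_set hsub).const_mul _)
                measurableSet_closedBall fun t _ =>
                mul_le_mul_of_nonneg_right (polarPoisson_le_center hρ2 hρr) (hφ0 t)
          _ = 2 * r / (r - ρ) * ∫ t in Metric.closedBall θ (h / 2 ^ (N + 1)), φ t :=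
              integral_const_mul _ _
          _ ≤ 2 * r / (r - ρ) * (η * (h / 2 ^ (N + 1))) :=
              mul_le_mul_of_nonneg_left (hmean _ (by positivity) hMh)
                (div_nonneg (by positivity) (by linarith))
          _ ≤ 2 * r / (r - ρ) * (η * d) := by
              refine mul_le_mul_of_nonneg_left (mul_le_mul_of_nonneg_left hM hη0.le)
                (div_nonneg (by positivity) (by linarith))
          _ = 2 * η := by
              have : r - ρ ≠ 0 := (sub_pos.2 hρr).ne'
              rw [hd]; field_simp
      have e2 : 4 * (d * Real.pi ^ 2) * η * (2 ^ (N + 1) - 1) / h ≤ 8 * Real.pi ^ 2 * η := by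
        rw [div_le_iff₀ hh]
        have e3 : d * (2 ^ (N + 1) - 1) ≤ 2 * h := by rw [pow_succ]; nlinarith
        calc 4 * (d * Real.pi ^ 2) * η * (2 ^ (N + 1) - 1) =
            4 * Real.pi ^ 2 * η * (d * (2 ^ (N + 1) - 1)) := by ring
          _ ≤ 4 * Real.pi ^ 2 * η * (2 * h) := mul_le_mul_of_nonneg_left e3 (by positivity)
          _ = 8 * Real.pi ^ 2 * η * h := by ring
      linarith
    · rw [Metric.mem_closedBall, Real.dist_eq] at ht
      have h1 : 0 < ((θ - t) / Real.pi) ^ 2 := by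
        have : θ - t ≠ 0 := sub_ne_zero.2 hne.symm
        positivity
      refine (polarPoisson_le hρ2 hρr h1 (sq_le_sin_half_sq ?_)).trans_eq ?_
      · rw [abs_sub_comm]; linarith
      · have h2 : (t - θ) ^ 2 = (θ - t) ^ 2 := by ring
        have h3 : θ - t ≠ 0 := sub_ne_zero.2 hne.symm
        rw [hd, h2]
        field_simp
  have h8 : (8 * Real.pi ^ 2 + 2) * η = ε := by rw [hη]; field_simp
  rw [abs_mul, abs_of_pos (by positivity)] at hrep
  rw [Real.dist_eq]
  have h3 : (3 : ℝ) < Real.pi := Real.pi_gt_three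
  nlinarith [abs_nonneg (u (circleMap 0 ρ θ) - g θ)]

end Fatou

/-! ### From bounded alternation to a product of sines -/

section SignChanges

/-- There is a chain of `k` points below `x` lying alternately in `A` and `B`. -/
def AltChain (A B : Set ℝ) : ℕ → ℝ → Prop
  | 0, _ => True
  | k + 1, x => ∃ y ≤ x, y ∈ (if Even k then A else B) ∧ AltChain A B k y

variable {A B : Set ℝ}

lemma AltChain.mono {k : ℕ} {x x' : ℝ} (h : AltChain A B k x) (hx : x ≤ x') :
    AltChain A B k x' := by
  cases k with
  | zero => trivial
  | succ k =>
    obtain ⟨y, hy, h1⟩ := h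
    exact ⟨y, hy.trans hx, h1⟩

lemma AltChain.of_succ {k : ℕ} {x : ℝ} (h : AltChain A B (k + 1) x) : AltChain A B k x := by
  obtain ⟨y, hy, -, h1⟩ := h
  exact h1.mono hy

lemma AltChain.anti {j k : ℕ} (hjk : j ≤ k) {x : ℝ} (h : AltChain A B k x) : AltChain A B j x := by
  induction k, hjk using Nat.le_induction with
  | base => exact h
  | succ k _ ih => exact ih h.of_succ

/-- The weak inequalities of a chain become strict because consecutive points lie in disjoint sets.
-/
lemma AltChain.exists_seq (hAB : Disjoint A B) {k : ℕ} {x : ℝ} (h : AltChain A B k x) :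
    ∃ y : ℕ → ℝ, (∀ i < k, y i ∈ if Even i then A else B) ∧
      (∀ i j, i < j → j < k → y i < y j) ∧ ∀ i < k, y i ≤ x := by
  induction k generalizing x with
  | zero => exact ⟨fun _ => 0, by simp, by simp, by simp⟩
  | succ k ih =>
    obtain ⟨z, hzx, hz, hc⟩ := h
    obtain ⟨y, h1, h2, h3⟩ := ih hc
    have hlt : ∀ i < k, y i < z := by
      intro i hi
      have hlast : y (k - 1) < z := by
        refine lt_of_le_of_ne (h3 _ (by omega)) fun heq => ?_
        have h4 := h1 (k - 1) (by omega)
        rw [heq] at h4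
        rcases Nat.even_or_odd k with hk | hk
        · have hk' : ¬ Even (k - 1) := by
            rw [Nat.not_even_iff_odd]; exact Nat.Even.sub_odd (by omega) hk odd_one
          rw [if_pos hk] at hz
          rw [if_neg hk'] at h4
          exact disjoint_left.1 hAB hz h4
        · have hk' : Even (k - 1) := Nat.Odd.sub_odd hk odd_one
          rw [if_neg (Nat.not_even_iff_odd.2 hk)] at hz
          rw [if_pos hk'] at h4
          exact disjoint_left.1 hAB h4 hz
      rcases (show i ≤ k - 1 by omega).eq_or_lt with h4 | h4
      · rw [h4]; exact hlast
      · exact (h2 i (k - 1) h4 (by omega)).trans hlast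
    refine ⟨fun i => if i < k then y i else z, fun i hi => ?_, fun i j hij hj => ?_, fun i hi => ?_⟩
    · by_cases hik : i < k
      · simp only [hik, if_true]; exact h1 i hik
      · have : i = k := by omega
        subst this
        simpa using hz
    · by_cases hjk : j < k
      · have hik : i < k := hij.trans hjk
        simp only [hjk, hik, if_true]; exact h2 i j hij hjk
      · have hik : i < k := by omega
        simp only [hjk, hik, if_true, if_false]; exact hlt i hik
    · by_cases hik : i < k
      · simp only [hik, if_true]; exact (h3 i hik).trans hzx
      · simp only [hik, if_false]; exact hzx

lemma prod_sign_pos {s : ℕ → ℝ} {K N : ℕ} (hKN : K ≤ N) (hpos : ∀ k < K, 0 < s k)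
    (hneg : ∀ k, K ≤ k → k < N → s k < 0) : 0 < (-1) ^ (N + K) * ∏ k ∈ Finset.range N, s k := by
  induction N, hKN using Nat.le_induction with
  | base =>
    rw [← two_mul, pow_mul, neg_one_sq, one_pow, one_mul]
    exact Finset.prod_pos fun k hk => hpos k (Finset.mem_range.1 hk)
  | succ N hN ih =>
    have h1 := ih fun k hk hkN => hneg k hk (by omega)
    have h2 := hneg N hN (by omega)
    rw [Finset.prod_range_succ, show N + 1 + K = N + K + 1 by ring, pow_succ]
    nlinarith

/-- If points of `A` and `B` alternate at most `2 n` times starting with `A`, then a product of `2 n`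
sines is negative on `A` and positive on `B`. -/
lemma exists_sign_product {n : ℕ} (hno : ∀ x, ¬ AltChain A B (2 * n + 1) x) :
    ∃ θ : ℕ → ℝ, ∀ x ∈ Ioo 0 (2 * Real.pi), (∀ k < 2 * n, x ≠ θ k) →
      (x ∈ A → ∏ k ∈ Finset.range (2 * n), Real.sin ((x - θ k) / 2) < 0) ∧
      (x ∈ B → 0 < ∏ k ∈ Finset.range (2 * n), Real.sin ((x - θ k) / 2)) := by
  -- The infimum θ_k of `D k` is the point beyond which a chain of length k + 1 starting in A is
  -- available. Adding 2π makes it the default when there is no such chain.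
  let D : ℕ → Set ℝ := fun k => {x | x ∈ Ioo 0 (2 * Real.pi) ∧ AltChain A B (k + 1) x} ∪ {2 * Real.pi}
  have hDb : ∀ k, BddBelow (D k) := fun k => ⟨0, by
    rintro x (hx | rfl)
    · exact hx.1.1.le
    · positivity⟩
  have hDne : ∀ k, (D k).Nonempty := fun k => ⟨_, Or.inr rfl⟩
  have hθ0 : ∀ k, 0 ≤ sInf (D k) := fun k => le_csInf (hDne k) (by
    rintro x (hx | rfl)
    · exact hx.1.1.le
    · positivity)
  have hθ1 : ∀ k, sInf (D k) ≤ 2 * Real.pi := fun k => csInf_le (hDb k) (Or.inr rfl)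
  refine ⟨fun k => sInf (D k), fun x hx hne => ?_⟩
  have hiff : ∀ k < 2 * n, (AltChain A B (k + 1) x → sInf (D k) < x) ∧
      (sInf (D k) < x → AltChain A B (k + 1) x) := by
    intro k hk
    constructor
    · intro h
      exact lt_of_le_of_ne (csInf_le (hDb k) (Or.inl ⟨hx, h⟩)) (hne k hk).symm
    · intro h
      obtain ⟨y, hy, hyx⟩ := exists_lt_of_csInf_lt (hDne k) h
      rcases hy with hy | rfl
      · exact hy.2.mono hyx.le
      · exact absurd hx.2 (not_lt.2 hyx.le)
  classical
  have hex : ∃ K, ¬ AltChain A B (K + 1) x := ⟨2 * n, hno x⟩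
  -- K is the longest chain below x, so exactly θ_0, …, θ_{K-1} are below x and the product has the
  -- sign (-1)^K. A point x of A with K even, or of B with K odd, would prolong the chain.
  set K := Nat.find hex with hK
  have hK1 : ¬ AltChain A B (K + 1) x := Nat.find_spec hex
  have hKn : K ≤ 2 * n := Nat.find_min' hex (hno x)
  have hK2 : AltChain A B K x := by
    rcases Nat.eq_zero_or_pos K with h | h
    · rw [h]; trivial
    · have h1 := Nat.find_min hex (m := K - 1) (by omega)
      rw [not_not] at h1
      rwa [show K - 1 + 1 = K by omega] at h1
  have hprod := prod_sign_pos (s := fun k => Real.sin ((x - sInf (D k)) / 2)) hKn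
    (fun k hk => by
      have h1 := (hiff k (by omega)).1 (hK2.anti (by omega))
      exact Real.sin_pos_of_pos_of_lt_pi (by linarith) (by linarith [hx.2, hθ0 k]))
    (fun k hk hkn => by
      have h1 : x < sInf (D k) := by
        refine lt_of_le_of_ne (not_lt.1 fun h => hK1 ?_) (hne k hkn)
        exact ((hiff k hkn).2 h).anti (by omega)
      exact Real.sin_neg_of_neg_of_neg_pi_lt (by linarith) (by linarith [hx.1, hθ1 k]))
  rw [pow_add, pow_mul, neg_one_sq, one_pow, one_mul] at hprod
  constructor
  · intro hxA
    have hodd : ¬ Even K := fun h => hK1 ⟨x, le_rfl, by rwa [if_pos h], hK2⟩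
    rw [(Nat.not_even_iff_odd.1 hodd).neg_one_pow] at hprod
    linarith
  · intro hxB
    have heven : Even K := by
      by_contra h
      exact hK1 ⟨x, le_rfl, by rwa [if_neg h], hK2⟩
    rw [heven.neg_one_pow] at hprod
    linarith

/-- The first points of the two chains lie in different sets. The lower one can be put in front of
the other chain, which thus gains a point. -/
lemma exists_alternating_of_chains {A B : Set ℝ} (hAB : Disjoint A B) {N : ℕ} {x x' : ℝ}
    (h1 : AltChain A B (N + 1) x) (h2 : AltChain B A (N + 1) x') :
    ∃ y : ℕ → ℝ, (∀ i j, i < j → j ≤ N + 1 → y i < y j) ∧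
      ((∀ i ≤ N + 1, y i ∈ if Even i then A else B) ∨
        ∀ i ≤ N + 1, y i ∈ if Even i then B else A) := by
  have cons : ∀ (A B : Set ℝ) (y : ℕ → ℝ) (a : ℝ), a ∈ A → a < y 0 →
      (∀ i < N + 1, y i ∈ if Even i then B else A) → (∀ i j, i < j → j < N + 1 → y i < y j) →
      ∃ y : ℕ → ℝ, (∀ i j, i < j → j ≤ N + 1 → y i < y j) ∧
        ∀ i ≤ N + 1, y i ∈ if Even i then A else B := by
    intro A B y a ha hay hm hs
    refine ⟨fun i => if i = 0 then a else y (i - 1), fun i j hij hj => ?_, fun i hi => ?_⟩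
    · have hj0 : j ≠ 0 := by omega
      simp only [hj0, if_false]
      by_cases hi0 : i = 0
      · simp only [hi0, if_true]
        rcases Nat.eq_zero_or_pos (j - 1) with h | h
        · rw [h]; exact hay
        · exact hay.trans (hs 0 _ h (by omega))
      · simp only [hi0, if_false]
        exact hs _ _ (by omega) (by omega)
    · by_cases hi0 : i = 0
      · simp only [hi0, if_true]; simpa using ha
      · simp only [hi0, if_false]
        have h3 := hm (i - 1) (by omega)
        have h4 : Even (i - 1) ↔ ¬ Even i := by
          obtain ⟨j, rfl⟩ : ∃ j, i = j + 1 := ⟨i - 1, by omega⟩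
          rw [Nat.add_sub_cancel, Nat.even_add_one, not_not]
        by_cases hi : Even i
        · rw [if_neg (by rw [h4, not_not]; exact hi)] at h3
          rw [if_pos hi]; exact h3
        · rw [if_pos (by rw [h4]; exact hi)] at h3
          rw [if_neg hi]; exact h3
  obtain ⟨y, hy1, hy2, -⟩ := h1.exists_seq hAB
  obtain ⟨z, hz1, hz2, -⟩ := h2.exists_seq hAB.symm
  have hyA : y 0 ∈ A := by simpa using hy1 0 (by omega)
  have hzB : z 0 ∈ B := by simpa using hz1 0 (by omega)
  rcases lt_trichotomy (y 0) (z 0) with h | h | h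
  · obtain ⟨w, hw1, hw2⟩ := cons A B z (y 0) hyA h hz1 hz2
    exact ⟨w, hw1, Or.inl hw2⟩
  · exact absurd (h ▸ hzB) (disjoint_left.1 hAB hyA)
  · obtain ⟨w, hw1, hw2⟩ := cons B A y (z 0) hzB h hy1 hy2
    exact ⟨w, hw1, Or.inr hw2⟩

end SignChanges

/-- The boundary values have the sign of a product of `2 n` sines. -/
theorem IsNonconstHolo.exists_sign_product_boundary {r : ℝ} {f : ℂ → ℂ} (hf : IsNonconstHolo r f)
    (ht : CurvesThroughZero r f) (hr : 0 < r) {n : ℕ} {ε : ℝ} {ψ φ : ℂ → ℂ}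
    (h : IsPowerChart f (Metric.ball 0 r) 0 n ε ψ φ) (h0 : (f 0).re = 0) {g : ℝ → ℝ}
    (hg : ∀ᵐ θ : ℝ, θ ∈ Ioo 0 (2 * Real.pi) →
      Tendsto (fun ρ => (f (circleMap 0 ρ θ)).re) (𝓝[<] r) (𝓝 (g θ))) :
    ∃ (θ : ℕ → ℝ) (e : ℝ), (e = 1 ∨ e = -1) ∧ ∀ᵐ x : ℝ, x ∈ Ioo 0 (2 * Real.pi) →
      0 ≤ e * (g x * ∏ k ∈ Finset.range (2 * n), Real.sin ((x - θ k) / 2)) := by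
  set A : Set ℝ := {x | x ∈ Ioo 0 (2 * Real.pi) ∧ ∀ᶠ ρ in 𝓝[<] r, 0 < (f (circleMap 0 ρ x)).re}
    with hA
  set B : Set ℝ := {x | x ∈ Ioo 0 (2 * Real.pi) ∧ ∀ᶠ ρ in 𝓝[<] r, (f (circleMap 0 ρ x)).re < 0}
    with hB
  have hAB : Disjoint A B := disjoint_left.2 fun x hx hx' => by
    obtain ⟨ρ, h1, h2⟩ := (hx.2.and hx'.2).exists
    exact lt_asymm h1 h2
  have hnull : ∀ (θ : ℕ → ℝ), ∀ᵐ x : ℝ, ∀ k < 2 * n, x ≠ θ k := fun θ => by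
    have : ∀ᵐ x : ℝ, ∀ k, x ≠ θ k := MeasureTheory.ae_all_iff.2 fun k =>
      MeasureTheory.Measure.ae_ne _ (θ k)
    filter_upwards [this] with x hx k _ using hx k
  have hsign : ∀ x ∈ Ioo 0 (2 * Real.pi),
      Tendsto (fun ρ => (f (circleMap 0 ρ x)).re) (𝓝[<] r) (𝓝 (g x)) →
      (0 < g x → x ∈ A) ∧ (g x < 0 → x ∈ B) := fun x hx hlim =>
    ⟨fun h => ⟨hx, hlim.eventually (lt_mem_nhds h)⟩, fun h => ⟨hx, hlim.eventually (gt_mem_nhds h)⟩⟩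
  -- Chains of length 2n + 1 of both kinds would give 2n + 2 alternating angles, which
  -- `no_alternating` forbids.
  have hcases : (∀ x, ¬ AltChain A B (2 * n + 1) x) ∨ ∀ x, ¬ AltChain B A (2 * n + 1) x := by
    by_contra! hcon
    obtain ⟨⟨x, hx⟩, x', hx'⟩ := hcon
    obtain ⟨y, hy, hy'⟩ := exists_alternating_of_chains hAB hx hx'
    have hI : ∀ i ≤ 2 * n + 1, y i ∈ Ioo 0 (2 * Real.pi) := by
      intro i hi
      rcases hy' with h | h <;>
      · have := h i hi
        split_ifs at this <;> exact this.1
    have h2π : y (2 * n + 1) < y 0 + 2 * Real.pi := by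
      linarith [(hI (2 * n + 1) le_rfl).2, (hI 0 (by omega)).1]
    rcases hy' with h' | h'
    · refine hf.no_alternating ht hr h h0 (Or.inl rfl) y hy h2π fun i hi => ?_
      have := h' i hi
      split_ifs at this with he
      · filter_upwards [this.2] with ρ hρ
        rw [he.neg_one_pow]; linarith
      · filter_upwards [this.2] with ρ hρ
        rw [(Nat.not_even_iff_odd.1 he).neg_one_pow]; linarith
    · refine hf.no_alternating ht hr h h0 (Or.inr rfl) y hy h2π fun i hi => ?_
      have := h' i hi
      split_ifs at this with he
      · filter_upwards [this.2] with ρ hρ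
        rw [he.neg_one_pow]; linarith
      · filter_upwards [this.2] with ρ hρ
        rw [(Nat.not_even_iff_odd.1 he).neg_one_pow]; linarith
  rcases hcases with hno | hno
  · obtain ⟨θ, hθ⟩ := exists_sign_product hno
    refine ⟨θ, -1, Or.inr rfl, ?_⟩
    filter_upwards [hg, hnull θ] with x hx hx2 hxI
    obtain ⟨h1, h2⟩ := hθ x hxI hx2
    obtain ⟨h3, h4⟩ := hsign x hxI (hx hxI)
    rcases lt_trichotomy (g x) 0 with h5 | h5 | h5
    · nlinarith [h2 (h4 h5)]
    · rw [h5]; simp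
    · nlinarith [h1 (h3 h5)]
  · obtain ⟨θ, hθ⟩ := exists_sign_product hno
    refine ⟨θ, 1, Or.inl rfl, ?_⟩
    filter_upwards [hg, hnull θ] with x hx hx2 hxI
    obtain ⟨h1, h2⟩ := hθ x hxI hx2
    obtain ⟨h3, h4⟩ := hsign x hxI (hx hxI)
    rcases lt_trichotomy (g x) 0 with h5 | h5 | h5
    · nlinarith [h1 (h4 h5)]
    · rw [h5]; simp
    · nlinarith [h2 (h3 h5)]

/-! ### The coefficient inequality -/

section CoefficientInequality

lemma integral_circleMap_inv : ∫ x in (0 : ℝ)..(2 * Real.pi), (circleMap 0 1 x)⁻¹ = 0 := by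
  have h1 : ∀ x : ℝ, (circleMap 0 1 x)⁻¹ = Complex.exp (-Complex.I * x) := fun x => by
    rw [circleMap_zero, Complex.ofReal_one, one_mul, ← Complex.exp_neg]
    congr 1; ring
  simp_rw [h1]
  rw [integral_exp_mul_complex (neg_ne_zero.2 Complex.I_ne_zero)]
  have h2 : Complex.exp (-Complex.I * (2 * Real.pi : ℝ)) = 1 := by
    rw [Complex.exp_eq_one_iff]
    exact ⟨-1, by push_cast; ring⟩
  rw [h2]
  simp

/-- For ζ on the unit circle the weight is 1 + cos(x - arg ζ). The term F(z)/z is split into `dslope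
F 0 z`, with value F'(0) at 0, and F(0)/z, which integrates to zero; the rest is the mean value
property. -/
lemma integral_mul_one_add_cos {F : ℂ → ℂ} {R : ℝ} (hR : 1 < R)
    (hF : DifferentiableOn ℂ F (Metric.ball 0 R)) (ζ : ℂ) :
    ∫ x in (0 : ℝ)..(2 * Real.pi),
      F (circleMap 0 1 x) * (1 + (circleMap 0 1 x * ζ⁻¹ + (circleMap 0 1 x)⁻¹ * ζ) / 2) =
    2 * Real.pi * (F 0 + ζ / 2 * deriv F 0) := by
  have hR0 : 0 < R := one_pos.trans hR
  have hF1 : DifferentiableOn ℂ (dslope F 0) (Metric.ball 0 R) :=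
    (Complex.differentiableOn_dslope (Metric.ball_mem_nhds 0 hR0)).2 hF
  set P : ℂ → ℂ := fun z => F z * (1 + z * ζ⁻¹ / 2) + dslope F 0 z * (ζ / 2) with hP
  have hPd : DifferentiableOn ℂ P (Metric.ball 0 R) := by
    refine (hF.mul ?_).add (hF1.mul_const _)
    fun_prop
  have hcl : Metric.closedBall (0 : ℂ) 1 ⊆ Metric.ball 0 R := Metric.closedBall_subset_ball hR
  have h1 : DiffContOnCl ℂ P (Metric.ball 0 |1|) := by
    refine DifferentiableOn.diffContOnCl ?_
    rw [abs_one]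
    exact hPd.mono (Metric.closure_ball_subset_closedBall.trans hcl)
  have h2 := h1.circleAverage
  have hpi : (2 * Real.pi : ℝ) ≠ 0 := by positivity
  rw [Real.circleAverage_def, inv_smul_eq_iff₀ hpi] at h2
  have hmem : ∀ x, circleMap 0 1 x ∈ Metric.ball (0 : ℂ) R := fun x => by
    rw [mem_ball_zero_iff, norm_circleMap_zero, abs_one]; exact hR
  have hPc : Continuous fun x => P (circleMap 0 1 x) :=
    hPd.continuousOn.comp_continuous (continuous_circleMap 0 1) hmem
  have hic : Continuous fun x : ℝ => (circleMap 0 1 x)⁻¹ :=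
    (continuous_circleMap 0 1).inv₀ fun x => circleMap_ne_center one_ne_zero
  have h3 : ∀ x : ℝ, F (circleMap 0 1 x) *
      (1 + (circleMap 0 1 x * ζ⁻¹ + (circleMap 0 1 x)⁻¹ * ζ) / 2) =
      P (circleMap 0 1 x) + F 0 * (ζ / 2) * (circleMap 0 1 x)⁻¹ := by
    intro x
    have hne : circleMap 0 1 x ≠ 0 := circleMap_ne_center one_ne_zero
    have h4 := sub_smul_dslope F 0 (circleMap 0 1 x)
    rw [sub_zero, smul_eq_mul] at h4
    have h5 : dslope F 0 (circleMap 0 1 x) = (F (circleMap 0 1 x) - F 0) / circleMap 0 1 x := by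
      rw [← h4, mul_div_cancel_left₀ _ hne]
    simp only [hP, h5, div_eq_mul_inv]
    ring
  simp_rw [h3]
  rw [intervalIntegral.integral_add (hPc.intervalIntegrable _ _)
    ((hic.const_mul _).intervalIntegrable _ _), intervalIntegral.integral_const_mul,
    integral_circleMap_inv, h2, hP]
  simp only [dslope_same, Complex.real_smul]
  push_cast
  ring

lemma sin_half_sub (x θ : ℝ) : ((Real.sin ((x - θ) / 2) : ℝ) : ℂ) =
    (2 * Complex.I)⁻¹ * Complex.exp (-(θ / 2) * Complex.I) * Complex.exp (-(x / 2) * Complex.I) *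
      (circleMap 0 1 x - Complex.exp (θ * Complex.I)) := by
  have h1 : circleMap 0 1 x = Complex.exp (x / 2 * Complex.I) * Complex.exp (x / 2 * Complex.I) := by
    rw [circleMap_zero, Complex.ofReal_one, one_mul, ← Complex.exp_add]; congr 1; ring
  have h2 : Complex.exp (θ * Complex.I) =
      Complex.exp (θ / 2 * Complex.I) * Complex.exp (θ / 2 * Complex.I) := by
    rw [← Complex.exp_add]; congr 1; ring
  have h3 : ((Real.sin ((x - θ) / 2) : ℝ) : ℂ) = (Complex.exp (-(x / 2) * Complex.I) *
      Complex.exp (θ / 2 * Complex.I) - Complex.exp (x / 2 * Complex.I) *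
      Complex.exp (-(θ / 2) * Complex.I)) * Complex.I / 2 := by
    rw [Complex.ofReal_sin, Complex.sin, ← Complex.exp_add, ← Complex.exp_add]
    push_cast
    congr 3
    · congr 1; ring
    · congr 1; ring
  have h4 : Complex.exp (-(x / 2) * Complex.I) * Complex.exp (x / 2 * Complex.I) = 1 := by
    rw [← Complex.exp_add, neg_mul, neg_add_cancel, Complex.exp_zero]
  have h5 : Complex.exp (-(θ / 2) * Complex.I) * Complex.exp (θ / 2 * Complex.I) = 1 := by
    rw [← Complex.exp_add, neg_mul, neg_add_cancel, Complex.exp_zero]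
  have h6 : (2 * Complex.I)⁻¹ = -(Complex.I / 2) := by
    rw [mul_inv, Complex.inv_I]; ring
  rw [h3, h1, h2, h6]
  linear_combination (-Complex.I / 2 * Complex.exp (-(x / 2) * Complex.I) *
    Complex.exp (θ / 2 * Complex.I)) * h5 + (Complex.I / 2 * Complex.exp (x / 2 * Complex.I) *
    Complex.exp (-(θ / 2) * Complex.I)) * h4

/-- Each sine is a linear factor in z = e^{ix} times e^{-ix/2}. With 2n factors the half angles
combine to z^{-n}, just what cancels the zero of f = z^n h. -/
lemma prod_sin_half_sub (θ : ℕ → ℝ) (n : ℕ) (x : ℝ) :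
    ((∏ k ∈ Finset.range (2 * n), Real.sin ((x - θ k) / 2) : ℝ) : ℂ) =
    (2 * Complex.I)⁻¹ ^ (2 * n) *
      Complex.exp (-((∑ k ∈ Finset.range (2 * n), θ k : ℝ) / 2) * Complex.I) *
      (circleMap 0 1 x ^ n)⁻¹ *
      ∏ k ∈ Finset.range (2 * n), (circleMap 0 1 x - Complex.exp (θ k * Complex.I)) := by
  rw [Complex.ofReal_prod]
  simp_rw [sin_half_sub]
  rw [Finset.prod_mul_distrib, Finset.prod_mul_distrib, Finset.prod_mul_distrib,
    Finset.prod_const, Finset.prod_const, Finset.card_range, ← Complex.exp_sum]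
  congr 3
  · congr 1
    rw [← Finset.sum_mul, Finset.sum_neg_distrib, Complex.ofReal_sum, Finset.sum_div]
  · rw [circleMap_zero, Complex.ofReal_one, one_mul, pow_mul, ← Complex.exp_nat_mul,
      ← inv_pow, ← Complex.exp_neg]
    congr 2
    push_cast
    ring

lemma hasDerivAt_prod_sub (E : ℕ → ℂ) (hE : ∀ k, E k ≠ 0) (N : ℕ) :
    HasDerivAt (fun z => ∏ k ∈ Finset.range N, (z - E k))
      (-((∏ k ∈ Finset.range N, (0 - E k)) * ∑ k ∈ Finset.range N, (E k)⁻¹)) 0 := by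
  induction N with
  | zero => simpa using hasDerivAt_const (0 : ℂ) (1 : ℂ)
  | succ N ih =>
    simp_rw [Finset.prod_range_succ, Finset.sum_range_succ]
    refine (ih.mul ((hasDerivAt_id (0 : ℂ)).sub_const (E N))).congr_deriv ?_
    have := hE N
    simp only [id]
    field_simp
    ring

lemma exists_rotation (Y : ℂ) {e : ℝ} (he : e = 1 ∨ e = -1) :
    ∃ φ : ℝ, e * (circleMap 0 1 φ * Y).re = -‖Y‖ := by
  have h1 : Complex.exp (((-Y.arg : ℝ) : ℂ) * Complex.I) * Y = ‖Y‖ := by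
    have h2 : ((-Y.arg : ℝ) : ℂ) * Complex.I + Y.arg * Complex.I = 0 := by push_cast; ring
    calc Complex.exp (((-Y.arg : ℝ) : ℂ) * Complex.I) * Y =
        Complex.exp (((-Y.arg : ℝ) : ℂ) * Complex.I) * (‖Y‖ * Complex.exp (Y.arg * Complex.I)) := by
          rw [Complex.norm_mul_exp_arg_mul_I]
      _ = ‖Y‖ := by rw [mul_left_comm, ← Complex.exp_add, h2, Complex.exp_zero, mul_one]
  rcases he with rfl | rfl
  · refine ⟨Real.pi + -Y.arg, ?_⟩
    rw [circleMap_zero, Complex.ofReal_one, one_mul, one_mul, Complex.ofReal_add, add_mul, Complex.exp_add,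
      Complex.exp_pi_mul_I, mul_assoc, h1]
    simp
  · refine ⟨-Y.arg, ?_⟩
    rw [circleMap_zero, Complex.ofReal_one, one_mul, h1]
    simp

/-- Testing with T(x)(1 + cos(x - φ)), where T is the product of sines, gives e (Re X + Re(e^{iφ}
Y)/2) ≥ 0 for every φ, where X is a multiple of h 0 and Y one of the left side. The choice of φ that
makes the second term most negative gives ‖Y‖ ≤ 2 |Re X|. -/
theorem coefficient_inequality {r : ℝ} (hr : 0 < r) {f h : ℂ → ℂ} {n : ℕ}
    (hh : AnalyticOnNhd ℂ h (Metric.ball 0 r))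
    (hfh : ∀ z ∈ Metric.ball (0 : ℂ) r, f z = z ^ n * h z) {g : ℝ → ℝ}
    (hg : IntervalIntegrable g MeasureTheory.volume 0 (2 * Real.pi))
    (hlim : Tendsto (fun ρ : ℝ => ∫ x in (0 : ℝ)..(2 * Real.pi), |(f (circleMap 0 ρ x)).re - g x|)
      (𝓝[<] r) (𝓝 0)) {θ : ℕ → ℝ} {e : ℝ} (he : e = 1 ∨ e = -1)
    (hsign : ∀ᵐ x : ℝ, x ∈ Ioo 0 (2 * Real.pi) →
      0 ≤ e * (g x * ∏ k ∈ Finset.range (2 * n), Real.sin ((x - θ k) / 2))) :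
    ‖(r : ℂ) * deriv h 0 - h 0 * ∑ k ∈ Finset.range (2 * n), Complex.exp (-θ k * Complex.I)‖ ≤
      2 * |(Complex.exp ((∑ k ∈ Finset.range (2 * n), θ k : ℝ) / 2 * Complex.I) * h 0).re| := by
  have h2pi : (0 : ℝ) ≤ 2 * Real.pi := by positivity
  set T : ℝ → ℝ := fun x => ∏ k ∈ Finset.range (2 * n), Real.sin ((x - θ k) / 2) with hT
  set σ : ℝ := ∑ k ∈ Finset.range (2 * n), θ k with hσ
  set c : ℂ := (2 * Complex.I)⁻¹ ^ (2 * n) * Complex.exp (-(σ / 2) * Complex.I) with hc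
  set Q : ℂ → ℂ := fun z => ∏ k ∈ Finset.range (2 * n), (z - Complex.exp (θ k * Complex.I)) with hQ
  have hT1 : ∀ x, |T x| ≤ 1 := fun x => by
    rw [hT, Finset.abs_prod]
    exact Finset.prod_le_one (fun k _ => abs_nonneg _) fun k _ => Real.abs_sin_le_one _
  have hQd : Differentiable ℂ Q := by rw [hQ]; fun_prop
  have hrne : ∀ ρ : ℝ, 0 < ρ → ρ < r → ∃ R, 1 < R ∧
      MapsTo (fun z : ℂ => (ρ : ℂ) * z) (Metric.ball 0 R) (Metric.ball 0 r) := by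
    intro ρ hρ hρr
    refine ⟨r / ρ, (one_lt_div hρ).2 hρr, fun z hz => ?_⟩
    rw [mem_ball_zero_iff] at hz ⊢
    rw [norm_mul, Complex.norm_real, Real.norm_eq_abs, abs_of_pos hρ, mul_comm]
    exact (lt_div_iff₀ hρ).1 hz
  -- On the circle of radius ρ the function T f is ρ^n c F(e^{ix}) with F(z) = h(ρz) Q(z)
  -- holomorphic beyond the closed unit disc, so `integral_mul_one_add_cos` applies.
  have hA : ∀ φ ρ : ℝ, 0 < ρ → ρ < r →
      ∫ x in (0 : ℝ)..(2 * Real.pi), (T x * (1 + Real.cos (x - φ))) * (f (circleMap 0 ρ x)).re =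
      2 * Real.pi * (ρ ^ n * (c * (h 0 * Q 0 + circleMap 0 1 φ / 2 *
        (ρ * deriv h 0 * Q 0 + h 0 * deriv Q 0))).re) := by
    intro φ ρ hρ hρr
    obtain ⟨R, hR, hmaps⟩ := hrne ρ hρ hρr
    set F : ℂ → ℂ := fun z => h (ρ * z) * Q z with hF
    have hFd : DifferentiableOn ℂ F (Metric.ball 0 R) :=
      (hh.differentiableOn.comp (by fun_prop) hmaps).mul hQd.differentiableOn
    have hF0 : F 0 = h 0 * Q 0 := by simp [hF]
    have hF' : deriv F 0 = ρ * deriv h 0 * Q 0 + h 0 * deriv Q 0 := by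
      have e1 : HasDerivAt (fun z : ℂ => (ρ : ℂ) * z) ρ 0 := by
        simpa using (hasDerivAt_id (0 : ℂ)).const_mul (ρ : ℂ)
      have e2 : HasDerivAt h (deriv h 0) ((ρ : ℂ) * 0) := by
        rw [mul_zero]
        exact (hh 0 (Metric.mem_ball_self hr)).differentiableAt.hasDerivAt
      have e3 : HasDerivAt F _ 0 := (e2.comp 0 e1).mul (hQd 0).hasDerivAt
      rw [e3.deriv]
      simp only [Function.comp_apply, mul_zero]
      ring
    have hint := integral_mul_one_add_cos hR hFd (circleMap 0 1 φ)
    rw [hF0, hF'] at hint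
    have hpt : ∀ x : ℝ, (T x * (1 + Real.cos (x - φ))) * (f (circleMap 0 ρ x)).re =
        ((ρ ^ n * c) * (F (circleMap 0 1 x) * (1 + (circleMap 0 1 x * (circleMap 0 1 φ)⁻¹ +
          (circleMap 0 1 x)⁻¹ * circleMap 0 1 φ) / 2))).re := by
      intro x
      have e1 : circleMap 0 ρ x = ρ * circleMap 0 1 x := by
        rw [circleMap_zero, circleMap_zero, Complex.ofReal_one, one_mul]
      have e2 : circleMap 0 ρ x ∈ Metric.ball (0 : ℂ) r := by
        rw [mem_ball_zero_iff, norm_circleMap_zero, abs_of_pos hρ]; exact hρr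
      have e3 : ((1 + Real.cos (x - φ) : ℝ) : ℂ) = 1 + (circleMap 0 1 x * (circleMap 0 1 φ)⁻¹ +
          (circleMap 0 1 x)⁻¹ * circleMap 0 1 φ) / 2 := by
        rw [Complex.ofReal_add, Complex.ofReal_cos, Complex.cos, circleMap_zero, circleMap_zero,
          Complex.ofReal_one, one_mul, one_mul, ← Complex.exp_neg, ← Complex.exp_neg,
          ← Complex.exp_add, ← Complex.exp_add]
        congr 3
        · congr 1; push_cast; ring
        · congr 1; push_cast; ring
      rw [← Complex.re_ofReal_mul, Complex.ofReal_mul, e3, hT, prod_sin_half_sub, hfh _ e2, e1,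
        mul_pow]
      congr 1
      simp only [hF, hc, hQ, hσ]
      field_simp
    have hcont : Continuous fun x : ℝ => (ρ ^ n * c : ℂ) * (F (circleMap 0 1 x) *
        (1 + (circleMap 0 1 x * (circleMap 0 1 φ)⁻¹ +
          (circleMap 0 1 x)⁻¹ * circleMap 0 1 φ) / 2)) := by
      have e1 : Continuous fun x : ℝ => F (circleMap 0 1 x) :=
        hFd.continuousOn.comp_continuous (continuous_circleMap 0 1) fun x => by
          rw [mem_ball_zero_iff, norm_circleMap_zero, abs_one]; exact hR
      have e2 : Continuous fun x : ℝ => (circleMap 0 1 x)⁻¹ :=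
        (continuous_circleMap 0 1).inv₀ fun x => circleMap_ne_center one_ne_zero
      have e3 := continuous_circleMap 0 1
      exact continuous_const.mul (e1.mul (continuous_const.add
        (((e3.mul continuous_const).add (e2.mul continuous_const)).div_const 2)))
    simp_rw [hpt]
    have hre := Complex.reCLM.intervalIntegral_comp_comm 
      (hcont.intervalIntegrable (μ := MeasureTheory.volume) 0 (2 * Real.pi))
    simp only [Complex.reCLM_apply] at hre
    rw [hre, intervalIntegral.integral_const_mul, hint]
    have : (ρ : ℂ) ^ n * c * (2 * Real.pi * (h 0 * Q 0 + circleMap 0 1 φ / 2 *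
        (ρ * deriv h 0 * Q 0 + h 0 * deriv Q 0))) = ((2 * Real.pi * ρ ^ n : ℝ) : ℂ) *
        (c * (h 0 * Q 0 + circleMap 0 1 φ / 2 * (ρ * deriv h 0 * Q 0 + h 0 * deriv Q 0))) := by
      push_cast; ring
    rw [this, Complex.re_ofReal_mul, mul_assoc]
  -- Let ρ tend to r: L¹ convergence replaces Re f by g, for which the sign is known.
  have hV : ∀ φ : ℝ, 0 ≤ e * (c * (h 0 * Q 0 + circleMap 0 1 φ / 2 *
      (r * deriv h 0 * Q 0 + h 0 * deriv Q 0))).re := by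
    intro φ
    have hkc : Continuous fun x : ℝ => T x * (1 + Real.cos (x - φ)) := by fun_prop
    have hIoo : ∀ᶠ ρ in 𝓝[<] r, ρ ∈ Ioo 0 r := Ioo_mem_nhdsLT hr
    have l1 := tendsto_integral_mul_of_L1 (M := 2) (k := fun _ x => T x * (1 + Real.cos (x - φ)))
      (k₀ := fun x => T x * (1 + Real.cos (x - φ))) hg (v := fun ρ x => (f (circleMap 0 ρ x)).re)
      (by
        filter_upwards [hIoo] with ρ hρ
        have hm : ∀ x, circleMap 0 ρ x ∈ Metric.ball (0 : ℂ) r := fun x => by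
          rw [mem_ball_zero_iff, norm_circleMap_zero, abs_of_pos hρ.1]; exact hρ.2
        have e1 : Continuous fun x => (circleMap 0 ρ x) ^ n * h (circleMap 0 ρ x) :=
          ((continuous_circleMap 0 ρ).pow n).mul
            (hh.continuousOn.comp_continuous (continuous_circleMap 0 ρ) hm)
        refine (Complex.continuous_re.comp e1).congr fun x => ?_
        rw [Function.comp_apply, hfh _ (hm x)])
      hlim (Eventually.of_forall fun _ => hkc)
      (Eventually.of_forall fun _ x => by
        rw [abs_mul]
        have e1 := hT1 x
        have e2 : |1 + Real.cos (x - φ)| ≤ 2 := by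
          rw [abs_le]
          constructor <;> linarith [Real.cos_le_one (x - φ), Real.neg_one_le_cos (x - φ)]
        calc |T x| * |1 + Real.cos (x - φ)| ≤ 1 * 2 :=
              mul_le_mul e1 e2 (abs_nonneg _) zero_le_one
          _ = 2 := one_mul 2)
      (fun x => tendsto_const_nhds)
    have l2 : Tendsto (fun ρ : ℝ => 2 * Real.pi * (ρ ^ n * (c * (h 0 * Q 0 + circleMap 0 1 φ / 2 *
        (ρ * deriv h 0 * Q 0 + h 0 * deriv Q 0))).re)) (𝓝[<] r)
        (𝓝 (2 * Real.pi * (r ^ n * (c * (h 0 * Q 0 + circleMap 0 1 φ / 2 *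
        (r * deriv h 0 * Q 0 + h 0 * deriv Q 0))).re))) := by
      refine Tendsto.mono_left (Continuous.tendsto ?_ r) nhdsWithin_le_nhds
      fun_prop
    have l3 := tendsto_nhds_unique l1 (l2.congr' (by
      filter_upwards [hIoo] with ρ hρ
      exact (hA φ ρ hρ.1 hρ.2).symm))
    have l4 : 0 ≤ ∫ x in (0 : ℝ)..(2 * Real.pi), e * (T x * (1 + Real.cos (x - φ)) * g x) := by
      rw [intervalIntegral.integral_of_le h2pi, MeasureTheory.integral_Ioc_eq_integral_Ioo]
      refine MeasureTheory.setIntegral_nonneg_of_ae_restrict ?_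
      refine (MeasureTheory.ae_restrict_iff' measurableSet_Ioo).2 ?_
      filter_upwards [hsign] with x hx hxI
      have e1 := hx hxI
      have e2 : 0 ≤ 1 + Real.cos (x - φ) := by linarith [Real.neg_one_le_cos (x - φ)]
      have e3 := mul_nonneg e1 e2
      calc (0 : ℝ) ≤ _ := e3
        _ = _ := by simp only [hT]; ring
    rw [intervalIntegral.integral_const_mul, l3] at l4
    have hp : 0 < 2 * Real.pi * r ^ n := by positivity
    have l5 : e * (2 * Real.pi * (r ^ n * (c * (h 0 * Q 0 + circleMap 0 1 φ / 2 *
        (r * deriv h 0 * Q 0 + h 0 * deriv Q 0))).re)) = 2 * Real.pi * r ^ n *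
        (e * (c * (h 0 * Q 0 + circleMap 0 1 φ / 2 *
        (r * deriv h 0 * Q 0 + h 0 * deriv Q 0))).re) := by ring
    rw [l5] at l4
    exact nonneg_of_mul_nonneg_right l4 hp
  set X := c * (h 0 * Q 0) with hX
  set Y := c * (r * deriv h 0 * Q 0 + h 0 * deriv Q 0) with hY
  have hXY : ‖Y‖ ≤ 2 * |X.re| := by
    obtain ⟨φ, hφ⟩ := exists_rotation Y he
    have h1 := hV φ
    have h2 : c * (h 0 * Q 0 + circleMap 0 1 φ / 2 * (r * deriv h 0 * Q 0 + h 0 * deriv Q 0)) =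
        X + ((1 / 2 : ℝ) : ℂ) * (circleMap 0 1 φ * Y) := by rw [hX, hY]; push_cast; ring
    rw [h2, Complex.add_re, Complex.re_ofReal_mul] at h1
    have h3 : e * X.re ≤ |X.re| := by
      rcases he with rfl | rfl
      · rw [one_mul]; exact le_abs_self _
      · rw [neg_one_mul]; exact neg_le_abs _
    nlinarith
  have hQ0 : Q 0 = Complex.exp (σ * Complex.I) := by
    have h1 : ∀ k, (0 : ℂ) - Complex.exp (θ k * Complex.I) = -1 * Complex.exp (θ k * Complex.I) :=
      fun k => by ring
    simp only [hQ, h1]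
    rw [Finset.prod_mul_distrib, Finset.prod_const, Finset.card_range, pow_mul, neg_one_sq, one_pow,
      one_mul, ← Complex.exp_sum, ← Finset.sum_mul, hσ, Complex.ofReal_sum]
  have hQ' : deriv Q 0 = -(Q 0 * ∑ k ∈ Finset.range (2 * n), Complex.exp (-θ k * Complex.I)) := by
    have h1 := (hasDerivAt_prod_sub (fun k => Complex.exp (θ k * Complex.I))
      (fun k => Complex.exp_ne_zero _) (2 * n)).deriv
    simp only [← Complex.exp_neg] at h1
    simp only [neg_mul]
    exact h1
  -- Up to this common real factor and factors of modulus 1, Y and X are the two sides of the claim.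
  have h2I : ((2 * Complex.I)⁻¹ : ℂ) ^ (2 * n) = (((-4)⁻¹ ^ n : ℝ) : ℂ) := by
    rw [pow_mul]
    push_cast
    congr 1
    rw [inv_pow, mul_pow, Complex.I_sq]
    norm_num
  have hYe : ‖Y‖ = |((-4 : ℝ)⁻¹) ^ n| * ‖(r : ℂ) * deriv h 0 -
      h 0 * ∑ k ∈ Finset.range (2 * n), Complex.exp (-θ k * Complex.I)‖ := by
    have h1 : Y = (((-4)⁻¹ ^ n : ℝ) : ℂ) * (Complex.exp ((-(σ / 2) : ℝ) * Complex.I) *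
        Complex.exp ((σ : ℝ) * Complex.I)) * ((r : ℂ) * deriv h 0 -
        h 0 * ∑ k ∈ Finset.range (2 * n), Complex.exp (-θ k * Complex.I)) := by
      rw [hY, hc, hQ', hQ0, h2I]
      push_cast
      ring
    rw [h1, norm_mul, norm_mul, norm_mul, Complex.norm_exp_ofReal_mul_I,
      Complex.norm_exp_ofReal_mul_I, Complex.norm_real, Real.norm_eq_abs, mul_one, mul_one]
  have hXe : |X.re| = |((-4 : ℝ)⁻¹) ^ n| * |(Complex.exp (σ / 2 * Complex.I) * h 0).re| := by
    have h1 : X = (((-4)⁻¹ ^ n : ℝ) : ℂ) * (Complex.exp (σ / 2 * Complex.I) * h 0) := by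
      have h2 : Complex.exp (σ / 2 * Complex.I) =
          Complex.exp (-(σ / 2) * Complex.I) * Complex.exp (σ * Complex.I) := by
        rw [← Complex.exp_add]; congr 1; ring
      rw [hX, hc, hQ0, h2I, h2]
      ring
    rw [h1, Complex.re_ofReal_mul, abs_mul]
  rw [hYe, hXe] at hXY
  have hpos : 0 < |((-4 : ℝ)⁻¹) ^ n| := abs_pos.2 (pow_ne_zero _ (by norm_num))
  nlinarith

end CoefficientInequality

/-! ### Sums of cosines with prescribed total angle -/

section Trigonometry

/-- If all cosines are positive, reduce the angles modulo 2π to absolute value at most π/2. The sum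
remains an odd multiple of π, so the absolute values add up to at least π, and Jensen's inequality
for the concave cosine applies. If some cosine is not positive, the sum is at most N - 1 ≤ N (1 -
(π/N)^2/2); here N ≥ 5 is used in the form π² ≤ 2N. -/
lemma sum_cos_le {N : ℕ} (hN : 5 ≤ N) (x : ℕ → ℝ) {k : ℤ}
    (hx : ∑ i ∈ Finset.range N, x i = Real.pi + k * (2 * Real.pi)) :
    ∑ i ∈ Finset.range N, Real.cos (x i) ≤ N * Real.cos (Real.pi / N) := by
  have hpi := Real.pi_pos
  have hN0 : (0 : ℝ) < N := by positivity
  have hN5 : (5 : ℝ) ≤ N := by exact_mod_cast hN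
  by_cases hall : ∀ i ∈ Finset.range N, 0 < Real.cos (x i)
  · set y : ℕ → ℝ := fun i => x i - round (x i / (2 * Real.pi)) * (2 * Real.pi) with hy
    have hcos : ∀ i, Real.cos |y i| = Real.cos (x i) := fun i => by
      rw [Real.cos_abs, hy, Real.cos_sub_int_mul_two_pi]
    have hyle : ∀ i, |y i| ≤ Real.pi := fun i => by
      have h1 := abs_sub_round (x i / (2 * Real.pi))
      have h2 : y i = (x i / (2 * Real.pi) - round (x i / (2 * Real.pi))) * (2 * Real.pi) := by
        rw [hy]; field_simp
      rw [h2, abs_mul, abs_of_pos (by positivity : 0 < 2 * Real.pi)]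
      nlinarith
    have hyI : ∀ i ∈ Finset.range N, |y i| ∈ Icc 0 (Real.pi / 2) := fun i hi => by
      refine ⟨abs_nonneg _, ?_⟩
      by_contra! hlt
      have h1 := hall i hi
      rw [← hcos] at h1
      exact absurd (Real.cos_nonpos_of_pi_div_two_le_of_le hlt.le (by linarith [hyle i]))
        (not_le.2 h1)
    have hconc : ConcaveOn ℝ (Icc 0 (Real.pi / 2)) Real.cos :=
      strictConcaveOn_cos_Icc.concaveOn.subset (Icc_subset_Icc (by linarith) le_rfl) (convex_Icc _ _)
    have hJ := hconc.le_map_sum (t := Finset.range N) (w := fun _ => (1 : ℝ) / N)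
      (p := fun i => |y i|) (fun i _ => by positivity)
      (by rw [Finset.sum_const, Finset.card_range, nsmul_eq_mul]; field_simp) hyI
    simp only [smul_eq_mul, ← Finset.mul_sum, hcos] at hJ
    have hmem : 1 / (N : ℝ) * ∑ i ∈ Finset.range N, |y i| ≤ Real.pi / 2 := by
      have : ∑ i ∈ Finset.range N, |y i| ≤ ∑ i ∈ Finset.range N, Real.pi / 2 :=
        Finset.sum_le_sum fun i hi => (hyI i hi).2
      rw [Finset.sum_const, Finset.card_range, nsmul_eq_mul] at this
      rw [div_mul_eq_mul_div, one_mul, div_le_iff₀ hN0]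
      linarith
    have hge : Real.pi ≤ ∑ i ∈ Finset.range N, |y i| := by
      refine le_trans ?_ (Finset.abs_sum_le_sum_abs _ _)
      set l : ℤ := k - ∑ i ∈ Finset.range N, round (x i / (2 * Real.pi)) with hl
      have h1 : ∑ i ∈ Finset.range N, y i = Real.pi * ((2 * l + 1 : ℤ) : ℝ) := by
        simp only [hy]
        rw [Finset.sum_sub_distrib, hx, ← Finset.sum_mul, hl]
        push_cast
        ring
      rw [h1, abs_mul, abs_of_pos hpi]
      have h2 : (1 : ℤ) ≤ |2 * l + 1| := Int.one_le_abs (by omega)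
      have h3 : (1 : ℝ) ≤ |((2 * l + 1 : ℤ) : ℝ)| := by exact_mod_cast h2
      nlinarith
    have hdec : Real.cos (1 / (N : ℝ) * ∑ i ∈ Finset.range N, |y i|) ≤ Real.cos (Real.pi / N) := by
      refine Real.cos_le_cos_of_nonneg_of_le_pi (by positivity) (by linarith) ?_
      rw [div_mul_eq_mul_div, one_mul]
      exact div_le_div_of_nonneg_right hge hN0.le
    have h4 := hJ.trans hdec
    rw [div_mul_eq_mul_div, one_mul, div_le_iff₀ hN0] at h4
    linarith
  · push Not at hall
    obtain ⟨j, hj, hcj⟩ := hall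
    have h1 : ∑ i ∈ Finset.range N, Real.cos (x i) ≤ N - 1 := by
      rw [← Finset.add_sum_erase _ _ hj]
      have h2 : ∑ i ∈ (Finset.range N).erase j, Real.cos (x i) ≤
          ∑ i ∈ (Finset.range N).erase j, (1 : ℝ) :=
        Finset.sum_le_sum fun i _ => Real.cos_le_one _
      rw [Finset.sum_const, Finset.card_erase_of_mem hj, Finset.card_range, nsmul_eq_mul,
        mul_one, Nat.cast_sub (by omega)] at h2
      push_cast at h2
      linarith
    have h2 := Real.one_sub_sq_div_two_le_cos (x := Real.pi / N)
    have h3 : (N : ℝ) - 1 ≤ N * (1 - (Real.pi / N) ^ 2 / 2) := by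
      have h4 : (N : ℝ) * (1 - (Real.pi / N) ^ 2 / 2) = N - Real.pi ^ 2 / (2 * N) := by
        field_simp
      rw [h4]
      have h5 : Real.pi ^ 2 / (2 * N) ≤ 1 := by
        rw [div_le_one (by positivity)]
        have := Real.pi_lt_d2
        nlinarith
      linarith
    nlinarith

/-- Shifting each y_k by π/2 turns the sines into cosines, and 2 |sin(S/2)| counts as two further
cosines of an angle w. Because n is even, |sin(S/2)| = |sin((S - nπ)/2)|, which makes the total
angle S - nπ - 2w an odd multiple of π. -/
lemma sum_sin_le_of_even {n : ℕ} (hn : 2 ≤ n) (he : Even n) (y : ℕ → ℝ) :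
    |∑ k ∈ Finset.range (2 * n), Real.sin (y k)| +
      2 * |Real.sin ((∑ k ∈ Finset.range (2 * n), y k) / 2)| ≤
      (2 * n + 2) * Real.cos (Real.pi / (2 * (n + 1))) := by
  wlog hpos : 0 ≤ ∑ k ∈ Finset.range (2 * n), Real.sin (y k) generalizing y
  · have h1 := this (fun k => -y k) (by
      simp only [Real.sin_neg, Finset.sum_neg_distrib]; linarith)
    simp only [Real.sin_neg, Finset.sum_neg_distrib, abs_neg, neg_div] at h1
    exact h1
  rw [abs_of_nonneg hpos]
  obtain ⟨l, hl⟩ := he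
  set S := ∑ k ∈ Finset.range (2 * n), y k with hS
  set X := S - n * Real.pi with hX
  have hsX : |Real.sin (S / 2)| = |Real.sin (X / 2)| := by
    have h1 : X / 2 = S / 2 - l * Real.pi := by rw [hX, hl]; push_cast; ring
    rw [h1, Real.sin_sub_nat_mul_pi, abs_mul, abs_pow, abs_neg, abs_one, one_pow, one_mul]
  obtain ⟨j, w, hw, hcw⟩ : ∃ (j : ℤ) (w : ℝ), X - 2 * w = Real.pi + j * (2 * Real.pi) ∧
      |Real.sin (X / 2)| = Real.cos w := by
    rcases abs_choice (Real.sin (X / 2)) with h | h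
    · refine ⟨0, X / 2 - Real.pi / 2, by push_cast; ring, ?_⟩
      rw [h, Real.cos_sub_pi_div_two]
    · refine ⟨-1, X / 2 + Real.pi / 2, by push_cast; ring, ?_⟩
      rw [h, Real.cos_add_pi_div_two]
  have hx := sum_cos_le (N := 2 * n + 1 + 1) (by omega)
    (fun i => if i < 2 * n then y i - Real.pi / 2 else -w) (k := j) (by
      rw [Finset.sum_range_succ, Finset.sum_range_succ,
        Finset.sum_congr rfl (fun i hi => if_pos (Finset.mem_range.1 hi)), Finset.sum_sub_distrib,
        Finset.sum_const, Finset.card_range, nsmul_eq_mul, if_neg (by omega), if_neg (by omega),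
        ← hw, hX]
      push_cast
      ring)
  rw [Finset.sum_range_succ, Finset.sum_range_succ, if_neg (by omega), if_neg (by omega),
    Finset.sum_congr rfl (fun i hi => by
      rw [if_pos (Finset.mem_range.1 hi), Real.cos_sub_pi_div_two]), Real.cos_neg] at hx
  rw [hsX, hcw]
  push_cast at hx
  rw [show (2 * (n : ℝ) + 1 + 1) = 2 * n + 2 by ring] at hx
  rw [show 2 * ((n : ℝ) + 1) = 2 * n + 2 by ring]
  linarith

end Trigonometry

/-! ### Curvature in terms of the first two coefficients -/

section Curvature

lemma IsPowerChart.exists_eq_pow_mul {f : ℂ → ℂ} {r : ℝ} {n : ℕ} {ε : ℝ} {ψ φ : ℂ → ℂ}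
    (hf : AnalyticOnNhd ℂ f (Metric.ball 0 r))
    (h : IsPowerChart f (Metric.ball 0 r) 0 n ε ψ φ) (h0 : f 0 = 0) :
    ∃ g : ℂ → ℂ, AnalyticOnNhd ℂ g (Metric.ball 0 r) ∧ g 0 ≠ 0 ∧
      ∀ z ∈ Metric.ball (0 : ℂ) r, f z = z ^ n * g z := by
  have hn : n ≠ 0 := Nat.one_le_iff_ne_zero.1 h.one_le
  obtain ⟨q, hq, hqf⟩ : ∃ q : ℂ → ℂ, AnalyticAt ℂ q 0 ∧ (q 0 ≠ 0 ∧ ∀ᶠ z in 𝓝 0, f z = z ^ n * q z) := by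
    have h1 : AnalyticAt ℂ (dslope φ 0) 0 := by
      obtain ⟨p, hp⟩ := h.analyticAt_inv
      exact hp.has_fpower_series_dslope_fslope.analyticAt
    refine ⟨fun z => dslope φ 0 z ^ n, h1.pow n, ?_, ?_⟩
    · simp only [dslope_same]
      exact pow_ne_zero _ h.deriv_inv_ne_zero
    · filter_upwards [h.right_inv] with z hz
      have h2 := sub_smul_dslope φ 0 z
      rw [sub_zero, smul_eq_mul, h.inv_center, sub_zero] at h2
      rw [← mul_pow, h2]
      conv_lhs => rw [← hz.2]
      rw [h.eq_pow _ hz.1, h0, zero_add]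
  obtain ⟨hq0, hqf⟩ := hqf
  have hev : Function.update (fun z => f z / z ^ n) 0 (q 0) =ᶠ[𝓝 0] q := by
    filter_upwards [hqf] with z hz
    rcases eq_or_ne z 0 with rfl | hz0
    · simp
    · rw [Function.update_of_ne hz0, hz, mul_div_cancel_left₀ _ (pow_ne_zero _ hz0)]
  refine ⟨Function.update (fun z => f z / z ^ n) 0 (q 0), fun z hz => ?_, by simpa using hq0,
    fun z hz => ?_⟩
  · rcases eq_or_ne z 0 with rfl | hz0
    · exact hq.congr hev.symm
    · have h1 : AnalyticAt ℂ (fun z => f z / z ^ n) z :=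
        (hf z hz).div (analyticAt_id.pow n) (pow_ne_zero _ hz0)
      refine h1.congr ?_
      filter_upwards [isOpen_ne.mem_nhds hz0] with x hx
      rw [Function.update_of_ne hx]
  · rcases eq_or_ne z 0 with rfl | hz0
    · rw [h0, zero_pow hn, zero_mul]
    · rw [Function.update_of_ne hz0, mul_div_cancel₀ _ (pow_ne_zero _ hz0)]

/-- Write γ(s) = (s - t) δ(s). The real factor (s - t)^n drops out, leaving Re(δ^n h(γ)) = 0 near t;
the two conclusions are its value and its derivative at t, because δ(t) = γ'(t) and δ'(t) =
γ''(t)/2. -/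
lemma curve_expansion {γ : ℝ → ℂ} {t : ℝ} (hγ : AnalyticAt ℝ γ t) (h0 : γ t = 0)
    {h : ℂ → ℂ} (hh : AnalyticAt ℂ h 0) {n : ℕ}
    (hZ : ∀ᶠ s in 𝓝 t, (γ s ^ n * h (γ s)).re = 0) :
    (deriv γ t ^ n * h 0).re = 0 ∧
    (n * deriv γ t ^ (n - 1) * (deriv (deriv γ) t / 2) * h 0 +
      deriv γ t ^ n * (deriv h 0 * deriv γ t)).re = 0 := by
  set δ := dslope γ t with hδ
  have hδa : AnalyticAt ℝ δ t := hγ.dslope_self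
  have hδt : δ t = deriv γ t := dslope_same γ t
  have hγδ : ∀ s, γ s = (s - t) * δ s := fun s => by
    have := sub_smul_dslope γ t s
    rw [h0, sub_zero, Complex.real_smul] at this
    rw [← this]
    push_cast
    rfl
  have hδ' : deriv (deriv γ) t / 2 = deriv δ t := by
    have h1 : deriv γ =ᶠ[𝓝 t] fun s => δ s + (s - t) * deriv δ s := by
      filter_upwards [hδa.eventually_analyticAt] with s hs
      have h2 : HasDerivAt (fun s : ℝ => ((s : ℂ) - t)) 1 s :=
        Complex.ofRealCLM.hasDerivAt.sub_const (t : ℂ)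
      have h3 := h2.mul hs.differentiableAt.hasDerivAt
      have h4 : γ = (fun s : ℝ => ((s : ℂ) - t)) * δ := funext hγδ
      rw [h4, h3.deriv, one_mul]
    have h2 : HasDerivAt (fun s : ℝ => ((s : ℂ) - t)) 1 t :=
      Complex.ofRealCLM.hasDerivAt.sub_const (t : ℂ)
    have h3 : HasDerivAt (fun s => δ s + (s - t) * deriv δ s) _ t :=
      hδa.differentiableAt.hasDerivAt.add (h2.mul hδa.deriv.differentiableAt.hasDerivAt)
    rw [h1.deriv_eq, h3.deriv]
    simp
  set k : ℝ → ℂ := fun s => δ s ^ n * h (γ s) with hk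
  have hγd : HasDerivAt γ (deriv γ t) t := hγ.differentiableAt.hasDerivAt
  have hhd : HasDerivAt h (deriv h 0) (γ t) := by rw [h0]; exact hh.differentiableAt.hasDerivAt
  have hkd : HasDerivAt k (n * deriv γ t ^ (n - 1) * (deriv (deriv γ) t / 2) * h 0 +
      deriv γ t ^ n * (deriv h 0 * deriv γ t)) t := by
    have h1 : HasDerivAt k _ t :=
      (hδa.differentiableAt.hasDerivAt.pow n).mul (hhd.comp t hγd)
    refine h1.congr_deriv ?_
    simp only [Pi.pow_apply]
    rw [hδ', hδt, h0]
  have hpunct : ∀ᶠ s in 𝓝[≠] t, (k s).re = 0 := by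
    filter_upwards [hZ.filter_mono nhdsWithin_le_nhds, self_mem_nhdsWithin] with s hs hne
    have h1 : γ s ^ n * h (γ s) = (((s - t) ^ n : ℝ) : ℂ) * k s := by
      have h2 : γ s ^ n = ((s : ℂ) - t) ^ n * δ s ^ n := by rw [hγδ s, mul_pow]
      simp only [hk]
      rw [h2]
      push_cast
      ring
    rw [h1, Complex.re_ofReal_mul] at hs
    exact (mul_eq_zero.1 hs).resolve_left (pow_ne_zero _ (sub_ne_zero.2 hne))
  have hkc : Tendsto (fun s => (k s).re) (𝓝[≠] t) (𝓝 (k t).re) :=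
    (Complex.continuous_re.continuousAt.comp hkd.continuousAt).tendsto.mono_left nhdsWithin_le_nhds
  have hk0 : (k t).re = 0 :=
    tendsto_nhds_unique hkc (tendsto_const_nhds.congr' (hpunct.mono fun s hs => hs.symm))
  constructor
  · rw [← hk0, hk]
    simp only [hδt, h0]
  · have h1 : HasDerivAt (fun s => (k s).re) _ t :=
      Complex.reCLM.hasFDerivAt.comp_hasDerivAt t hkd
    refine h1.unique ((hasDerivAt_const t (0 : ℝ)).congr_of_eventuallyEq ?_)
    filter_upwards [eventually_nhdsWithin_iff.1 hpunct] with s hs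
    by_cases hst : s = t
    · rw [hst, hk0]
    · exact hs hst

/-- The curvature at `0` of a curve on which the real part of `z ^ n * h z` vanishes. -/
lemma signedCurvature_eq {γ : ℝ → ℂ} {t : ℝ} (hγ : IsRegularAnalytic γ) (h0 : γ t = 0)
    {h : ℂ → ℂ} (hh : AnalyticAt ℂ h 0) {n : ℕ} (hn : 1 ≤ n)
    (hZ : ∀ᶠ s in 𝓝 t, (γ s ^ n * h (γ s)).re = 0) :
    (deriv γ t ^ n * h 0).re = 0 ∧
    n * (deriv γ t ^ n * h 0).im * signedCurvature γ t * ‖deriv γ t‖ =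
      2 * (deriv γ t ^ (n + 1) * deriv h 0).re := by
  obtain ⟨h1, h2⟩ := curve_expansion (hγ.1 t trivial) h0 hh hZ
  refine ⟨h1, ?_⟩
  have hτ := hγ.2 t
  unfold signedCurvature
  set τ := deriv γ t
  set β := deriv (deriv γ) t
  set T := ‖τ‖ with hT
  have hT0 : 0 < T := norm_pos_iff.2 hτ
  set μ := (τ ^ n * h 0).im with hμ
  have h3 : τ ^ n * h 0 = μ * Complex.I := by
    apply Complex.ext
    · rw [h1]; simp
    · simp [hμ]
  -- As τ^n h(0) = iμ, this term is (nμ/2) i β/τ, with real part -(nμ/2) Im(β/τ), and Im(β/τ) is the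
  -- signed curvature times |τ|.
  have h4 : n * τ ^ (n - 1) * (β / 2) * h 0 = ((n * μ / 2 : ℝ) : ℂ) * (Complex.I * (β / τ)) := by
    have : τ ^ n = τ ^ (n - 1) * τ := by rw [← pow_succ, Nat.sub_add_cancel hn]
    rw [this] at h3
    have h5 : τ ^ (n - 1) * h 0 = μ * Complex.I / τ := by
      rw [eq_div_iff hτ, ← h3]; ring
    calc n * τ ^ (n - 1) * (β / 2) * h 0 = n * (β / 2) * (τ ^ (n - 1) * h 0) := by ring
      _ = _ := by rw [h5]; push_cast; ring
  have h5 : τ ^ n * (deriv h 0 * τ) = τ ^ (n + 1) * deriv h 0 := by ring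
  rw [h4, h5, Complex.add_re, Complex.re_ofReal_mul, Complex.I_mul_re, Complex.div_im,
    Complex.normSq_eq_norm_sq] at h2
  have h6 : ((τ.re * β.im - τ.im * β.re) / T ^ 3) * T =
      (β.im * τ.re / T ^ 2 - β.re * τ.im / T ^ 2) := by
    field_simp
  rw [mul_assoc, h6]
  rw [← hT] at h2
  linarith

/-- Measure the angles from the tangent, y_k = θ_k - arg τ. Since τ^n h(0) is imaginary, the sum of
exponentials contributes Σ sin y_k, and the error admitted by the coefficient inequality contributes
2 |sin(Σ y_k / 2)|. -/
lemma curvature_le_trigonometric_sum {γ : ℝ → ℂ} {t r : ℝ} (hγ : IsRegularAnalytic γ)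
    (h0 : γ t = 0) {h : ℂ → ℂ} (hh : AnalyticAt ℂ h 0) (hh0 : h 0 ≠ 0) (hr : 0 < r) {n : ℕ}
    (hn : 1 ≤ n) (hZ : ∀ᶠ s in 𝓝 t, (γ s ^ n * h (γ s)).re = 0) {θ : ℕ → ℝ}
    (hθ : ‖(r : ℂ) * deriv h 0 - h 0 * ∑ k ∈ Finset.range (2 * n), Complex.exp (-θ k * Complex.I)‖ ≤
      2 * |(Complex.exp ((∑ k ∈ Finset.range (2 * n), θ k : ℝ) / 2 * Complex.I) * h 0).re|) :
    ∃ y : ℕ → ℝ, n * r * |signedCurvature γ t| ≤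
      2 * (|∑ k ∈ Finset.range (2 * n), Real.sin (y k)| +
        2 * |Real.sin ((∑ k ∈ Finset.range (2 * n), y k) / 2)|) := by
  obtain ⟨h1, h2⟩ := signedCurvature_eq hγ h0 hh hn hZ
  have hτ := hγ.2 t
  set κ := signedCurvature γ t
  set τ := deriv γ t
  set T := ‖τ‖ with hT
  have hT0 : 0 < T := norm_pos_iff.2 hτ
  set μ := (τ ^ n * h 0).im with hμ
  have h3 : τ ^ n * h 0 = μ * Complex.I := by
    apply Complex.ext
    · rw [h1]; simp
    · simp [hμ]
  have hμ0 : μ ≠ 0 := by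
    intro h
    rw [h, Complex.ofReal_zero, zero_mul] at h3
    exact mul_ne_zero (pow_ne_zero _ hτ) hh0 h3
  set α := τ.arg with hα
  have hτe : τ = T * Complex.exp (α * Complex.I) := (Complex.norm_mul_exp_arg_mul_I τ).symm
  set s := ∑ k ∈ Finset.range (2 * n), Complex.exp (-θ k * Complex.I) with hs
  set E := (r : ℂ) * deriv h 0 - h 0 * s with hE
  set σ := ∑ k ∈ Finset.range (2 * n), θ k with hσ
  refine ⟨fun k => θ k - α, ?_⟩
  have hsum : (∑ k ∈ Finset.range (2 * n), (θ k - α)) / 2 = σ / 2 - n * α := by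
    rw [Finset.sum_sub_distrib, Finset.sum_const, Finset.card_range, nsmul_eq_mul]
    push_cast
    ring
  rw [hsum]
  have hE1 : |(Complex.exp (σ / 2 * Complex.I) * h 0).re| * T ^ n = |μ| * |Real.sin (σ / 2 - n * α)| := by
    have h4 : Complex.exp (σ / 2 * Complex.I) * h 0 * ((T ^ n : ℝ) : ℂ) =
        μ * (Complex.I * Complex.exp ((σ / 2 - n * α : ℝ) * Complex.I)) := by
      have h5 : Complex.exp (n * α * Complex.I) ≠ 0 := Complex.exp_ne_zero _
      have h6 : Complex.exp ((σ / 2 - n * α : ℝ) * Complex.I) * Complex.exp (n * α * Complex.I) =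
          Complex.exp (σ / 2 * Complex.I) := by
        rw [← Complex.exp_add]; congr 1; push_cast; ring
      have h7 : (T : ℂ) ^ n * Complex.exp (n * α * Complex.I) * h 0 = μ * Complex.I := by
        rw [← h3, hτe, mul_pow, ← Complex.exp_nat_mul, mul_assoc (n : ℂ)]
      apply mul_right_cancel₀ h5
      rw [← h6, Complex.ofReal_pow]
      linear_combination Complex.exp ((σ / 2 - n * α : ℝ) * Complex.I) *
        Complex.exp (n * α * Complex.I) * h7
    have h5 := congrArg Complex.re h4
    rw [Complex.re_mul_ofReal, Complex.re_ofReal_mul, Complex.I_mul_re,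
      Complex.exp_ofReal_mul_I_im] at h5
    have h6 := congrArg abs h5
    rw [abs_mul, abs_mul, abs_neg, abs_of_pos (pow_pos hT0 n)] at h6
    exact h6
  have hmain : n * μ * κ * T * r = 2 * ((τ ^ n * h 0 * (τ * s)).re + (τ ^ (n + 1) * E).re) := by
    have h4 : τ ^ n * h 0 * (τ * s) + τ ^ (n + 1) * E = (r : ℂ) * (τ ^ (n + 1) * deriv h 0) := by
      rw [hE]; ring
    rw [← Complex.add_re, h4, Complex.re_ofReal_mul, h2]
    ring
  have hA : (τ ^ n * h 0 * (τ * s)).re =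
      μ * T * ∑ k ∈ Finset.range (2 * n), Real.sin (θ k - α) := by
    rw [h3, hs, hτe, Finset.mul_sum, mul_assoc, Complex.re_ofReal_mul, Complex.I_mul_re,
      Complex.im_sum, mul_assoc, Finset.mul_sum, ← Finset.sum_neg_distrib]
    congr 1
    refine Finset.sum_congr rfl fun k _ => ?_
    rw [mul_assoc, ← Complex.exp_add, Complex.im_ofReal_mul, ← add_mul]
    have : (α : ℂ) + -θ k = ((-(θ k - α) : ℝ) : ℂ) := by push_cast; ring
    rw [this, Complex.exp_ofReal_mul_I_im, Real.sin_neg]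
    ring
  have hB : |(τ ^ (n + 1) * E).re| ≤ 2 * (|μ| * T * |Real.sin (σ / 2 - n * α)|) := by
    refine (Complex.abs_re_le_norm _).trans ?_
    rw [norm_mul, norm_pow, ← hT, pow_succ]
    calc T ^ n * T * ‖E‖ ≤ T ^ n * T * (2 * |(Complex.exp (σ / 2 * Complex.I) * h 0).re|) :=
          mul_le_mul_of_nonneg_left hθ (by positivity)
      _ = 2 * T * (|(Complex.exp (σ / 2 * Complex.I) * h 0).re| * T ^ n) := by ring
      _ = _ := by rw [hE1]; ring
  have hfin : |μ| * T * (n * r * |κ|) ≤ |μ| * T * (2 * (|∑ k ∈ Finset.range (2 * n),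
      Real.sin (θ k - α)| + 2 * |Real.sin (σ / 2 - n * α)|)) := by
    have h4 : |μ| * T * (n * r * |κ|) = |n * μ * κ * T * r| := by
      rw [abs_mul, abs_mul, abs_mul, abs_mul, abs_of_pos hr, abs_of_pos hT0, Nat.abs_cast]
      ring
    rw [h4, hmain, abs_mul, abs_two]
    have h5 := abs_add_le (τ ^ n * h 0 * (τ * s)).re (τ ^ (n + 1) * E).re
    rw [hA, abs_mul, abs_mul, abs_of_pos hT0] at h5
    rw [hA]
    linarith
  exact le_of_mul_le_mul_left hfin (mul_pos (abs_pos.2 hμ0) hT0)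

end Curvature

/-! ### The upper bounds -/

section UpperBound

lemma nodalSet_congr {r : ℝ} {u v : ℂ → ℝ} (h : EqOn u v (Metric.ball 0 r)) :
    nodalSet r u = nodalSet r v := by
  ext z
  exact and_congr_right fun hz => by rw [h hz]

lemma isNodalCurve_congr {r : ℝ} {u v : ℂ → ℝ} (h : EqOn u v (Metric.ball 0 r)) {Γ : Set ℂ} :
    IsNodalCurve r u Γ ↔ IsNodalCurve r v Γ := by
  unfold IsNodalCurve
  rw [nodalSet_congr h]

lemma IsAdmissible.exists_holo {n : ℕ} {r : ℝ} (hr : 0 < r) {u : ℂ → ℝ} (hu : IsAdmissible n r u) :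
    ∃ f : ℂ → ℂ, IsNonconstHolo r f ∧ f 0 = 0 ∧ EqOn (fun z => (f z).re) u (Metric.ball 0 r) := by
  obtain ⟨F, hF, hFu⟩ := hu.harmonic.exists_analyticOnNhd_ball_re_eq
  have h0 : (0 : ℂ) ∈ Metric.ball (0 : ℂ) r := Metric.mem_ball_self hr
  have hF0 : (F 0).re = 0 := (hFu h0).trans hu.map_zero
  have hre : EqOn (fun z => (F z - F 0).re) u (Metric.ball 0 r) := fun z hz => by
    have := hFu hz
    simp only [Complex.sub_re, hF0, sub_zero]
    exact this
  refine ⟨fun z => F z - F 0, ⟨fun z hz => (hF z hz).sub analyticAt_const, fun p hp hc => ?_⟩,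
    sub_self _, hre⟩
  have h1 := AnalyticOnNhd.eqOn_of_preconnected_of_eventuallyEq
    (fun z hz => (hF z hz).sub (analyticAt_const (v := F 0)))
    (analyticOnNhd_const (v := F p - F 0)) (convex_ball (0 : ℂ) r).isPreconnected hp hc
  refine hu.nonconst ⟨(F p - F 0).re, fun z hz => ?_⟩
  rw [← hre hz]
  exact congrArg Complex.re (h1 hz)

theorem IsAdmissible.curvature_le {n : ℕ} (hn : 1 ≤ n) {r : ℝ} (hr : 0 < r) {u : ℂ → ℝ}
    (hu : IsAdmissible n r u) {Γ : Set ℂ} (hΓ : IsNodalCurve r u Γ) {κ : ℝ}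
    (hκ : HasCurvatureAt Γ 0 κ) :
    ∃ y : ℕ → ℝ, n * r * |κ| ≤ 2 * (|∑ k ∈ Finset.range (2 * n), Real.sin (y k)| +
        2 * |Real.sin ((∑ k ∈ Finset.range (2 * n), y k) / 2)|) := by
  obtain ⟨f, hf, hf0, hfu⟩ := hu.exists_holo hr
  have h0re : (f 0).re = 0 := by rw [hf0]; rfl
  have ht : CurvesThroughZero r f := fun I σ hσ hI =>
    hu.through_zero _ ((isNodalCurve_congr hfu).1 (hf.isNodalCurve_of_max hσ hI))
  obtain ⟨m, ε, ψ, φ, hc⟩ := hf.exists_powerChart (Metric.mem_ball_self hr)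
  -- The order of f at 0 is the number of nodal curves, because all of them pass through 0.
  have hmn : m = n := by
    have h1 := hf.encard_nodal ht hc h0re
    simp_rw [isNodalCurve_congr hfu] at h1
    rw [hu.card_nodal] at h1
    exact_mod_cast h1.symm
  subst hmn
  obtain ⟨h, hh, hh0, hfh⟩ := hc.exists_eq_pow_mul hf.analytic hf0
  obtain ⟨g, hg, hlim⟩ := hu.boundary
  have hball : ∀ᶠ ρ in 𝓝[<] r, ∀ x, circleMap 0 ρ x ∈ Metric.ball (0 : ℂ) r := by
    filter_upwards [Ioo_mem_nhdsLT hr] with ρ hρ x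
    rw [mem_ball_zero_iff, norm_circleMap_zero, abs_of_pos hρ.1]; exact hρ.2
  have hrad : ∀ᵐ x : ℝ, x ∈ Ioo 0 (2 * Real.pi) →
      Tendsto (fun ρ => (f (circleMap 0 ρ x)).re) (𝓝[<] r) (𝓝 (g x)) := by
    filter_upwards [ae_tendsto_radial hr hu.harmonic hg hlim] with x hx hxI
    refine (hx hxI).congr' ?_
    filter_upwards [hball] with ρ hρ using (hfu (hρ x)).symm
  obtain ⟨θ, e, he, hsign⟩ := hf.exists_sign_product_boundary ht hr hc h0re hrad
  have hlim' : Tendsto (fun ρ : ℝ => ∫ x in (0 : ℝ)..(2 * Real.pi),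
      |(f (circleMap 0 ρ x)).re - g x|) (𝓝[<] r) (𝓝 0) := by
    refine hlim.congr' ?_
    filter_upwards [hball] with ρ hρ
    refine intervalIntegral.integral_congr fun x _ => ?_
    have := hfu (hρ x)
    simp only at this ⊢
    rw [this]
  have hcoef := coefficient_inequality hr hh hfh hg hlim' he hsign
  obtain ⟨γ, hγ, hγΓ, t, hγt, rfl⟩ := hκ
  refine curvature_le_trigonometric_sum hγ hγt (hh 0 (Metric.mem_ball_self hr)) hh0 hr hn
    (Eventually.of_forall fun s => ?_) hcoef
  have h1 : γ s ∈ nodalSet r u := hΓ.1.2 (hγΓ ▸ mem_range_self s)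
  rw [← hfh _ h1.1]
  exact (hfu h1.1).trans h1.2

theorem isCurvatureBound {n : ℕ} (hn : 1 ≤ n) {r : ℝ} (hr : 0 < r) :
    IsCurvatureBound n r (4 * ((n : ℝ) + 1) / ((n : ℝ) * r)) := by
  intro u hu Γ hΓ κ hκ
  obtain ⟨y, hy⟩ := hu.curvature_le hn hr hΓ hκ
  have hn0 : (0 : ℝ) < n := by positivity
  rw [le_div_iff₀ (by positivity)]
  -- The general bound only estimates every sine by 1.
  have h1 : |∑ k ∈ Finset.range (2 * n), Real.sin (y k)| ≤ 2 * n := by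
    refine (Finset.abs_sum_le_sum_abs _ _).trans ?_
    refine (Finset.sum_le_sum fun k _ => Real.abs_sin_le_one (y k)).trans ?_
    rw [Finset.sum_const, Finset.card_range, nsmul_eq_mul]
    push_cast
    linarith
  have h2 := Real.abs_sin_le_one ((∑ k ∈ Finset.range (2 * n), y k) / 2)
  linarith

theorem isCurvatureBound_of_even {n : ℕ} (hn : 1 ≤ n) (he : Even n) {r : ℝ} (hr : 0 < r) :
    IsCurvatureBound n r
      (4 * ((n : ℝ) + 1) / ((n : ℝ) * r) * Real.cos (Real.pi / (2 * ((n : ℝ) + 1)))) := by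
  intro u hu Γ hΓ κ hκ
  obtain ⟨y, hy⟩ := hu.curvature_le hn hr hΓ hκ
  have hn0 : (0 : ℝ) < n := by positivity
  have hn2 : 2 ≤ n := by obtain ⟨l, hl⟩ := he; omega
  rw [div_mul_eq_mul_div, le_div_iff₀ (by positivity)]
  have := sum_sin_le_of_even hn2 he y
  linarith

end UpperBound

/-! ### A criterion for all nodal curves to reach 0 -/

namespace IsNonconstHolo

variable {r : ℝ} {f : ℂ → ℂ}

lemma exists_uniform_time_of_isCompact (hf : IsNonconstHolo r f) {K : Set ℂ} (hK : IsCompact K)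
    (hKZ : K ⊆ reZeros r f) :
    ∃ η > 0, ∀ I σ, IsMaxUnitCurve (reZeros r f) I σ → ∀ t ∈ I, σ t ∈ K →
      Icc (t - η) (t + η) ⊆ I := by
  refine hK.induction_on (p := fun K => ∃ η > 0, ∀ I σ, IsMaxUnitCurve (reZeros r f) I σ →
    ∀ t ∈ I, σ t ∈ K → Icc (t - η) (t + η) ⊆ I) ?_ ?_ ?_ ?_
  · exact ⟨1, one_pos, fun I σ _ t _ h => h.elim⟩
  · rintro s t hst ⟨η, hη, h⟩
    exact ⟨η, hη, fun I σ hσ x hx hxs => h I σ hσ x hx (hst hxs)⟩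
  · rintro s t ⟨η, hη, h⟩ ⟨η', hη', h'⟩
    refine ⟨min η η', lt_min hη hη', fun I σ hσ x hx hxs => ?_⟩
    rcases hxs with hxs | hxs
    · refine (Icc_subset_Icc ?_ ?_).trans (h I σ hσ x hx hxs) <;>
        linarith [min_le_left η η']
    · refine (Icc_subset_Icc ?_ ?_).trans (h' I σ hσ x hx hxs) <;>
        linarith [min_le_right η η']
  · intro p hp
    obtain ⟨η, hη, V, hV, h⟩ := hf.exists_uniform_time (hKZ hp)
    exact ⟨V, mem_nhdsWithin_of_mem_nhds hV, η, hη, h⟩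

/-- Along a nodal curve the distance from `0` changes at the speed `Re G / |G|`, where
`G = z f' / f`. -/
lemma abs_re_conj_mul_deriv (hf : IsNonconstHolo r f) {I : Set ℝ} {σ : ℝ → ℂ}
    (h : IsUnitCurve (reZeros r f) I σ) {t : ℝ} (ht : t ∈ I) {g : ℂ} (hg : 0 < g.re)
    (hgf : g * f (σ t) = σ t * deriv f (σ t)) (hf0 : f (σ t) ≠ 0) :
    |((starRingEnd ℂ) (σ t) * deriv σ t).re| = ‖σ t‖ * (g.re / ‖g‖) := by
  set z := σ t
  set d := deriv σ t
  have hd : ‖d‖ = 1 := h.unit t ht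
  have h1 : (f z).re = 0 := (h.maps t ht).2
  have h2 := hf.re_deriv_mul_eq_zero h ht
  -- On the nodal set f and its derivative along the curve are both imaginary, so their quotient A
  -- is real and g σ' = A σ.
  have h3 := div_im_eq_zero_of_re_eq_zero h2 h1
  obtain ⟨A, hA⟩ : ∃ A : ℝ, deriv f z * d / f z = A := ⟨_, (Complex.ext rfl (by simpa using h3))⟩
  have hA' : deriv f z * d = A * f z := (div_eq_iff hf0).1 hA
  have hgd : g * d = A * z := by
    apply mul_right_cancel₀ hf0
    linear_combination d * hgf + z * hA'
  have hg0 : g ≠ 0 := by rintro rfl; simp at hg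
  have hgn : 0 < ‖g‖ := norm_pos_iff.2 hg0
  have hn : ‖g‖ = |A| * ‖z‖ := by
    have := congrArg norm hgd
    rwa [norm_mul, norm_mul, hd, mul_one, Complex.norm_real, Real.norm_eq_abs] at this
  have h4 : (starRingEnd ℂ) z * d * (Complex.normSq g : ℂ) =
      (A * ‖z‖ ^ 2 : ℝ) * (starRingEnd ℂ) g := by
    rw [← Complex.mul_conj]
    push_cast
    rw [← Complex.mul_conj']
    linear_combination (starRingEnd ℂ) z * (starRingEnd ℂ) g * hgd
  have h5 := congrArg Complex.re h4
  rw [Complex.re_mul_ofReal, Complex.re_ofReal_mul, Complex.conj_re, Complex.normSq_eq_norm_sq]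
    at h5
  have h6 := congrArg abs h5
  rw [abs_mul, abs_mul, abs_mul, abs_of_pos hg, abs_of_pos (pow_pos hgn 2),
    abs_of_nonneg (pow_nonneg (norm_nonneg z) 2)] at h6
  rw [← mul_left_inj' (pow_pos hgn 2).ne', h6]
  field_simp
  rw [hn]; ring

/-- If `Re (z f' / f) > 0` on the nodal set, the distance from `0` has no critical points on the
nodal curves, and they all reach `0`. -/
theorem curvesThroughZero (hf : IsNonconstHolo r f) {G : ℂ → ℂ}
    (hG : ContinuousOn G (Metric.ball 0 r))
    (hGf : ∀ z ∈ Metric.ball (0 : ℂ) r, G z * f z = z * deriv f z)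
    (hf0 : ∀ z ∈ Metric.ball (0 : ℂ) r, f z = 0 → z = 0)
    (hpos : ∀ z ∈ reZeros r f, 0 < (G z).re) : CurvesThroughZero r f := by
  intro I σ hσ hI
  by_contra h0
  have hne : ∀ {J : Set ℝ} {ρ : ℝ → ℂ}, ρ '' J = σ '' I → ∀ t ∈ J, ρ t ≠ 0 :=
    fun hJ t ht h => h0 (hJ ▸ ⟨t, ht, h⟩)
  -- the orientation is chosen so that the curve approaches `0`
  obtain ⟨J, ρ, hρ, hρ0, ⟨t₀, ht₀⟩, hneg⟩ : ∃ (J : Set ℝ) (ρ : ℝ → ℂ),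
      IsMaxUnitCurve (reZeros r f) J ρ ∧ (∀ t ∈ J, ρ t ≠ 0) ∧ J.Nonempty ∧
      ∀ t ∈ J, ((starRingEnd ℂ) (ρ t) * deriv ρ t).re < 0 := by
    have hcont : ContinuousOn (fun t => ((starRingEnd ℂ) (σ t) * deriv σ t).re) I := by
      intro t ht
      have h1 := (hσ.analytic t ht).continuousAt
      have h2 := (hσ.analytic t ht).deriv.continuousAt
      exact (Complex.continuous_re.continuousAt.comp
        ((Complex.continuous_conj.continuousAt.comp h1).mul h2)).continuousWithinAt
    have hnz : ∀ t ∈ I, ((starRingEnd ℂ) (σ t) * deriv σ t).re ≠ 0 := by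
      intro t ht
      have hm := hσ.maps t ht
      have hg := hpos _ hm
      rw [← abs_pos, hf.abs_re_conj_mul_deriv hσ.toIsUnitCurve ht hg (hGf _ hm.1)
        fun h => hne rfl t ht (hf0 _ hm.1 h)]
      have h1 : G (σ t) ≠ 0 := by intro h; rw [h] at hg; simp at hg
      exact mul_pos (norm_pos_iff.2 (hne rfl t ht)) (div_pos hg (norm_pos_iff.2 h1))
    obtain ⟨t₁, ht₁⟩ := hI
    rcases lt_or_gt_of_ne (hnz t₁ ht₁) with hlt | hgt
    · refine ⟨I, σ, hσ, hne rfl, ⟨t₁, ht₁⟩, fun t ht => ?_⟩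
      by_contra hge
      obtain ⟨s, hs, hs0⟩ := hσ.preconn.intermediate_value ht₁ ht hcont ⟨hlt.le, not_lt.1 hge⟩
      exact hnz s hs hs0
    · have he : (-1 : ℝ) = 1 ∨ (-1 : ℝ) = -1 := Or.inr rfl
      refine ⟨_, _, hσ.comp_affine he 0, fun t ht => hne rfl _ ht, ⟨-t₁, by simpa using ht₁⟩,
        fun t ht => ?_⟩
      rw [(hσ.toIsUnitCurve.comp_affine he 0).2 t ht]
      have ht' : -1 * t + 0 ∈ I := ht
      have : 0 < ((starRingEnd ℂ) (σ (-1 * t + 0)) * deriv σ (-1 * t + 0)).re := by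
        by_contra hge
        obtain ⟨s, hs, hs0⟩ := hσ.preconn.intermediate_value ht' ht₁ hcont
          ⟨not_lt.1 hge, hgt.le⟩
        exact hnz s hs hs0
      have e : (starRingEnd ℂ) (σ (-1 * t + 0)) * (((-1 : ℝ) : ℂ) * deriv σ (-1 * t + 0)) =
        -((starRingEnd ℂ) (σ (-1 * t + 0)) * deriv σ (-1 * t + 0)) := by push_cast; ring
      rw [e, Complex.neg_re]
      linarith
  -- The distance from 0 decreases, so the curve stays in this compact part of the nodal set. There
  -- it continues for a uniform time η, and hence for all times after t₀.
  set K : Set ℂ := Metric.closedBall 0 ‖ρ t₀‖ ∩ {z | (f z).re = 0} with hKdef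
  have hsub : Metric.closedBall (0 : ℂ) ‖ρ t₀‖ ⊆ Metric.ball 0 r :=
    Metric.closedBall_subset_ball (by simpa using (hρ.maps t₀ ht₀).1)
  have hK : IsCompact K := by
    refine (isCompact_closedBall (0 : ℂ) ‖ρ t₀‖).of_isClosed_subset ?_ inter_subset_left
    have h1 : ContinuousOn (fun z => (f z).re) (Metric.closedBall 0 ‖ρ t₀‖) :=
      Complex.continuous_re.comp_continuousOn (hf.analytic.continuousOn.mono hsub)
    exact h1.preimage_isClosed_of_isClosed Metric.isClosed_closedBall isClosed_singleton
  have hKZ : K ⊆ reZeros r f := fun z hz => ⟨hsub hz.1, hz.2⟩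
  obtain ⟨η, hη, htime⟩ := hf.exists_uniform_time_of_isCompact hK hKZ
  have hG0 : ∀ z ∈ K, G z ≠ 0 := fun z hz h => by
    have := hpos z (hKZ hz)
    rw [h] at this; simp at this
  obtain ⟨z₁, hz₁, hmin⟩ := hK.exists_isMinOn (f := fun z => (G z).re / ‖G z‖)
    ⟨ρ t₀, by simp, (hρ.maps t₀ ht₀).2⟩ (by
      have h1 := hG.mono (inter_subset_left.trans hsub : K ⊆ _)
      exact (Complex.continuous_re.comp_continuousOn h1).div h1.norm
        fun z hz => norm_ne_zero_iff.2 (hG0 z hz))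
  -- By compactness the distance decreases at least at the speed c > 0.
  set c := (G z₁).re / ‖G z₁‖ with hc
  have hc0 : 0 < c := div_pos (hpos _ (hKZ hz₁)) (norm_pos_iff.2 (hG0 _ hz₁))
  have hd : ∀ t ∈ J, HasDerivAt (fun t => ‖ρ t‖)
      (((starRingEnd ℂ) (ρ t) * deriv ρ t).re / ‖ρ t‖) t := by
    intro t ht
    have h1 := (hρ.analytic t ht).differentiableAt.hasDerivAt.norm_sq
    have h2 := h1.sqrt (pow_ne_zero 2 (norm_ne_zero_iff.2 (hρ0 t ht)))
    simp only [Real.sqrt_sq (norm_nonneg _), Complex.inner] at h2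
    refine h2.congr_deriv ?_
    rw [mul_div_mul_left _ _ two_ne_zero, mul_comm]
  have hconv : Convex ℝ J := hρ.preconn.ordConnected.convex
  have hcontn : ContinuousOn (fun t => ‖ρ t‖) J := fun t ht =>
    (hd t ht).continuousAt.continuousWithinAt
  have hanti : AntitoneOn (fun t => ‖ρ t‖) J := by
    refine antitoneOn_of_deriv_nonpos hconv hcontn
      (fun t ht => (hd t (interior_subset ht)).differentiableAt.differentiableWithinAt)
      fun t ht => ?_
    rw [(hd t (interior_subset ht)).deriv]
    exact div_nonpos_of_nonpos_of_nonneg (hneg t (interior_subset ht)).le (norm_nonneg _)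
  have hinK : ∀ t ∈ J, t₀ ≤ t → ρ t ∈ K := fun t ht h =>
    ⟨by simpa using hanti ht₀ ht h, (hρ.maps t ht).2⟩
  have hall : ∀ k : ℕ, t₀ + k * η ∈ J := by
    intro k
    induction k with
    | zero => simpa using ht₀
    | succ k ih =>
      refine htime J ρ hρ _ ih (hinK _ ih (by nlinarith [k.cast_nonneg (α := ℝ)])) ⟨?_, ?_⟩ <;>
        push_cast <;> linarith
  have hIci : Ici t₀ ⊆ J := by
    intro t ht
    obtain ⟨k, hk⟩ := exists_nat_ge ((t - t₀) / η)
    refine hρ.preconn.ordConnected.out ht₀ (hall k) ⟨ht, ?_⟩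
    rw [div_le_iff₀ hη] at hk
    linarith
  have hanti' : AntitoneOn (fun t => ‖ρ t‖ + c * t) (Ici t₀) := by
    have hd' : ∀ t ∈ Ici t₀, HasDerivAt (fun t => ‖ρ t‖ + c * t)
        (((starRingEnd ℂ) (ρ t) * deriv ρ t).re / ‖ρ t‖ + c * 1) t := fun t ht =>
      (hd t (hIci ht)).add ((hasDerivAt_id t).const_mul c)
    refine antitoneOn_of_deriv_nonpos (convex_Ici t₀)
      (fun t ht => (hd' t ht).continuousAt.continuousWithinAt)
      (fun t ht => (hd' t (interior_subset ht)).differentiableAt.differentiableWithinAt)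
      fun t ht => ?_
    have ht' := interior_subset ht
    rw [(hd' t ht').deriv]
    have htJ := hIci ht'
    have hm := hρ.maps t htJ
    have h1 := hf.abs_re_conj_mul_deriv hρ.toIsUnitCurve htJ (hpos _ hm) (hGf _ hm.1)
        fun h => hρ0 t htJ (hf0 _ hm.1 h)
    rw [abs_of_neg (hneg t htJ)] at h1
    have h2 : c ≤ (G (ρ t)).re / ‖G (ρ t)‖ := hmin (hinK t htJ ht')
    have h3 : ((starRingEnd ℂ) (ρ t) * deriv ρ t).re = -(‖ρ t‖ * ((G (ρ t)).re / ‖G (ρ t)‖)) := by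
      linarith
    rw [h3, neg_div, mul_div_cancel_left₀ _ (norm_ne_zero_iff.2 (hρ0 t htJ))]
    linarith
  -- By this time the distance would be at most -1.
  have hT : t₀ ≤ t₀ + (‖ρ t₀‖ + 1) / c := by
    have : 0 ≤ (‖ρ t₀‖ + 1) / c := by positivity
    linarith
  have h1 := hanti' self_mem_Ici hT hT
  simp only at h1
  have h2 : c * (t₀ + (‖ρ t₀‖ + 1) / c) = c * t₀ + (‖ρ t₀‖ + 1) := by field_simp
  rw [h2] at h1
  linarith [norm_nonneg (ρ (t₀ + (‖ρ t₀‖ + 1) / c))]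

end IsNonconstHolo

/-! ### Admissibility and curvature for functions of given order at 0 -/

lemma AnalyticAt.dslope_center {f : ℂ → ℂ} {p : ℂ} (hf : AnalyticAt ℂ f p) :
    AnalyticAt ℂ (dslope f p) p := by
  obtain ⟨q, hq⟩ := hf
  exact hq.has_fpower_series_dslope_fslope.analyticAt

/-- The exponent of a power chart at a zero is the order of the zero. -/
lemma IsPowerChart.eq_order {f h : ℂ → ℂ} {U : Set ℂ} {m n : ℕ} {ε : ℝ} {ψ φ : ℂ → ℂ}
    (hc : IsPowerChart f U 0 m ε ψ φ) (hf : AnalyticAt ℂ f 0) (hf0 : f 0 = 0)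
    (hh : AnalyticAt ℂ h 0) (hh0 : h 0 ≠ 0) (hfh : ∀ᶠ z in 𝓝 0, f z = z ^ n * h z) :
    m = n ∧ deriv φ 0 ^ n = h 0 := by
  have hD := hc.analyticAt_inv.dslope_center
  have hD0 : dslope φ 0 0 = deriv φ 0 := dslope_same _ _
  have h1 : ∀ᶠ z in 𝓝 0, f z = z ^ m * dslope φ 0 z ^ m := by
    filter_upwards [hc.right_inv] with z hz
    have h2 := hc.eq_pow _ hz.1
    rw [hz.2, hf0, zero_add] at h2
    have h3 := sub_smul_dslope φ 0 z
    rw [hc.inv_center, sub_zero, sub_zero, smul_eq_mul] at h3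
    rw [h2, ← h3, mul_pow]
  have h2 : analyticOrderAt f 0 = m := hf.analyticOrderAt_eq_natCast.2
    ⟨fun z => dslope φ 0 z ^ m, hD.pow m, by
      simpa only [hD0] using pow_ne_zero m hc.deriv_inv_ne_zero, by simpa using h1⟩
  have h3 : analyticOrderAt f 0 = n := hf.analyticOrderAt_eq_natCast.2
    ⟨h, hh, hh0, by simpa using hfh⟩
  obtain rfl : m = n := by
    rw [h2] at h3
    exact_mod_cast h3
  refine ⟨rfl, ?_⟩
  rw [← hD0]
  refine tendsto_nhds_unique_of_eventuallyEq (l := 𝓝[≠] (0 : ℂ))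
    ((hD.continuousAt.pow m).tendsto.mono_left nhdsWithin_le_nhds)
    (hh.continuousAt.tendsto.mono_left nhdsWithin_le_nhds) ?_
  filter_upwards [nhdsWithin_le_nhds h1, nhdsWithin_le_nhds hfh, self_mem_nhdsWithin]
    with z hz1 hz2 hz
  exact mul_left_cancel₀ (pow_ne_zero m hz) (hz1.symm.trans hz2)

/-- Continuity up to the circle and dominated convergence. This is what the dilation of the extremal
functions is for. -/
lemma hasL1BoundaryValue_re {f : ℂ → ℂ} {r R : ℝ} (hr : 0 < r) (hrR : r < R)
    (hf : AnalyticOnNhd ℂ f (Metric.ball 0 R)) :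
    HasL1BoundaryValue r fun z => (f z).re := by
  have hsub : Metric.closedBall (0 : ℂ) r ⊆ Metric.ball 0 R := Metric.closedBall_subset_ball hrR
  have hcont : ContinuousOn (fun z => (f z).re) (Metric.closedBall 0 r) :=
    Complex.continuous_re.comp_continuousOn (hf.continuousOn.mono hsub)
  have hmem : ∀ ρ ∈ Ioc 0 r, ∀ θ, circleMap 0 ρ θ ∈ Metric.closedBall (0 : ℂ) r := by
    intro ρ hρ θ
    simpa [abs_of_pos hρ.1] using hρ.2
  have hcc : ∀ ρ ∈ Ioc 0 r, Continuous fun θ => (f (circleMap 0 ρ θ)).re := fun ρ hρ =>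
    hcont.comp_continuous (continuous_circleMap 0 ρ) (hmem ρ hρ)
  obtain ⟨M, hM⟩ := (isCompact_closedBall (0 : ℂ) r).exists_bound_of_continuousOn hcont
  have hr' : r ∈ Ioc 0 r := ⟨hr, le_rfl⟩
  have hev : ∀ᶠ ρ in 𝓝[<] r, ρ ∈ Ioc 0 r := by
    filter_upwards [Ioo_mem_nhdsLT hr] with ρ hρ using ⟨hρ.1, hρ.2.le⟩
  refine ⟨fun θ => (f (circleMap 0 r θ)).re, (hcc r hr').intervalIntegrable _ _, ?_⟩
  have h0 : (∫ θ in (0 : ℝ)..(2 * Real.pi), (0 : ℝ)) = 0 := by simp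
  have hMM : IntervalIntegrable (fun _ : ℝ => M + M) MeasureTheory.volume 0 (2 * Real.pi) :=
    intervalIntegrable_const
  suffices h : Tendsto (fun ρ : ℝ => ∫ θ in (0 : ℝ)..(2 * Real.pi),
      |(f (circleMap 0 ρ θ)).re - (f (circleMap 0 r θ)).re|) (𝓝[<] r)
      (𝓝 (∫ θ in (0 : ℝ)..(2 * Real.pi), (0 : ℝ))) by rwa [h0] at h
  refine intervalIntegral.tendsto_integral_filter_of_dominated_convergence (fun _ => M + M)
    ?_ ?_ hMM (MeasureTheory.ae_of_all _ fun θ _ => ?_)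
  · filter_upwards [hev] with ρ hρ
    exact ((hcc ρ hρ).sub (hcc r hr')).abs.aestronglyMeasurable
  · filter_upwards [hev] with ρ hρ
    refine MeasureTheory.ae_of_all _ fun θ _ => ?_
    rw [Real.norm_eq_abs, abs_abs]
    exact (abs_sub _ _).trans (add_le_add (hM _ (hmem ρ hρ θ)) (hM _ (hmem r hr' θ)))
  · have h1 : ContinuousAt (fun ρ : ℝ => circleMap 0 ρ θ) r := by
      simp only [circleMap_zero]
      fun_prop
    have h2 : ContinuousAt (fun z => (f z).re) (circleMap 0 r θ) :=
      Complex.continuous_re.continuousAt.comp (hf _ (hsub (hmem r hr' θ))).continuousAt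
    have h3 : Tendsto (fun ρ : ℝ => (f (circleMap 0 ρ θ)).re) (𝓝[<] r)
        (𝓝 (f (circleMap 0 r θ)).re) :=
      (ContinuousAt.comp (f := fun ρ : ℝ => circleMap 0 ρ θ) h2 h1).tendsto.mono_left
        nhdsWithin_le_nhds
    simpa using (h3.sub_const (f (circleMap 0 r θ)).re).abs

lemma isNonconstHolo_of_order {f h : ℂ → ℂ} {r : ℝ} (hr : 0 < r) {n : ℕ} (hn : 1 ≤ n)
    (hf : AnalyticOnNhd ℂ f (Metric.ball 0 r)) (hh : AnalyticAt ℂ h 0) (hh0 : h 0 ≠ 0)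
    (hfh : ∀ᶠ z in 𝓝 0, f z = z ^ n * h z) : IsNonconstHolo r f := by
  refine ⟨hf, fun p hp hc => ?_⟩
  have h0 : (0 : ℂ) ∈ Metric.ball (0 : ℂ) r := Metric.mem_ball_self hr
  have h1 : EqOn f (fun _ => f p) (Metric.ball 0 r) :=
    hf.eqOn_of_preconnected_of_eventuallyEq analyticOnNhd_const
      (convex_ball (0 : ℂ) r).isPreconnected hp hc
  have h2 : f 0 = 0 := by
    rw [hfh.self_of_nhds, zero_pow (by omega), zero_mul]
  have h3 : ∀ᶠ z in 𝓝[≠] (0 : ℂ), False := by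
    filter_upwards [nhdsWithin_le_nhds hfh, self_mem_nhdsWithin,
      nhdsWithin_le_nhds (hh.continuousAt.eventually_ne hh0),
      nhdsWithin_le_nhds (Metric.ball_mem_nhds (0 : ℂ) hr)] with z hz1 hz2 hz3 hz4
    have h4 := (h1 hz4).trans (h1 h0).symm
    rw [h2, hz1] at h4
    exact mul_ne_zero (pow_ne_zero n hz2) hz3 h4
  exact h3.exists.elim fun _ h => h

namespace IsNonconstHolo

variable {r : ℝ} {f h : ℂ → ℂ} {n : ℕ}

theorem isAdmissible_re (hf : IsNonconstHolo r f) (ht : CurvesThroughZero r f) (hr : 0 < r)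
    {R : ℝ} (hrR : r < R) (hfR : AnalyticOnNhd ℂ f (Metric.ball 0 R)) (hf0 : f 0 = 0)
    (hh : AnalyticAt ℂ h 0) (hh0 : h 0 ≠ 0) (hfh : ∀ᶠ z in 𝓝 0, f z = z ^ n * h z) :
    IsAdmissible n r fun z => (f z).re := by
  have hmem : (0 : ℂ) ∈ Metric.ball (0 : ℂ) r := Metric.mem_ball_self hr
  have h0 : (f 0).re = 0 := by rw [hf0]; rfl
  refine ⟨fun z hz => (hf.analytic z hz).harmonicAt_re, ?_, hasL1BoundaryValue_re hr hrR hfR, h0,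
    ?_, fun Γ hΓ => ?_⟩
  · rintro ⟨c, hc⟩
    have hsub : closure (Metric.ball (0 : ℂ) (r / 2)) ⊆ Metric.ball 0 r :=
      Metric.closure_ball_subset_closedBall.trans (Metric.closedBall_subset_ball (by linarith))
    have hemp := hf.eq_empty_of_frontier Metric.isOpen_ball hsub fun z hz =>
      (hc z (hsub (frontier_subset_closure hz))).trans ((hc 0 hmem).symm.trans h0)
    exact (Metric.nonempty_ball.2 (half_pos hr)).ne_empty hemp
  · obtain ⟨m, ε, ψ, φ, hchart⟩ := hf.exists_powerChart hmem
    rw [hf.encard_nodal ht hchart h0, (hchart.eq_order (hf.analytic 0 hmem) hf0 hh hh0 hfh).1]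
  · obtain ⟨⟨⟨γ, hγ, rfl⟩, -⟩, -⟩ := id hΓ
    obtain ⟨I, σ, hσ, hI, him, -⟩ := hf.exists_max_of_isNodalCurve hγ hΓ 0
    exact him ▸ ht I σ hσ ⟨0, hI⟩

/-- The nodal curve with a given tangent at `0`, and its curvature. -/
theorem exists_nodal_curvature (hf : IsNonconstHolo r f) (hr : 0 < r) (hn : 1 ≤ n)
    (hf0 : f 0 = 0) (hh : AnalyticAt ℂ h 0) (hh0 : h 0 ≠ 0)
    (hfh : ∀ z ∈ Metric.ball (0 : ℂ) r, f z = z ^ n * h z)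
    {τ : ℂ} (hτ : ‖τ‖ = 1) (hτn : (τ ^ n * h 0).re = 0) :
    ∃ Γ, IsNodalCurve r (fun z => (f z).re) Γ ∧ ∃ κ, HasCurvatureAt Γ 0 κ ∧
      |κ| * (n * ‖h 0‖) = 2 * |(τ ^ (n + 1) * deriv h 0).re| := by
  have hmem : (0 : ℂ) ∈ Metric.ball (0 : ℂ) r := Metric.mem_ball_self hr
  have h0 : (f 0).re = 0 := by rw [hf0]; rfl
  obtain ⟨m, ε, ψ, φ, hc⟩ := hf.exists_powerChart hmem
  obtain ⟨rfl, hφ⟩ := hc.eq_order (hf.analytic 0 hmem) hf0 hh hh0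
    (by filter_upwards [Metric.ball_mem_nhds (0 : ℂ) hr] with z hz using hfh z hz)
  have hφ0 := hc.deriv_inv_ne_zero
  have hφn : (‖deriv φ 0‖ : ℂ) ≠ 0 := by exact_mod_cast norm_ne_zero_iff.2 hφ0
  have hψφ : deriv φ 0 * deriv ψ 0 = 1 := by
    have := hc.deriv_mul_deriv hc.zero_mem
    rwa [hc.map_zero] at this
  -- The direction τ read in the chart. Since φ'(0)^m = h(0), the condition on the m-th power of
  -- this direction is the hypothesis on τ.
  obtain ⟨I, σ, hσ, hI, hσ0, hdσ⟩ := hf.exists_max_of_direction hc h0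
    (v := deriv φ 0 * τ / ‖deriv φ 0‖) (by
      rw [norm_div, norm_mul, hτ, mul_one, Complex.norm_real, norm_norm,
        div_self (norm_ne_zero_iff.2 hφ0)]) (by
      rw [div_pow, mul_pow, hφ, mul_comm, ← Complex.ofReal_pow, Complex.div_ofReal_re, hτn,
        zero_div])
  have hdσ' : deriv σ 0 = τ := by
    have h1 : (‖deriv φ 0‖ : ℂ) * ‖deriv ψ 0‖ = 1 := by
      rw [← Complex.ofReal_mul, ← norm_mul, hψφ, norm_one, Complex.ofReal_one]
    have h2 : (‖deriv ψ 0‖ : ℂ) ≠ 0 := right_ne_zero_of_mul_eq_one h1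
    rw [hdσ]
    field_simp
    linear_combination τ * hψφ - τ * h1
  refine ⟨_, hf.isNodalCurve_of_max hσ ⟨0, hI⟩, ?_⟩
  obtain ⟨γ, hγ, hγr, hγt⟩ := hσ.toIsUnitCurve.isAnalyticCurveIn ⟨0, hI⟩
  obtain ⟨s, hs, c, hcs⟩ := hγt 0 hI
  rw [hσ0] at hs
  rw [hdσ'] at hcs
  refine ⟨_, ⟨γ, hγ, hγr, s, hs, rfl⟩, ?_⟩
  have hc0 : c ≠ 0 := by
    rintro rfl
    exact hγ.2 s (by rw [hcs]; simp)
  have hZ : ∀ x, γ x ∈ reZeros r f := fun x => by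
    have : γ x ∈ σ '' I := hγr ▸ mem_range_self x
    obtain ⟨t, ht, htx⟩ := this
    exact htx ▸ hσ.maps t ht
  obtain ⟨-, hk⟩ := signedCurvature_eq hγ hs hh hn
    (Eventually.of_forall fun x => hfh _ (hZ x).1 ▸ (hZ x).2)
  rw [hcs, mul_pow, mul_pow, ← Complex.ofReal_pow, ← Complex.ofReal_pow,
    mul_assoc _ (τ ^ m), mul_assoc _ (τ ^ (m + 1)), Complex.im_ofReal_mul, Complex.re_ofReal_mul, norm_mul, hτ, Complex.norm_real,
    Real.norm_eq_abs] at hk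
  have hk' := congrArg abs hk
  have h3 : |(τ ^ m * h 0).im| = ‖h 0‖ := by
    rw [Complex.abs_im_eq_norm.2 hτn, norm_mul, norm_pow, hτ, one_pow, one_mul]
  simp only [abs_mul, abs_pow, abs_abs, Nat.abs_cast, abs_two, mul_one, h3] at hk'
  have h4 : |c| ^ (m + 1) ≠ 0 := pow_ne_zero _ (abs_ne_zero.2 hc0)
  apply mul_left_cancel₀ h4
  linear_combination hk'

end IsNonconstHolo

/-! ### Angle estimates for the extremal function -/

/-- The difference of the two sides has derivative 4 s (s - (x/2) cos(x/2)) with s = sin(x/2), which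
is nonnegative because tan(x/2) ≥ x/2. -/
lemma three_mul_sin_le {x : ℝ} (h0 : 0 ≤ x) (hx : x ≤ Real.pi) :
    3 * Real.sin x ≤ (2 + Real.cos x) * x := by
  have hd : ∀ x : ℝ, HasDerivAt (fun x => (2 + Real.cos x) * x - 3 * Real.sin x)
      (2 - 2 * Real.cos x - x * Real.sin x) x := fun x =>
    ((((Real.hasDerivAt_cos x).const_add 2).mul (hasDerivAt_id x)).sub
      ((Real.hasDerivAt_sin x).const_mul 3)).congr_deriv (by simp only [id]; ring)
  have hmono : MonotoneOn (fun x => (2 + Real.cos x) * x - 3 * Real.sin x) (Icc 0 Real.pi) := by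
    refine monotoneOn_of_deriv_nonneg (convex_Icc _ _)
      (fun x _ => (hd x).continuousAt.continuousWithinAt)
      (fun x _ => (hd x).differentiableAt.differentiableWithinAt) fun x hx => ?_
    rw [interior_Icc] at hx
    rw [(hd x).deriv]
    have h1 : x / 2 < Real.pi / 2 := by linarith [hx.2]
    have h2 := Real.le_tan (by linarith [hx.1] : 0 ≤ x / 2) h1
    have hc : 0 < Real.cos (x / 2) := Real.cos_pos_of_mem_Ioo ⟨by linarith [hx.1], h1⟩
    have hs : 0 < Real.sin (x / 2) := Real.sin_pos_of_pos_of_lt_pi (by linarith [hx.1])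
      (by linarith)
    rw [Real.tan_eq_sin_div_cos, le_div_iff₀ hc] at h2
    have e1 : Real.cos x = 1 - 2 * Real.sin (x / 2) ^ 2 := by
      have := Real.cos_two_mul (x / 2)
      rw [mul_div_cancel₀ _ two_ne_zero] at this
      linarith [Real.sin_sq_add_cos_sq (x / 2)]
    have e2 : Real.sin x = 2 * Real.sin (x / 2) * Real.cos (x / 2) := by
      rw [← Real.sin_two_mul, mul_div_cancel₀ _ two_ne_zero]
    rw [e1, e2]
    nlinarith
  have := hmono ⟨le_rfl, Real.pi_pos.le⟩ ⟨h0, hx⟩ h0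
  simp only [mul_zero, Real.sin_zero, sub_zero] at this
  linarith

/-- The claim of `extremal_angle_bound` after replacing sin δ by δ(2 + c)/3. The expression is
affine in N, so its value at N = 2 and its slope suffice, or N = 1 when A = 0. With B = q² and |A| ≤
q, the worst cases in A are the ends ±q. -/
lemma extremal_polynomial_pos {N A B c : ℝ} (hN : 1 ≤ N) (hNA : 2 ≤ N ∨ A = 0) (hAB : A ^ 2 ≤ B)
    (hB : B ≤ 1) (hc1 : -1 ≤ c) :
    0 < 6 * N - 6 * A * c + 6 * B * c ^ 2 - 3 * B - 2 * N * (2 + c) * (A - B * c) := by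
  have hB0 : 0 ≤ B := (sq_nonneg A).trans hAB
  rcases hNA with h2 | rfl
  · obtain ⟨q, hq0, rfl⟩ : ∃ q : ℝ, 0 ≤ q ∧ B = q ^ 2 :=
      ⟨Real.sqrt B, Real.sqrt_nonneg B, (Real.sq_sqrt hB0).symm⟩
    have hq1 : q ≤ 1 := by nlinarith
    obtain ⟨hA1, hA2⟩ := abs_le.1 (abs_le_of_sq_le_sq hAB hq0)
    have hP0 : 0 < 6 - 2 * (2 + c) * (A - q ^ 2 * c) := by
      have h1 : 0 ≤ (q - A) * (2 + c) := mul_nonneg (by linarith) (by linarith)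
      have h3 : 0 < 6 - 2 * (2 + c) * (q - q ^ 2 * c) := by
        have e : 6 - 2 * (2 + c) * (q - q ^ 2 * c) =
          (1 - q) * (6 - 2 * (q * c) + 2 * (q * c) ^ 2) +
            q * (2 + 2 * (q * c) + 2 * (q * c) ^ 2) := by ring
        have h4 : 0 < 6 - 2 * (q * c) + 2 * (q * c) ^ 2 := by nlinarith [sq_nonneg (q * c - 1)]
        have h5 : 0 < 2 + 2 * (q * c) + 2 * (q * c) ^ 2 := by nlinarith [sq_nonneg (q * c + 1)]
        rw [e]
        rcases hq0.eq_or_lt with rfl | hq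
        · simp
        · nlinarith [mul_pos hq h5, mul_nonneg (sub_nonneg.2 hq1) h4.le]
      linarith
    have hP2 : 0 < 12 - 6 * A * c + 6 * q ^ 2 * c ^ 2 - 3 * q ^ 2 -
        4 * (2 + c) * (A - q ^ 2 * c) := by
      have h1 : 0 < 12 - 3 * q ^ 2 - 8 * q - 10 * (q * c) + 8 * q * (q * c) + 10 * (q * c) ^ 2 := by
        nlinarith [sq_nonneg (20 * (q * c) + 8 * q - 10)]
      have h3 : 0 < 12 - 3 * q ^ 2 + 8 * q + 10 * (q * c) + 8 * q * (q * c) +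
          10 * (q * c) ^ 2 := by
        nlinarith [sq_nonneg (20 * (q * c) + 8 * q + 10)]
      rcases le_total 0 (8 + 10 * c) with h4 | h4
      · nlinarith [mul_nonneg (sub_nonneg.2 hA2) h4]
      · nlinarith [mul_nonneg (by linarith : 0 ≤ A + q) (neg_nonneg.2 h4)]
    nlinarith [mul_nonneg (sub_nonneg.2 h2) hP0.le]
  · have e : 6 * N - 6 * 0 * c + 6 * B * c ^ 2 - 3 * B - 2 * N * (2 + c) * (0 - B * c) =
      (N - 1) * (6 + B * (2 * (c + 1) ^ 2 - 2)) + (6 - 7 / 2 * B + B * (8 * (c + 1 / 4) ^ 2)) := by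
      ring
    rw [e]
    have h1 : 0 ≤ B * (c + 1) ^ 2 := by positivity
    have h2 : 0 ≤ B * (8 * (c + 1 / 4) ^ 2) := by positivity
    have h3 : 0 ≤ (N - 1) * (6 + B * (2 * (c + 1) ^ 2 - 2)) :=
      mul_nonneg (by linarith) (by nlinarith)
    linarith

/-- In the application N = n, and the two expressions are n Re q and n Im q for the quantity q of
`re_pow_mul_pos`; the conclusion is the bound n · tan(arg q) < δ. -/
lemma extremal_angle_bound {N A B δ : ℝ} (hN : 1 ≤ N) (hNA : 2 ≤ N ∨ A = 0) (hAB : A ^ 2 ≤ B)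
    (hB : B ≤ 1) (hδ0 : 0 < δ) (hδ : δ < Real.pi) :
    0 < N - A * Real.cos δ + B / 2 * (2 * Real.cos δ ^ 2 - 1) ∧
    N * (Real.sin δ * (A - B * Real.cos δ)) <
      δ * (N - A * Real.cos δ + B / 2 * (2 * Real.cos δ ^ 2 - 1)) := by
  set c := Real.cos δ
  have hc1 : -1 ≤ c := Real.neg_one_le_cos δ
  have hc2 : c ≤ 1 := Real.cos_le_one δ
  have hB0 : 0 ≤ B := (sq_nonneg A).trans hAB
  have hX : 0 < N - A * c + B / 2 * (2 * c ^ 2 - 1) := by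
    rcases hNA with h2 | rfl
    · have hA : |A| ≤ 1 := abs_le_one_iff_mul_self_le_one.2 (by nlinarith)
      have h1 : A * c ≤ 1 := by
        refine (le_abs_self _).trans ?_
        rw [abs_mul]
        exact mul_le_one₀ hA (abs_nonneg _) (abs_le.2 ⟨hc1, hc2⟩)
      nlinarith
    · nlinarith
  refine ⟨hX, ?_⟩
  have hs : 0 < Real.sin δ := Real.sin_pos_of_pos_of_lt_pi hδ0 hδ
  rcases le_or_gt (A - B * c) 0 with h | h
  · have h1 : N * (Real.sin δ * (A - B * c)) ≤ 0 :=
      mul_nonpos_of_nonneg_of_nonpos (by linarith) (mul_nonpos_of_nonneg_of_nonpos hs.le h)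
    exact h1.trans_lt (mul_pos hδ0 hX)
  · have h1 := three_mul_sin_le hδ0.le hδ.le
    have h2 := extremal_polynomial_pos hN hNA hAB hB hc1
    nlinarith

/-- For a positive argument, arg q ≤ tan(arg q) = Im q / Re q. -/
lemma mul_arg_lt {N δ : ℝ} (hN : 0 < N) (hδ : 0 < δ) {q : ℂ} (hq : 0 < q.re)
    (h : N * q.im < δ * q.re) : N * q.arg < δ := by
  rcases le_or_gt q.im 0 with h0 | h0
  · rcases h0.eq_or_lt with h1 | h1
    · rw [Complex.arg_eq_zero_iff.2 ⟨hq.le, h1⟩]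
      simpa using hδ
    · have := Complex.arg_neg_iff.2 h1
      nlinarith
  · have h1 : |q.arg| < Real.pi / 2 := Complex.abs_arg_lt_pi_div_two_iff.2 (Or.inl hq)
    have h2 : q.arg ≤ Real.tan q.arg :=
      Real.le_tan (Complex.arg_nonneg_iff.2 h0.le) (lt_of_abs_lt h1)
    rw [Complex.tan_arg, le_div_iff₀ hq] at h2
    by_contra h4
    nlinarith [mul_le_mul_of_nonneg_right (not_lt.1 h4) hq.le]

/-- The angle estimate for the extremal function near the point where it vanishes on the circle. -/
lemma re_pow_mul_pos {n : ℕ} (hn : 1 ≤ n) {κ : ℝ} (hκ : 2 * n * κ ^ 2 ≤ 1)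
    (hnκ : 2 ≤ n ∨ κ = 0) {V : ℂ} (hV : 0 < V.re) (hVn : (2 * n + 1) * ‖V‖ ^ 2 ≤ 1) :
    0 < ((1 + 2 * Complex.I * κ * V - V ^ 2) ^ n * V).re := by
  have hV0 : V ≠ 0 := by rintro rfl; simp at hV
  have hs : 0 < ‖V‖ := norm_pos_iff.2 hV0
  set s := ‖V‖ with hsdef
  -- The angle between V and the positive imaginary axis. The claim amounts to δ - π < n arg q < δ.
  set δ := Real.pi / 2 - V.arg with hδdef
  have harg := abs_lt.1 (Complex.abs_arg_lt_pi_div_two_iff.2 (Or.inl hV))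
  have hδ0 : 0 < δ := by linarith [harg.2]
  have hδ : δ < Real.pi := by linarith [harg.1]
  have hx : V.re = s * Real.sin δ := by
    rw [hδdef, Real.sin_pi_div_two_sub, Complex.norm_mul_cos_arg]
  have hy : V.im = s * Real.cos δ := by
    rw [hδdef, Real.cos_pi_div_two_sub, Complex.norm_mul_sin_arg]
  have hN : (1 : ℝ) ≤ n := by exact_mod_cast hn
  have hN0 : (0 : ℝ) < n := by linarith
  set q : ℂ := 1 + 2 * Complex.I * κ * V - V ^ 2 with hq
  have hqre : n * q.re = n - 2 * n * s * κ * Real.cos δ +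
      2 * n * s ^ 2 / 2 * (2 * Real.cos δ ^ 2 - 1) := by
    have : q.re = 1 - 2 * κ * V.im - V.re ^ 2 + V.im ^ 2 := by
      simp [hq, pow_two]; ring
    rw [this, hx, hy]
    linear_combination n * s ^ 2 * (-Real.sin_sq_add_cos_sq δ)
  have hqim : n * q.im = Real.sin δ * (2 * n * s * κ - 2 * n * s ^ 2 * Real.cos δ) := by
    have : q.im = 2 * κ * V.re - 2 * V.re * V.im := by
      simp [hq, pow_two]; ring
    rw [this, hx, hy]
    ring
  have hAB : (2 * n * s * κ) ^ 2 ≤ 2 * n * s ^ 2 := by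
    have h1 : 0 ≤ 2 * n * s ^ 2 := by positivity
    nlinarith [mul_le_mul_of_nonneg_left hκ h1]
  have hB : 2 * n * s ^ 2 ≤ 1 := by nlinarith [sq_nonneg s]
  have hNA : (2 : ℝ) ≤ n ∨ 2 * n * s * κ = 0 :=
    hnκ.imp (fun h => by exact_mod_cast h) fun h => by rw [h, mul_zero]
  obtain ⟨h1, h2⟩ := extremal_angle_bound hN hNA hAB hB hδ0 hδ
  -- The lower bound is the upper bound for the conjugate of q, with A and δ replaced by -A and π -
  -- δ.
  obtain ⟨-, h3⟩ := extremal_angle_bound hN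
    (hNA.imp id fun h => by rw [h, neg_zero]) ((neg_sq _).trans_le hAB) hB
    (by linarith : 0 < Real.pi - δ) (by linarith : Real.pi - δ < Real.pi)
  rw [Real.sin_pi_sub, Real.cos_pi_sub] at h3
  rw [← hqre] at h1 h2
  rw [← hqim] at h2
  have hqpos : 0 < q.re := pos_of_mul_pos_right h1 hN0.le
  have h4 : n * q.arg < δ := mul_arg_lt hN0 hδ0 hqpos (by nlinarith)
  have h5 : n * ((starRingEnd ℂ) q).arg < Real.pi - δ := by
    refine mul_arg_lt hN0 (by linarith) (by simpa using hqpos) ?_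
    rw [Complex.conj_re, Complex.conj_im]
    have e1 : Real.sin δ * (-(2 * n * s * κ) - 2 * n * s ^ 2 * -Real.cos δ) = n * -q.im := by
      linear_combination hqim
    have e2 : n - -(2 * n * s * κ) * -Real.cos δ +
        2 * n * s ^ 2 / 2 * (2 * (-Real.cos δ) ^ 2 - 1) = n * q.re := by
      linear_combination -hqre
    rw [e1, e2] at h3
    nlinarith
  rw [Complex.arg_conj, if_neg (fun h => by
    rw [Complex.arg_eq_pi_iff] at h; linarith [h.1])] at h5
  have hq0 : q ≠ 0 := by rintro h; rw [h] at hqpos; simp at hqpos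
  have e : q ^ n * V = (‖q‖ ^ n * s : ℝ) * Complex.exp ((n * q.arg + V.arg : ℝ) * Complex.I) := by
    conv_lhs => rw [← Complex.norm_mul_exp_arg_mul_I q, ← Complex.norm_mul_exp_arg_mul_I V]
    rw [mul_pow, ← Complex.exp_nat_mul]
    push_cast
    rw [add_mul, Complex.exp_add, mul_assoc (n : ℂ)]
    ring
  rw [e, Complex.re_ofReal_mul, Complex.exp_ofReal_mul_I_re]
  refine mul_pos (mul_pos (pow_pos (norm_pos_iff.2 hq0) n) hs)
    (Real.cos_pos_of_mem_Ioo ⟨?_, ?_⟩) <;> linarith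

/-! ### The extremal functions -/

/-- The extremal function divided by `z ^ n`. -/
noncomputable def extremalFactor (n : ℕ) (E z : ℂ) : ℂ :=
  (E + (starRingEnd ℂ) E * z) / (1 - z) ^ (2 * n + 1)

/-- The logarithmic derivative `z f' / f` of the extremal function `f`. -/
noncomputable def extremalLogDeriv (n : ℕ) (E z : ℂ) : ℂ :=
  n * ((1 + z) / (1 - z)) + 2 * E.re * z / ((1 - z) * (E + (starRingEnd ℂ) E * z))

section Extremal

variable {n : ℕ} {E z : ℂ}

lemma one_sub_ne_zero_of_norm_lt (hz : ‖z‖ < 1) : 1 - z ≠ 0 := by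
  intro h
  rw [← sub_eq_zero.1 h, norm_one] at hz
  exact lt_irrefl _ hz

/-- The Möbius map V = (E + Ē z)/(1 - z) sends the disc to the right half-plane: Re V = Re E (1 -
|z|²)/|1 - z|². -/
lemma extremal_re_pos (hE : 0 < E.re) (hz : ‖z‖ < 1) :
    0 < ((E + (starRingEnd ℂ) E * z) / (1 - z)).re := by
  have h1 : 0 < Complex.normSq (1 - z) :=
    Complex.normSq_pos.2 (one_sub_ne_zero_of_norm_lt hz)
  have h2 : ((E + (starRingEnd ℂ) E * z) / (1 - z)).re =
      E.re * (1 - ‖z‖ ^ 2) / Complex.normSq (1 - z) := by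
    rw [Complex.div_re, ← add_div, ← Complex.normSq_eq_norm_sq, Complex.normSq_apply z]
    congr 1
    simp
    ring
  rw [h2]
  exact div_pos (mul_pos hE (by nlinarith [norm_nonneg z])) h1

lemma extremal_numerator_ne_zero (hE : 0 < E.re) (hz : ‖z‖ < 1) :
    E + (starRingEnd ℂ) E * z ≠ 0 := by
  intro h
  have := extremal_re_pos hE hz
  rw [h] at this
  simp at this

lemma conj_eq_of_norm_one (hE : ‖E‖ = 1) :
    (starRingEnd ℂ) E = E.re - E.im * Complex.I ∧ (E.im : ℂ) ^ 2 = 1 - (E.re : ℂ) ^ 2 := by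
  constructor
  · apply Complex.ext <;> simp
  · have : E.re ^ 2 + E.im ^ 2 = 1 := by
      have := Complex.normSq_eq_norm_sq E
      rw [hE, Complex.normSq_apply] at this
      linarith
    exact_mod_cast (by linarith : E.im ^ 2 = 1 - E.re ^ 2)

/-- Expresses z/(1 - z)² through V, so that the extremal function becomes a real multiple of (1 + 2i
Im E · V - V²)^n V. -/
lemma extremal_quadratic (hE : ‖E‖ = 1) {V : ℂ} (hz : 1 - z ≠ 0)
    (hV : E + (starRingEnd ℂ) E * z = V * (1 - z)) :
    1 + 2 * Complex.I * E.im * V - V ^ 2 = -4 * E.re ^ 2 * (z / (1 - z) ^ 2) := by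
  obtain ⟨h1, h2⟩ := conj_eq_of_norm_one hE
  have h3 : E = E.re + E.im * Complex.I := (Complex.re_add_im E).symm
  have hV' : E.re + E.im * Complex.I + (E.re - E.im * Complex.I) * z = V * (1 - z) := by
    rw [← h1, ← h3, hV]
  rw [← mul_div_assoc, eq_div_iff (pow_ne_zero 2 hz)]
  generalize (E.re : ℂ) = a at *
  generalize (E.im : ℂ) = b at *
  linear_combination (-(2 * Complex.I * b * (1 - z)) + (V * (1 - z) +
    (a + b * Complex.I + (a - b * Complex.I) * z))) * hV' +
    (1 - z) ^ 2 * (b ^ 2 * Complex.I_sq - h2)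

/-- In terms of V, 2 Re E times the logarithmic derivative is (2n + 1) V - 1/V minus an imaginary
constant, so its real part is positive as soon as (2n + 1)|V|² > 1. For smaller V, `re_pow_mul_pos`
shows that the real part of the extremal function does not vanish. -/
lemma extremalLogDeriv_re_pos (hn : 1 ≤ n) (hE1 : ‖E‖ = 1) (hE : 0 < E.re)
    (hn2 : 2 * n * E.im ^ 2 ≤ 1) (hnE : 2 ≤ n ∨ E.im = 0) (hz : ‖z‖ < 1)
    (h : (z ^ n * extremalFactor n E z).re = 0) : 0 < (extremalLogDeriv n E z).re := by
  set V := (E + (starRingEnd ℂ) E * z) / (1 - z) with hV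
  have hz1 := one_sub_ne_zero_of_norm_lt hz
  have hVre : 0 < V.re := extremal_re_pos hE hz
  have hV0 : V ≠ 0 := by intro h; rw [h] at hVre; simp at hVre
  have hnum : E + (starRingEnd ℂ) E * z = V * (1 - z) := (div_mul_cancel₀ _ hz1).symm
  have hQ := extremal_quadratic hE1 hz1 hnum
  clear_value V
  have hlt : 1 < (2 * n + 1) * ‖V‖ ^ 2 := by
    by_contra hle
    have h1 := re_pow_mul_pos hn hn2 hnE hVre (not_lt.1 hle)
    have h2 : (1 + 2 * Complex.I * E.im * V - V ^ 2) ^ n * V =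
        ((-4 * E.re ^ 2) ^ n : ℝ) * (z ^ n * extremalFactor n E z) := by
      rw [hQ, extremalFactor, hnum]
      push_cast
      rw [mul_pow, div_pow, ← pow_mul, pow_succ (1 - z), mul_div_mul_right _ _ hz1]
      ring
    rw [h2, Complex.re_ofReal_mul, h, mul_zero] at h1
    exact lt_irrefl _ h1
  have hG : (2 * E.re : ℝ) * extremalLogDeriv n E z =
      (2 * n + 1 : ℝ) * V - V⁻¹ - (2 * (n + 1) * E.im : ℝ) * Complex.I := by
    have hw : E.re * ((1 + z) / (1 - z)) = V - E.im * Complex.I := by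
      rw [← mul_div_assoc, div_eq_iff hz1, sub_mul, ← hnum, (conj_eq_of_norm_one hE1).1]
      nth_rewrite 2 [← Complex.re_add_im E]
      ring
    have hq : 2 * E.re * (2 * E.re * z / ((1 - z) * (V * (1 - z)))) =
        4 * E.re ^ 2 * (z / (1 - z) ^ 2) * V⁻¹ := by
      rw [div_eq_mul_inv, mul_inv, mul_inv, div_eq_mul_inv, ← inv_pow]
      ring
    have hVV : V * V⁻¹ = 1 := mul_inv_cancel₀ hV0
    rw [extremalLogDeriv, hnum]
    push_cast
    linear_combination 2 * n * hw + hq + (V - 2 * Complex.I * E.im) * hVV + V⁻¹ * hQ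
  have h1 := congrArg Complex.re hG
  rw [Complex.re_ofReal_mul, Complex.sub_re, Complex.sub_re, Complex.re_ofReal_mul,
    Complex.re_ofReal_mul, Complex.I_re, Complex.inv_re, Complex.normSq_eq_norm_sq, mul_zero,
    sub_zero] at h1
  have hVn : 0 < ‖V‖ ^ 2 := by positivity
  have h2 : 0 < (2 * n + 1) * V.re - V.re / ‖V‖ ^ 2 := by
    rw [sub_pos, div_lt_iff₀ hVn]
    nlinarith
  rw [← h1] at h2
  exact pos_of_mul_pos_right h2 (by linarith)

lemma hasDerivAt_extremal (hE : 0 < E.re) (hz : ‖z‖ < 1) :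
    ∃ d, HasDerivAt (fun z => z ^ n * extremalFactor n E z) d z ∧
      extremalLogDeriv n E z * (z ^ n * extremalFactor n E z) = z * d := by
  have hz1 := one_sub_ne_zero_of_norm_lt hz
  have hnum := extremal_numerator_ne_zero hE hz
  have h1 : HasDerivAt (fun z : ℂ => E + (starRingEnd ℂ) E * z) ((starRingEnd ℂ) E) z := by
    simpa using ((hasDerivAt_id z).const_mul ((starRingEnd ℂ) E)).const_add E
  have h2 : HasDerivAt (fun z : ℂ => (1 - z) ^ (2 * n + 1)) _ z :=
    ((hasDerivAt_id z).const_sub 1).pow (2 * n + 1)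
  refine ⟨_, (hasDerivAt_pow n z).mul (h1.div h2 (pow_ne_zero _ hz1)), ?_⟩
  have h3 : z * (n * z ^ (n - 1)) = n * z ^ n := by
    rcases n.eq_zero_or_pos with rfl | h
    · simp
    · rw [mul_left_comm, mul_pow_sub_one h.ne']
  have h4 : (starRingEnd ℂ) E + E = 2 * E.re := by
    rw [add_comm, Complex.add_conj]
    push_cast
    ring
  rw [extremalFactor, extremalLogDeriv, mul_add z, ← mul_assoc z, h3]
  simp only [Nat.add_sub_cancel, id]
  rw [pow_succ (1 - z)]
  have hP : (1 - z) ^ (2 * n) ≠ 0 := pow_ne_zero _ hz1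
  generalize (1 - z) ^ (2 * n) = P at *
  generalize z ^ n = Z at *
  generalize hN : E + (starRingEnd ℂ) E * z = N at *
  push_cast
  field_simp
  linear_combination Z * z * (hN - h4)

end Extremal

lemma deriv_extremalFactor_zero (n : ℕ) (E : ℂ) :
    deriv (extremalFactor n E) 0 = (starRingEnd ℂ) E + (2 * n + 1) * E := by
  have h1 : HasDerivAt (fun z : ℂ => E + (starRingEnd ℂ) E * z) ((starRingEnd ℂ) E) 0 := by
    simpa using ((hasDerivAt_id (0 : ℂ)).const_mul ((starRingEnd ℂ) E)).const_add E
  have h2 : HasDerivAt (fun z : ℂ => (1 - z) ^ (2 * n + 1)) _ 0 :=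
    ((hasDerivAt_id (0 : ℂ)).const_sub 1).pow (2 * n + 1)
  have h3 : HasDerivAt (extremalFactor n E) _ 0 := h1.div h2 (by simp)
  rw [h3.deriv]
  simp
  ring

lemma analyticAt_extremalFactor {n : ℕ} {E z : ℂ} (hz : ‖z‖ < 1) :
    AnalyticAt ℂ (extremalFactor n E) z := by
  unfold extremalFactor
  exact (analyticAt_const.add (analyticAt_const.mul analyticAt_id)).div
    ((analyticAt_const.sub analyticAt_id).pow _) (pow_ne_zero _ (one_sub_ne_zero_of_norm_lt hz))

/-! ### Sharpness of the bounds -/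

/-- The dilated extremal functions have curvatures approaching the bound. -/
theorem exists_isAdmissible_curvature {n : ℕ} {E : ℂ} (hn : 1 ≤ n) (hE1 : ‖E‖ = 1) (hE : 0 < E.re)
    (hn2 : 2 * n * E.im ^ 2 ≤ 1) (hnE : 2 ≤ n ∨ E.im = 0)
    (hpow : (Complex.I * E) ^ (n + 1) = 1 ∨ (Complex.I * E) ^ (n + 1) = -1) {r a : ℝ} (hr : 0 < r)
    (ha : 0 < a) (har : a * r < 1) :
    ∃ u, IsAdmissible n r u ∧ ∃ Γ, IsNodalCurve r u Γ ∧ ∃ κ, HasCurvatureAt Γ 0 κ ∧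
      |κ| = 4 * (n + 1) * a / n * E.re := by
  set f : ℂ → ℂ := fun z => z ^ n * extremalFactor n E z with hf
  set F : ℂ → ℂ := fun z => f (a * z) with hF
  set h : ℂ → ℂ := fun z => a ^ n * extremalFactor n E (a * z) with hh
  have hE0 : E ≠ 0 := by rintro rfl; simp at hE
  have ha0 : (a : ℂ) ≠ 0 := by exact_mod_cast ha.ne'
  have hlt : ∀ {z : ℂ}, z ∈ Metric.ball (0 : ℂ) a⁻¹ → ‖(a : ℂ) * z‖ < 1 := fun {z} hz => by
    rw [mem_ball_zero_iff] at hz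
    rw [norm_mul, Complex.norm_real, Real.norm_of_nonneg ha.le, ← mul_inv_cancel₀ ha.ne']
    exact mul_lt_mul_of_pos_left hz ha
  have hrR : r < a⁻¹ := by rwa [lt_inv_comm₀ hr ha, ← one_div, lt_div_iff₀ hr]
  have hsub : Metric.ball (0 : ℂ) r ⊆ Metric.ball 0 a⁻¹ := Metric.ball_subset_ball hrR.le
  have hmul : ∀ z : ℂ, AnalyticAt ℂ (fun z : ℂ => (a : ℂ) * z) z := fun z =>
    analyticAt_const.mul analyticAt_id
  have hFR : AnalyticOnNhd ℂ F (Metric.ball 0 a⁻¹) := fun z hz => by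
    have h1 : AnalyticAt ℂ f (a * z) := (analyticAt_id.pow n).mul (analyticAt_extremalFactor (hlt hz))
    exact AnalyticAt.fun_comp (g := f) h1 (hmul z)
  have hFh : ∀ z, F z = z ^ n * h z := fun z => by
    simp only [hF, hf, hh, mul_pow]; ring
  have hha : AnalyticAt ℂ h 0 := by
    have h1 : AnalyticAt ℂ (extremalFactor n E) (a * 0) := analyticAt_extremalFactor (by simp)
    exact analyticAt_const.mul (AnalyticAt.fun_comp (g := extremalFactor n E) h1 (hmul 0))
  have hh0 : h 0 = a ^ n * E := by simp [hh, extremalFactor]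
  have hh0' : h 0 ≠ 0 := by rw [hh0]; exact mul_ne_zero (pow_ne_zero n ha0) hE0
  have hF0 : F 0 = 0 := by rw [hFh, zero_pow (by omega), zero_mul]
  have hhd : deriv h 0 = a ^ (n + 1) * ((starRingEnd ℂ) E + (2 * n + 1) * E) := by
    have h1 : deriv h 0 = a ^ n * deriv (fun z => extremalFactor n E (a * z)) 0 :=
      deriv_const_mul_field _
    rw [h1, deriv_comp_mul_left, mul_zero, deriv_extremalFactor_zero, smul_eq_mul]
    ring
  have hFn : IsNonconstHolo r F := isNonconstHolo_of_order hr hn (hFR.mono hsub) hha hh0'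
    (Eventually.of_forall hFh)
  have hct : CurvesThroughZero r F := by
    refine hFn.curvesThroughZero (G := fun z => extremalLogDeriv n E (a * z)) ?_ ?_ ?_ ?_
    · intro z hz
      have hz' := hlt (hsub hz)
      have h1 := one_sub_ne_zero_of_norm_lt hz'
      have h2 := extremal_numerator_ne_zero hE hz'
      unfold extremalLogDeriv
      exact ContinuousAt.continuousWithinAt (by fun_prop (disch := simp [h1, h2]))
    · intro z hz
      obtain ⟨d, hd, hd'⟩ := hasDerivAt_extremal (n := n) hE (hlt (hsub hz))
      have h1 : deriv F z = a * d := by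
        have : deriv F z = (a : ℂ) • deriv f (a * z) := deriv_comp_mul_left _ _ _
        rw [this, hd.deriv, smul_eq_mul]
      rw [h1]
      refine hd'.trans (by ring)
    · intro z hz hFz
      by_contra hz0
      have hz' := hlt (hsub hz)
      refine mul_ne_zero (pow_ne_zero n (mul_ne_zero ha0 hz0)) ?_ hFz
      exact div_ne_zero (extremal_numerator_ne_zero hE hz')
        (pow_ne_zero _ (one_sub_ne_zero_of_norm_lt hz'))
    · intro z hz
      exact extremalLogDeriv_re_pos hn hE1 hE hn2 hnE (hlt (hsub hz.1)) hz.2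
  refine ⟨_, hFn.isAdmissible_re hct hr hrR hFR hF0 hha hh0' (Eventually.of_forall hFh), ?_⟩
  obtain ⟨e, he, hpe⟩ : ∃ e : ℝ, (e = 1 ∨ e = -1) ∧ (Complex.I * E) ^ (n + 1) = e := by
    rcases hpow with h1 | h1
    · exact ⟨1, Or.inl rfl, by rw [h1]; simp⟩
    · exact ⟨-1, Or.inr rfl, by rw [h1]; simp⟩
  -- The direction iE is nodal, since (iE)^n E = -i (iE)^{n+1} with (iE)^{n+1} = ±1.
  have hτn : ((Complex.I * E) ^ n * h 0).re = 0 := by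
    have h1 : (Complex.I * E) ^ n * h 0 = (-(a ^ n * e) : ℝ) * Complex.I := by
      rw [hh0]
      push_cast
      rw [← hpe, pow_succ]
      linear_combination ((Complex.I * E) ^ n * a ^ n * E) * Complex.I_sq
    rw [h1, Complex.re_ofReal_mul, Complex.I_re, mul_zero]
  obtain ⟨Γ, hΓ, κ, hκ, hκe⟩ := hFn.exists_nodal_curvature hr hn hF0 hha hh0' (fun z _ => hFh z)
    (τ := Complex.I * E) (by rw [norm_mul, Complex.norm_I, hE1, one_mul]) hτn
  refine ⟨Γ, hΓ, κ, hκ, ?_⟩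
  -- Both terms of the derivative, Ē and (2n + 1) E, have real parts of the same sign and add up to
  -- (2n + 2) Re E.
  have h1 : ((Complex.I * E) ^ (n + 1) * deriv h 0).re =
      e * (a ^ (n + 1) * ((2 * n + 2) * E.re)) := by
    rw [hpe, hhd, Complex.re_ofReal_mul, ← Complex.ofReal_pow, Complex.re_ofReal_mul]
    congr 2
    simp
    ring
  have hpos : 0 ≤ a ^ (n + 1) * ((2 * n + 2) * E.re) := by positivity
  have he1 : |e| = 1 := by rcases he with rfl | rfl <;> simp
  rw [h1, abs_mul, he1, one_mul, abs_of_nonneg hpos, hh0, norm_mul, hE1, mul_one, norm_pow,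
    Complex.norm_real, Real.norm_of_nonneg ha.le] at hκe
  have hn0 : (0 : ℝ) < n := by exact_mod_cast hn
  have hap : 0 < a ^ n := pow_pos ha n
  rw [div_mul_eq_mul_div, eq_div_iff hn0.ne']
  apply mul_right_cancel₀ hap.ne'
  rw [pow_succ] at hκe
  linear_combination hκe

/-- Dilate by a = ρ/r and let ρ tend to 1 from below. -/
theorem isSharpCurvatureBound_of_extremal {n : ℕ} {E : ℂ} (hn : 1 ≤ n) (hE1 : ‖E‖ = 1)
    (hE : 0 < E.re) (hn2 : 2 * n * E.im ^ 2 ≤ 1) (hnE : 2 ≤ n ∨ E.im = 0)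
    (hpow : (Complex.I * E) ^ (n + 1) = 1 ∨ (Complex.I * E) ^ (n + 1) = -1) {r : ℝ} (hr : 0 < r) :
    IsSharpCurvatureBound n r (4 * ((n : ℝ) + 1) / ((n : ℝ) * r) * E.re) := by
  intro C' hC'
  have hn0 : (0 : ℝ) < n := by exact_mod_cast hn
  have h1 : Tendsto (fun ρ : ℝ => ρ * (4 * ((n : ℝ) + 1) / ((n : ℝ) * r) * E.re)) (𝓝[<] 1)
      (𝓝 (1 * (4 * ((n : ℝ) + 1) / ((n : ℝ) * r) * E.re))) :=
    (tendsto_id.mul_const _).mono_left nhdsWithin_le_nhds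
  rw [one_mul] at h1
  obtain ⟨ρ, hρ, hρ0, hρ1⟩ :=
    ((h1.eventually (lt_mem_nhds hC')).and (Ioo_mem_nhdsLT zero_lt_one)).exists
  obtain ⟨u, hu, Γ, hΓ, κ, hκ, hκe⟩ := exists_isAdmissible_curvature hn hE1 hE hn2 hnE hpow hr
    (div_pos hρ0 hr) (by rwa [div_mul_cancel₀ _ hr.ne'])
  refine ⟨u, hu, Γ, hΓ, κ, hκ, ?_⟩
  rw [hκe]
  refine hρ.trans_eq ?_
  field_simp

theorem isSharpCurvatureBound_of_odd {n : ℕ} (ho : Odd n) {r : ℝ} (hr : 0 < r) :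
    IsSharpCurvatureBound n r (4 * ((n : ℝ) + 1) / ((n : ℝ) * r)) := by
  -- For odd n the exponent n + 1 is even, so i^{n+1} = ±1 and E = 1 is allowed.
  have h := isSharpCurvatureBound_of_extremal (n := n) (E := 1) ho.pos (by simp) (by simp)
    (by simp) (Or.inr (by simp)) (by
      obtain ⟨k, rfl⟩ := ho
      rw [mul_one, show 2 * k + 1 + 1 = 2 * (k + 1) by ring, pow_mul, Complex.I_sq]
      exact neg_one_pow_eq_or ℂ (k + 1)) hr
  simpa using h

theorem isSharpCurvatureBound_of_even {n : ℕ} (hn : 1 ≤ n) (he : Even n) {r : ℝ} (hr : 0 < r) :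
    IsSharpCurvatureBound n r
      (4 * ((n : ℝ) + 1) / ((n : ℝ) * r) * Real.cos (Real.pi / (2 * ((n : ℝ) + 1)))) := by
  have hn2 : 2 ≤ n := by obtain ⟨k, rfl⟩ := he; omega
  have hN : (2 : ℝ) ≤ n := by exact_mod_cast hn2
  set x := Real.pi / (2 * ((n : ℝ) + 1)) with hx
  have hx0 : 0 < x := by positivity
  have hxpi : x * (2 * ((n : ℝ) + 1)) = Real.pi := div_mul_cancel₀ _ (by positivity)
  have hx2 : x < Real.pi / 2 := by nlinarith
  -- Equality holds for n = 2, where x = π/6; for n ≥ 4 the bound sin x ≤ x is enough.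
  have hsin : 2 * n * Real.sin x ^ 2 ≤ 1 := by
    rcases hn2.eq_or_lt with h2 | h2
    · have : x = Real.pi / 6 := by rw [hx, ← h2]; norm_num
      rw [this, ← h2, Real.sin_pi_div_six]
      norm_num
    · have h4 : (4 : ℝ) ≤ n := by
        have : 4 ≤ n := by obtain ⟨k, rfl⟩ := he; omega
        exact_mod_cast this
      have h1 : Real.sin x ≤ x := Real.sin_le hx0.le
      have h3 : 0 ≤ Real.sin x := Real.sin_nonneg_of_nonneg_of_le_pi hx0.le
        (by linarith [Real.pi_pos])
      have h5 : x * (2 * ((n : ℝ) + 1)) ≤ 3.15 := hxpi.le.trans Real.pi_lt_d2.le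
      have h7 : (x * (2 * ((n : ℝ) + 1))) ^ 2 ≤ 3.15 ^ 2 := pow_le_pow_left₀ (by positivity) h5 2
      have h8 : 2 * (n : ℝ) * 3.15 ^ 2 ≤ (2 * ((n : ℝ) + 1)) ^ 2 := by nlinarith
      have h9 : 0 < (2 * ((n : ℝ) + 1)) ^ 2 := by positivity
      have h10 : 2 * n * x ^ 2 ≤ 1 := by
        apply le_of_mul_le_mul_right _ h9
        rw [one_mul]
        refine le_trans ?_ h8
        rw [mul_pow] at h7
        nlinarith
      nlinarith
  have h := isSharpCurvatureBound_of_extremal (n := n) (E := Complex.exp (x * Complex.I)) hn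
    (Complex.norm_exp_ofReal_mul_I x) (by
      rw [Complex.exp_ofReal_mul_I_re]
      exact Real.cos_pos_of_mem_Ioo ⟨by linarith, hx2⟩)
    (by rwa [Complex.exp_ofReal_mul_I_im]) (Or.inl hn2) (by
      -- Hence (iE)^{n+1} = i^{n+2}, which is ±1 because n is even.
      have h1 : Complex.exp (x * Complex.I) ^ (n + 1) = Complex.I := by
        rw [← Complex.exp_nat_mul]
        refine Eq.trans ?_ Complex.exp_pi_div_two_mul_I
        congr 1
        have h2 : (x : ℂ) * (2 * ((n : ℂ) + 1)) = Real.pi := by exact_mod_cast hxpi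
        push_cast
        linear_combination Complex.I / 2 * h2
      obtain ⟨k, rfl⟩ := he
      rw [mul_pow, h1, ← pow_succ, show k + k + 1 + 1 = 2 * (k + 1) by ring, pow_mul, Complex.I_sq]
      exact neg_one_pow_eq_or ℂ (k + 1)) hr
  rwa [Complex.exp_ofReal_mul_I_re] at h

theorem mainTheorem1 (n : ℕ) (hn : 1 ≤ n) (r₀ : ℝ) (hr₀ : 0 < r₀) :
    IsCurvatureBound n r₀ (4 * ((n : ℝ) + 1) / ((n : ℝ) * r₀)) ∧
    (Odd n → IsSharpCurvatureBound n r₀ (4 * ((n : ℝ) + 1) / ((n : ℝ) * r₀))) ∧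
    (Even n →
      IsCurvatureBound n r₀
        (4 * ((n : ℝ) + 1) / ((n : ℝ) * r₀) * Real.cos (Real.pi / (2 * ((n : ℝ) + 1)))) ∧
      IsSharpCurvatureBound n r₀
        (4 * ((n : ℝ) + 1) / ((n : ℝ) * r₀) * Real.cos (Real.pi / (2 * ((n : ℝ) + 1))))) := by
  exact ⟨isCurvatureBound hn hr₀, fun ho => isSharpCurvatureBound_of_odd ho hr₀,
    fun he => ⟨isCurvatureBound_of_even hn he hr₀, isSharpCurvatureBound_of_even hn he hr₀⟩⟩
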